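/- **Setting.** Let $H$ be a real separable Hilbert space with inner product $(\cdot,\cdot)$ and norm $\|\cdot\|$, and let $A$ be a densely defined, nonnegative, self-adjoint operator on $H$ with compact inverse. Its fractional powers are defined by the spectral decomposition, $A^{r}x=\sum_{\mu}\mu^{r}P_\mu x$ for $x\in D(A^r)=\{x\in H:\sum_\mu \mu^{2r}\|P_\mu x\|^2<\infty\}$, where $\mu$ runs over the eigenvalues of $A$ and $P_\mu$ is the orthogonal projection onto the eigenspace of $\mu$; put $\|x\|_r=\|A^{r/2}x\|$ for $x\in D(A^{r/2})$. Let $b$ be a kernel satisfying the following assumption: $0\ne b\in L^1_{\mathrm{loc}}(\mathbb R_+)$ is $3$-monotone, that is, $b$ is differentiable on $(0,\infty)$ and both $b$ and $-\dot b$ are nonnegative, nonincreasing and convex there; $\lim_{t\to\infty}b(t)=0$; and, with $\widehat b(z)=\int_0^\infty b(t)e^{-zt}\,dt$, $$\rho:=1+\frac2\pi\sup\{|\arg\widehat b(z)|:\operatorname{Re}z>0\}\in(1,2).$$ Let $\{S(t)\}_{t\ge0}\subset\mathcal B(H)$ be the resolvent family of $$\dot u(t)+\int_0^t b(t-s)Au(s)\,ds=0,\quad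 t>0,\qquad u(0)=x,$$ that is, the strongly continuous family that commutes with $A$ on $D(A)$ and for which $u(t)=S(t)x$ solves this problem for all $x\in D(A)$. For $0<h<1$ let $V_h$ be a finite-dimensional subspace of $D(A^{1/2})$, let $P_h:H\to V_h$ be the orthogonal projection, let $A_h:V_h\to V_h$ be given by $(A_h\psi,\chi)=(A^{1/2}\psi,A^{1/2}\chi)$ for $\psi,\chi\in V_h$, and let $\{S_h(t)\}_{t\ge0}\subset\mathcal B(V_h)$ be the resolvent family of the same problem on $V_h$ with $A_h$ in place of $A$. Let $R_h:D(A^{1/2})\to V_h$ be the Ritz projection, $(A^{1/2}R_hv,A^{1/2}\chi)=(A^{1/2}v,A^{1/2}\chi)$ for $v\in D(A^{1/2})$, $\chi\in V_h$. (In the main example, $A=-\Delta$ on $H=L^2(\mathcal D)$ with Dirichlet boundary conditions, $D(A^{1/2})=H^1_0(\mathcal D)$, $(A^{1/2}u,A^{1/2}v)=(\nabla u,\nabla v)$, and $V_h$ consists of the continuous piecewise linear functions on a triangulation of mesh size $h$ that vanish on the boundary.) **Proposition.** Assume that there is a constant $C_R$ such that, for all $0<h<1$ and $1\le\gamma\le2$,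 $$\|R_hv-v\|\le C_R\,h^{\gamma}\|v\|_{\gamma},\qquad v\in D(A^{\gamma/2}).$$ Then there is a constant $C$, independent of $h$, $s$ and $x$, such that for all $0<h<1$, all $0\le s\le2$ and all $x\in H$ with $x\in D(A^{(s-1/\rho)/2})$ (no restriction if $s\le1/\rho$), the integral below is finite and $$\int_0^\infty\|S(t)x-S_h(t)P_hx\|^2\,dt\le C\,h^{2s}\,\|x\|^2_{s-1/\rho}.$$ -/

import Mathlib

open Set Filter MeasureTheory Topology
open scoped RealInnerProductSpace

noncomputable section

namespace Volterra

/-! ### The kernel -/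

/-- The Laplace transform `∫₀^∞ b(t) exp(-z t) dt` of a real kernel, for `Re z > 0`. -/
def laplace (b : ℝ → ℝ) (z : ℂ) : ℂ :=
  ∫ t in Ioi (0 : ℝ), (b t : ℂ) * Complex.exp (-z * t)

/-- `ρ = 1 + (2/π) sup {|arg b̂(z)| : Re z > 0}`. The set is nonempty and bounded by `π`. -/
def rho (b : ℝ → ℝ) : ℝ :=
  1 + 2 / Real.pi * sSup {a : ℝ | ∃ z : ℂ, 0 < z.re ∧ a = |Complex.arg (laplace b z)|}

/-- The standing assumption on the kernel: `0 ≠ b ∈ L¹_loc(ℝ₊)` is 3-monotone, tends to zero at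
infinity, and `ρ ∈ (1, 2)`. Only the values of `b` on `(0, ∞)` matter. -/
structure IsAdmissibleKernel (b : ℝ → ℝ) : Prop where
  ne_zero : ∃ t, 0 < t ∧ b t ≠ 0
  /-- integrability on bounded intervals, up to the endpoint `0` -/
  locallyIntegrable : ∀ T : ℝ, 0 < T → IntegrableOn b (Ioc 0 T)
  differentiableOn : DifferentiableOn ℝ b (Ioi 0)
  nonneg : ∀ t, 0 < t → 0 ≤ b t
  antitoneOn : AntitoneOn b (Ioi 0)
  convexOn : ConvexOn ℝ (Ioi 0) b
  neg_deriv_nonneg : ∀ t, 0 < t → 0 ≤ -deriv b t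
  neg_deriv_antitoneOn : AntitoneOn (fun t => -deriv b t) (Ioi 0)
  neg_deriv_convexOn : ConvexOn ℝ (Ioi 0) (fun t => -deriv b t)
  tendsto_zero : Tendsto b atTop (𝓝 0)
  one_lt_rho : 1 < rho b
  rho_lt_two : rho b < 2

/-! ### The resolvent family of the Volterra equation -/

/-- `S` is the resolvent family of `u'(t) + ∫₀ᵗ b(t-s) A u(s) ds = 0`: it is strongly continuous on
`[0, ∞)` with `S(0) = I`, it leaves `D(A)` invariant and commutes with `A` there, and `u = S(·) x`
solves the equation for every `x ∈ D(A)` (where `A u(s) = A S(s) x = S(s) A x`). These properties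
determine `S(t)` for `t ≥ 0`; the values at negative times are irrelevant. -/
structure IsResolventFamily {E : Type*} [NormedAddCommGroup E] [NormedSpace ℝ E]
    (b : ℝ → ℝ) (A : E →ₗ.[ℝ] E) (S : ℝ → E →L[ℝ] E) : Prop where
  zero : S 0 = ContinuousLinearMap.id ℝ E
  continuousOn : ∀ x : E, ContinuousOn (fun t => S t x) (Ici 0)
  commute : ∀ t, 0 ≤ t → ∀ x : A.domain,
    ∃ hx : S t x ∈ A.domain, A ⟨S t x, hx⟩ = S t (A x)
  hasDerivAt : ∀ x : A.domain, ∀ t, 0 < t →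
    HasDerivAt (fun τ => S τ x) (-∫ s in (0 : ℝ)..t, b (t - s) • S s (A x)) t

/-! ### The operator `A` and its fractional powers -/

variable {H : Type*} [NormedAddCommGroup H] [InnerProductSpace ℝ H] [CompleteSpace H]

/-- `A` is a densely defined, nonnegative, self-adjoint operator with compact inverse. -/
structure IsPositiveWithCompactInverse (A : H →ₗ.[ℝ] H) : Prop where
  dense_domain : Dense (A.domain : Set H)
  selfAdjoint : IsSelfAdjoint A
  nonneg : ∀ x : A.domain, 0 ≤ ⟪A x, (x : H)⟫
  compact_inverse : ∃ T : H →L[ℝ] H, IsCompactOperator T ∧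
    (∀ y : H, ∃ hy : T y ∈ A.domain, A ⟨T y, hy⟩ = y) ∧ ∀ x : A.domain, T (A x) = x

/-- The eigenspace `{x ∈ D(A) : A x = μ x}`. -/
def eigenspace (A : H →ₗ.[ℝ] H) (μ : ℝ) : Submodule ℝ H :=
  (LinearMap.ker (A.toFun - μ • A.domain.subtype)).map A.domain.subtype

/-- The orthogonal projection of `H` onto the eigenspace of `A` for `μ`; it is zero if `μ` is not an
eigenvalue. (For self-adjoint `A` the eigenspace is closed, so the closure changes nothing.) -/
def eigenproj (A : H →ₗ.[ℝ] H) (μ : ℝ) : H →L[ℝ] H :=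
  (eigenspace A μ).topologicalClosure.starProjection

/-- `D(A^r)`, by the spectral decomposition of `A`: all `x` with `∑ μ^(2r) ‖P_μ x‖² < ∞`. -/
def fracDomain (A : H →ₗ.[ℝ] H) (r : ℝ) : Set H :=
  {x | Summable fun μ : ℝ => μ ^ (2 * r) * ‖eigenproj A μ x‖ ^ 2}

/-- `A^r x = ∑ μ^r P_μ x` for `x ∈ D(A^r)`, the sum being over the eigenvalues of `A`. -/
def fracPow (A : H →ₗ.[ℝ] H) (r : ℝ) (x : H) : H :=
  ∑' μ : ℝ, μ ^ r • eigenproj A μ x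

/-- The norm `‖x‖_r = ‖A^(r/2) x‖`, for `x ∈ D(A^(r/2))`. -/
def fracNorm (A : H →ₗ.[ℝ] H) (r : ℝ) (x : H) : ℝ :=
  ‖fracPow A (r / 2) x‖

/-- The energy form `(A^(1/2) u, A^(1/2) v)` on `D(A^(1/2))`. For `A = -Δ` with Dirichlet boundary
conditions, `D(A^(1/2))` is `H¹₀` and this is `(∇u, ∇v)`. -/
def energy (A : H →ₗ.[ℝ] H) (u v : H) : ℝ :=
  ⟪fracPow A (1 / 2) u, fracPow A (1 / 2) v⟫

end Volterra

end

/-!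
The estimate is obtained in the frequency domain, where the equation turns into a family of scalar
problems `s' + l (b * s) = 0` with transforms `ŝ = s(0) / (z + l b̂(z))`.

*The symbol.* The values of `b̂` lie in a sector of half-angle `(ρ - 1) π/2 < π/2`, so that
`|z + l b̂(z)|` dominates both `|z|` and `l |b̂(z)|`. Convexity of `b` bounds `|b̂(z)|` below by the
values of `b̂` on the real axis (`IsAdmissibleKernel.laplaceReal_le_norm`), and the Schwarz lemma,
applied to `b̂^(1/(ρ-1))`, shows `b̂(x) ≥ c x^(1-ρ)` for `x ≥ 1`
(`IsAdmissibleKernel.laplaceReal_one_mul_rpow_le`). Together `|z + l b̂(z)| ≥ c (|Im z| + l^(1/ρ))`,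
and Plancherel's identity gives `∫ s² ≤ C l^(-1/ρ) s(0)²`
(`IsAdmissibleKernel.exists_lintegral_sq_le`). Boundedness of `s`, which makes its transform
meaningful, and uniqueness follow from the positivity `∫ s (b * s) ≥ 0` (`energy_nonneg`).

*Stability.* Summation over the eigenvalues of `A` yields `∫ ‖S(t) x‖² ≤ C ‖x‖²_{-1/ρ}`. For the
discrete family one obtains the norm of `A_h^(-1/(2ρ)) P_h x`, which is at most `‖x‖_{-1/ρ}`: this
holds for resolvents by the variational characterization (`sum_inner_sq_div_le`), and hence for
negative powers by the integral representation of `x^(-α)`.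

*Error for data in `D(A)`.* With `y = S(t) x` and `r = R_h S(t) x`, tested with a discrete
eigenvector, the solution `v` of the discrete problem satisfies
`(z + l b̂) (v̂ - r̂) = z (ŷ - r̂)`. Since `|z| ≤ C |z + l b̂|`, the error is controlled by the Ritz
error `‖S(t) x - R_h S(t) x‖ ≤ C h² ‖S(t) A x‖` (`lintegral_error_sq_le`).

*Interpolation.* Splitting `x` at the frequency `h⁻²`, stability handles the upper part and the
error estimate for smooth data the lower one (`lintegral_error_sq_le_spectralSum`).
-/

noncomputable section

namespace Volterra

open scoped ComplexConjugate FourierTransform SchwartzMap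

/-! ### Plancherel's identity for the Laplace transform -/

/-- The Fourier transform on `L²` extends the Fourier integral: both define the same tempered
distribution, by the self-adjointness of the Fourier integral on `L¹`. -/
theorem fourier_toLp_ae_eq {f : ℝ → ℂ} (h1 : Integrable f) (h2 : MemLp f 2) :
    (𝓕 (h2.toLp f) : Lp ℂ 2 (volume : Measure ℝ)) =ᵐ[volume] 𝓕 f := by
  have hcont : Continuous (𝓕 f) :=
    VectorFourier.fourierIntegral_continuous Real.continuous_fourierChar
      (by exact continuous_inner) h1
  apply ae_eq_of_integral_contDiff_smul_eq
  · exact (Lp.memLp _).locallyIntegrable (by norm_num)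
  · exact hcont.locallyIntegrable
  intro g hg hgc
  let φ : 𝓢(ℝ, ℂ) := HasCompactSupport.toSchwartzMap (f := fun x => (g x : ℂ))
    (hgc.comp_left Complex.ofReal_zero) (Complex.ofRealCLM.contDiff.comp hg)
  have hφ : ∀ x, φ x = (g x : ℂ) := fun x => rfl
  have e1 := congrArg (fun F => F φ) (Lp.fourier_toTemperedDistribution_eq (h2.toLp f))
  simp only [TemperedDistribution.fourier_apply, Lp.toTemperedDistribution_apply] at e1
  have e2 : ∫ x, (𝓕 φ) x • (h2.toLp f) x = ∫ x, (𝓕 φ) x • f x := by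
    refine integral_congr_ae ?_
    filter_upwards [h2.coeFn_toLp] with x hx
    rw [hx]
  have e3 : ∫ x, (𝓕 φ) x • f x = ∫ x, φ x • 𝓕 f x := by
    have := VectorFourier.integral_fourierIntegral_smul_eq_flip (μ := volume) (ν := volume)
      (L := innerₗ ℝ) Real.continuous_fourierChar (by exact continuous_inner) φ.integrable h1
    rw [flip_innerₗ] at this
    rw [SchwartzMap.fourier_coe]
    exact this
  rw [e2, e3] at e1
  simpa [hφ] using e1.symm

theorem lintegral_fourier_sq {f : ℝ → ℂ} (h1 : Integrable f) (h2 : MemLp f 2) :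
    ∫⁻ x, ‖𝓕 f x‖ₑ ^ 2 = ∫⁻ x, ‖f x‖ₑ ^ 2 := by
  have h := Lp.norm_fourier_eq (h2.toLp f)
  rw [Lp.norm_def, Lp.norm_def, ENNReal.toReal_eq_toReal_iff' (Lp.eLpNorm_ne_top _)
    (Lp.eLpNorm_ne_top _), eLpNorm_congr_ae (fourier_toLp_ae_eq h1 h2),
    eLpNorm_congr_ae h2.coeFn_toLp, eLpNorm_eq_lintegral_rpow_enorm_toReal (by simp) (by simp),
    eLpNorm_eq_lintegral_rpow_enorm_toReal (by simp) (by simp)] at h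
  simpa using ENNReal.rpow_left_injective (x := 1 / (2 : ℝ)) (by norm_num) (by simpa using h)

/-- The function on the whole line whose Fourier transform is the Laplace transform of `g` on the
line `Re z = x`. -/
def dampedExtension (g : ℝ → ℝ) (x : ℝ) (t : ℝ) : ℂ :=
  (Ioi (0 : ℝ)).indicator (fun t => ((Real.exp (-x * t) * g t : ℝ) : ℂ)) t

theorem laplace_eq_fourier (g : ℝ → ℝ) (x k : ℝ) :
    laplace g (x + k * Complex.I) = 𝓕 (dampedExtension g x) (k / (2 * Real.pi)) := by
  rw [Real.fourier_real_eq_integral_exp_smul, laplace, ← integral_indicator measurableSet_Ioi]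
  congr 1
  ext t
  by_cases ht : t ∈ Ioi (0 : ℝ)
  · simp only [dampedExtension, indicator_of_mem ht, smul_eq_mul]
    push_cast
    rw [mul_comm, ← mul_assoc, ← Complex.exp_add]
    congr 2
    have : (Real.pi : ℂ) ≠ 0 := by exact_mod_cast Real.pi_ne_zero
    field_simp
    ring
  · simp [dampedExtension, indicator_of_notMem ht]

theorem lintegral_comp_div (f : ℝ → ENNReal) {a : ℝ} (ha : 0 < a) :
    ∫⁻ x, f (x / a) = ENNReal.ofReal a * ∫⁻ x, f x := by
  have h := Real.smul_map_volume_mul_right (a := a⁻¹) (by positivity)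
  have he : MeasurableEmbedding (fun x : ℝ => x * a⁻¹) :=
    (Homeomorph.mulRight₀ a⁻¹ (by positivity)).measurableEmbedding
  conv_rhs => rw [← h]
  rw [lintegral_smul_measure, he.lintegral_map, abs_of_pos (by positivity), smul_eq_mul,
    ← mul_assoc, ← ENNReal.ofReal_mul ha.le, mul_inv_cancel₀ ha.ne']
  simp [div_eq_mul_inv]

/-- Plancherel's identity for the Laplace transform on the line `Re z = x`. -/
theorem lintegral_laplace_sq {g : ℝ → ℝ} {x : ℝ}
    (h1 : IntegrableOn (fun t => Real.exp (-x * t) * g t) (Ioi 0))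
    (h2 : IntegrableOn (fun t => (Real.exp (-x * t) * g t) ^ 2) (Ioi 0)) :
    ∫⁻ k : ℝ, ‖laplace g (x + k * Complex.I)‖ₑ ^ 2 =
      ENNReal.ofReal (2 * Real.pi) * ∫⁻ t in Ioi (0 : ℝ), ‖Real.exp (-x * t) * g t‖ₑ ^ 2 := by
  have hF1 : Integrable (dampedExtension g x) :=
    (integrable_indicator_iff measurableSet_Ioi).2 h1.ofReal
  have hF2 : MemLp (dampedExtension g x) 2 := by
    rw [memLp_two_iff_integrable_sq_norm hF1.aestronglyMeasurable]
    refine (h2.integrable_indicator measurableSet_Ioi).congr (ae_of_all _ fun t => ?_)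
    by_cases ht : t ∈ Ioi (0 : ℝ)
    · simp only [dampedExtension, indicator_of_mem ht, Complex.norm_real, Real.norm_eq_abs, sq_abs]
    · simp [dampedExtension, indicator_of_notMem ht]
  simp_rw [laplace_eq_fourier]
  rw [lintegral_comp_div (fun k => ‖𝓕 (dampedExtension g x) k‖ₑ ^ 2) (by positivity),
    lintegral_fourier_sq hF1 hF2, ← lintegral_indicator measurableSet_Ioi]
  congr 2
  ext t
  by_cases ht : t ∈ Ioi (0 : ℝ)
  · simp only [dampedExtension, indicator_of_mem ht]
    rw [← ofReal_norm, ← ofReal_norm, Complex.norm_real]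
  · simp [dampedExtension, indicator_of_notMem ht]

/-! ### Absolutely convergent Laplace transforms -/

/-- The one-sided convolution `(b * g)(t) = ∫₀ᵗ b(t - s) g(s) ds`. -/
def conv (b g : ℝ → ℝ) (t : ℝ) : ℝ := ∫ s in (0 : ℝ)..t, b (t - s) * g s

/-- `exp(-x t) g(t)` is integrable on `(0, ∞)`, so that the Laplace transform of `g` converges
absolutely on the line `Re z = x`. -/
def DampedIntegrable (g : ℝ → ℝ) (x : ℝ) : Prop :=
  IntegrableOn (fun t => Real.exp (-x * t) * g t) (Ioi 0)

theorem DampedIntegrable.add {g v : ℝ → ℝ} {x : ℝ} (hg : DampedIntegrable g x)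
    (hv : DampedIntegrable v x) : DampedIntegrable (fun t => g t + v t) x := by
  unfold DampedIntegrable at *
  refine (Integrable.add hg hv).congr (ae_of_all _ fun t => ?_)
  simp only [Pi.add_apply]; ring

theorem DampedIntegrable.sub {g v : ℝ → ℝ} {x : ℝ} (hg : DampedIntegrable g x)
    (hv : DampedIntegrable v x) : DampedIntegrable (fun t => g t - v t) x := by
  unfold DampedIntegrable at *
  refine (Integrable.sub hg hv).congr (ae_of_all _ fun t => ?_)
  simp only [Pi.sub_apply]; ring

theorem DampedIntegrable.integrableOn_sq {g : ℝ → ℝ} {x M : ℝ} (hg : DampedIntegrable g x)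
    (hM : ∀ t, 0 < t → |Real.exp (-x * t) * g t| ≤ M) :
    IntegrableOn (fun t => (Real.exp (-x * t) * g t) ^ 2) (Ioi 0) := by
  refine Integrable.mono' (hg.norm.const_mul M) (hg.aestronglyMeasurable.pow 2) ?_
  refine (ae_restrict_iff' measurableSet_Ioi).2 (ae_of_all _ fun t ht => ?_)
  rw [norm_pow, sq]
  exact mul_le_mul_of_nonneg_right (hM t ht) (norm_nonneg _)

theorem dampedIntegrable_of_aestronglyMeasurable {g : ℝ → ℝ} {x M : ℝ} (hx : 0 < x)
    (hg : AEStronglyMeasurable g (volume.restrict (Ioi 0))) (hM : ∀ t, 0 < t → |g t| ≤ M) :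
    DampedIntegrable g x := by
  have h0 : IntegrableOn (fun t : ℝ => Real.exp (-x * t)) (Ioi 0) := exp_neg_integrableOn_Ioi 0 hx
  exact Integrable.mul_bdd (c := M) h0 hg
    ((ae_restrict_iff' measurableSet_Ioi).2 (ae_of_all _ fun t ht => hM t ht))

theorem dampedIntegrable_of_continuousOn {g : ℝ → ℝ} {x M : ℝ} (hx : 0 < x)
    (hg : ContinuousOn g (Ici 0)) (hM : ∀ t, 0 < t → |g t| ≤ M) : DampedIntegrable g x :=
  dampedIntegrable_of_aestronglyMeasurable hx
    ((hg.mono Ioi_subset_Ici_self).aestronglyMeasurable measurableSet_Ioi) hM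

theorem abs_damped_le {g : ℝ → ℝ} {x M : ℝ} (hx : 0 < x) (hM : ∀ t, 0 < t → |g t| ≤ M) :
    ∀ t, 0 < t → |Real.exp (-x * t) * g t| ≤ M := fun t ht => by
  rw [abs_mul, abs_of_pos (Real.exp_pos _)]
  have h1 : Real.exp (-x * t) ≤ 1 := Real.exp_le_one_iff.2 (by nlinarith)
  nlinarith [hM t ht, abs_nonneg (g t), Real.exp_pos (-x * t)]

theorem DampedIntegrable.integrableOn_cexp {g : ℝ → ℝ} {z : ℂ} (hg : DampedIntegrable g z.re) :
    IntegrableOn (fun t : ℝ => (g t : ℂ) * Complex.exp (-z * t)) (Ioi 0) := by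
  have h1 : IntegrableOn (fun t : ℝ => ((Real.exp (-z.re * t) * g t : ℝ) : ℂ)) (Ioi 0) := hg.ofReal
  have h2 : Continuous fun t : ℝ => Complex.exp (-(z.im * Complex.I) * t) := by fun_prop
  refine (Integrable.mul_bdd (c := 1) h1 h2.aestronglyMeasurable.restrict
    (ae_of_all _ fun t => ?_)).congr (ae_of_all _ fun t => ?_)
  · rw [Complex.norm_exp]; simp
  · have hz : z = z.re + z.im * Complex.I := (Complex.re_add_im z).symm
    push_cast
    conv_rhs => rw [hz]
    rw [mul_comm (Complex.exp _) (g t : ℂ), mul_assoc, ← Complex.exp_add]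
    congr 2
    ring

theorem laplace_add {g v : ℝ → ℝ} {z : ℂ} (hg : DampedIntegrable g z.re)
    (hv : DampedIntegrable v z.re) :
    laplace (fun t => g t + v t) z = laplace g z + laplace v z := by
  rw [laplace, laplace, laplace, ← integral_add hg.integrableOn_cexp hv.integrableOn_cexp]
  congr 1; ext t; push_cast; ring

theorem laplace_sub {g v : ℝ → ℝ} {z : ℂ} (hg : DampedIntegrable g z.re)
    (hv : DampedIntegrable v z.re) :
    laplace (fun t => g t - v t) z = laplace g z - laplace v z := by
  rw [laplace, laplace, laplace, ← integral_sub hg.integrableOn_cexp hv.integrableOn_cexp]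
  congr 1; ext t; push_cast; ring

theorem laplace_const_mul (g : ℝ → ℝ) (c : ℝ) (z : ℂ) :
    laplace (fun t => c * g t) z = c * laplace g z := by
  rw [laplace, laplace, ← integral_const_mul]
  congr 1; ext t; push_cast; ring

/-! ### The one-sided convolution -/

theorem exp_mul_conv (b g : ℝ → ℝ) (z : ℂ) (t : ℝ) :
    ((conv b g t : ℝ) : ℂ) * Complex.exp (-z * t) =
      ∫ s in (0 : ℝ)..t, ContinuousLinearMap.mul ℝ ℂ ((g s : ℂ) * Complex.exp (-z * s))
        ((b (t - s) : ℂ) * Complex.exp (-z * ((t - s : ℝ) : ℂ))) := by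
  rw [conv, ← intervalIntegral.integral_ofReal, ← intervalIntegral.integral_mul_const]
  congr 1; ext s
  simp only [ContinuousLinearMap.mul_apply']
  have : Complex.exp (-z * t) = Complex.exp (-z * s) * Complex.exp (-z * ((t - s : ℝ) : ℂ)) := by
    rw [← Complex.exp_add]; congr 1; push_cast; ring
  rw [this]; push_cast; ring

theorem laplace_conv {b g : ℝ → ℝ} {z : ℂ} (hb : DampedIntegrable b z.re)
    (hg : DampedIntegrable g z.re) : laplace (conv b g) z = laplace b z * laplace g z := by
  have h := integral_posConvolution hg.integrableOn_cexp hb.integrableOn_cexp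
    (ContinuousLinearMap.mul ℝ ℂ)
  rw [laplace]
  simp_rw [exp_mul_conv]
  rw [h, ContinuousLinearMap.mul_apply', mul_comm]; rfl

theorem exp_mul_conv_real (b g : ℝ → ℝ) (x t : ℝ) :
    Real.exp (-x * t) * conv b g t =
      ∫ s in (0 : ℝ)..t, ContinuousLinearMap.mul ℝ ℝ (Real.exp (-x * s) * g s)
        (Real.exp (-x * (t - s)) * b (t - s)) := by
  rw [conv, ← intervalIntegral.integral_const_mul]
  congr 1; ext s
  simp only [ContinuousLinearMap.mul_apply']
  have : Real.exp (-x * t) = Real.exp (-x * s) * Real.exp (-x * (t - s)) := by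
    rw [← Real.exp_add]; congr 1; ring
  rw [this]; ring

theorem DampedIntegrable.conv {b g : ℝ → ℝ} {x : ℝ} (hb : DampedIntegrable b x)
    (hg : DampedIntegrable g x) : DampedIntegrable (conv b g) x := by
  have h := (integrable_posConvolution hg hb (ContinuousLinearMap.mul ℝ ℝ)).integrableOn
    (s := Ioi (0 : ℝ))
  refine h.congr ((ae_restrict_iff' measurableSet_Ioi).2 (ae_of_all _ fun t ht => ?_))
  simp only [posConvolution, indicator_of_mem ht]
  rw [exp_mul_conv_real]

theorem abs_exp_mul_conv_le {b g : ℝ → ℝ} {x M : ℝ} (hb : DampedIntegrable b x)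
    (hM : ∀ t, 0 < t → |Real.exp (-x * t) * g t| ≤ M) {t : ℝ} (ht : 0 < t) :
    |Real.exp (-x * t) * Volterra.conv b g t| ≤
      M * ∫ s in Ioi (0 : ℝ), |Real.exp (-x * s) * b s| := by
  have hM0 : 0 ≤ M := (abs_nonneg _).trans (hM 1 one_pos)
  have hI : IntegrableOn (fun s => |Real.exp (-x * s) * b s|) (Ioi 0) := hb.norm
  have hI' : IntervalIntegrable (fun s => |Real.exp (-x * s) * b s|) volume 0 t :=
    (intervalIntegrable_iff_integrableOn_Ioc_of_le ht.le).2 (hI.mono_set Ioc_subset_Ioi_self)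
  rw [exp_mul_conv_real, ← Real.norm_eq_abs]
  have h1 : ‖∫ s in (0 : ℝ)..t, ContinuousLinearMap.mul ℝ ℝ (Real.exp (-x * s) * g s)
        (Real.exp (-x * (t - s)) * b (t - s))‖ ≤
      ∫ s in (0 : ℝ)..t, M * |Real.exp (-x * (t - s)) * b (t - s)| := by
    refine intervalIntegral.norm_integral_le_of_norm_le ht.le ?_ ?_
    · refine ae_of_all _ fun s hs => ?_
      rw [ContinuousLinearMap.mul_apply', norm_mul]
      exact mul_le_mul_of_nonneg_right (hM s hs.1) (abs_nonneg _)
    · have := (hI'.comp_sub_left t).symm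
      simp only [sub_zero, sub_self] at this
      exact this.const_mul M
  refine h1.trans ?_
  rw [intervalIntegral.integral_const_mul]
  refine mul_le_mul_of_nonneg_left ?_ hM0
  rw [intervalIntegral.integral_comp_sub_left (fun s => |Real.exp (-x * s) * b s|), sub_self,
    sub_zero, intervalIntegral.integral_of_le ht.le]
  exact setIntegral_mono_set hI (ae_of_all _ fun s => abs_nonneg _)
    Ioc_subset_Ioi_self.eventuallyLE

/-! ### Positivity of the kernel and the energy estimate -/

/-- The Cayley transform maps the right half plane into the unit disc. -/
theorem norm_sub_one_le_norm_add_one {w : ℂ} (hw : 0 ≤ w.re) : ‖w - 1‖ ≤ ‖w + 1‖ := by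
  rw [← abs_of_nonneg (norm_nonneg (w - 1)), ← abs_of_nonneg (norm_nonneg (w + 1)), ← sq_le_sq,
    ← Complex.normSq_eq_norm_sq, ← Complex.normSq_eq_norm_sq, Complex.normSq_apply,
    Complex.normSq_apply]
  simp only [Complex.sub_re, Complex.sub_im, Complex.add_re, Complex.add_im, Complex.one_re,
    Complex.one_im]
  nlinarith

theorem lintegral_enorm_sq_eq_ofReal_integral {α : Type*} [MeasurableSpace α] {μ : Measure α}
    {f : α → ℝ} (hf : Integrable (fun t => f t ^ 2) μ) :
    ∫⁻ t, ‖f t‖ₑ ^ 2 ∂μ = ENNReal.ofReal (∫ t, f t ^ 2 ∂μ) := by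
  rw [ofReal_integral_eq_lintegral_ofReal hf (ae_of_all _ fun t => sq_nonneg _)]
  congr 1; ext t
  rw [← ofReal_norm, ← ENNReal.ofReal_pow (norm_nonneg _), Real.norm_eq_abs, sq_abs]

/-- A kernel whose Laplace transform has nonnegative real part is of positive type, here with the
weight `exp(-2 x t)`; by polarisation of Plancherel's identity, the integral is that of
`Re b̂ |v̂|²`. -/
theorem damped_energy_nonneg {b v : ℝ → ℝ} {x M : ℝ} (hb : DampedIntegrable b x)
    (hpos : ∀ z : ℂ, z.re = x → 0 ≤ (laplace b z).re) (hv : DampedIntegrable v x)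
    (hM : ∀ t, 0 < t → |Real.exp (-x * t) * v t| ≤ M) :
    IntegrableOn (fun t => Real.exp (-x * t) ^ 2 * (v t * conv b v t)) (Ioi 0) ∧
      0 ≤ ∫ t in Ioi (0 : ℝ), Real.exp (-x * t) ^ 2 * (v t * conv b v t) := by
  set N := M * ∫ s in Ioi (0 : ℝ), |Real.exp (-x * s) * b s|
  have hc : DampedIntegrable (conv b v) x := hb.conv hv
  have hN : ∀ t, 0 < t → |Real.exp (-x * t) * conv b v t| ≤ N :=
    fun t ht => abs_exp_mul_conv_le hb hM ht
  have hadd := (hc.add hv).integrableOn_sq (M := N + M) fun t ht => by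
    rw [mul_add]; exact (abs_add_le _ _).trans (add_le_add (hN t ht) (hM t ht))
  have hsub := (hc.sub hv).integrableOn_sq (M := N + M) fun t ht => by
    rw [mul_sub]; exact (abs_sub _ _).trans (add_le_add (hN t ht) (hM t ht))
  have heq : (fun t => Real.exp (-x * t) ^ 2 * (v t * conv b v t)) =
      fun t => (1 / 4) * ((Real.exp (-x * t) * (conv b v t + v t)) ^ 2 -
        (Real.exp (-x * t) * (conv b v t - v t)) ^ 2) := by
    ext t; ring
  refine ⟨heq ▸ (hadd.sub hsub).const_mul _, ?_⟩
  rw [heq, integral_const_mul, integral_sub hadd hsub]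
  have hle : ∫⁻ k : ℝ, ‖laplace (fun t => conv b v t - v t) (x + k * Complex.I)‖ₑ ^ 2 ≤
      ∫⁻ k : ℝ, ‖laplace (fun t => conv b v t + v t) (x + k * Complex.I)‖ₑ ^ 2 := by
    refine lintegral_mono fun k => ?_
    have hre : (x + k * Complex.I : ℂ).re = x := by simp
    rw [laplace_add (by rwa [hre]) (by rwa [hre]), laplace_sub (by rwa [hre]) (by rwa [hre]),
      laplace_conv (by rwa [hre]) (by rwa [hre])]
    have h1 := norm_sub_one_le_norm_add_one (hpos _ hre)
    gcongr
    rw [← ofReal_norm, ← ofReal_norm]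
    refine ENNReal.ofReal_le_ofReal ?_
    rw [← sub_one_mul, ← add_one_mul, norm_mul, norm_mul]
    gcongr
  rw [lintegral_laplace_sq (hc.sub hv) hsub, lintegral_laplace_sq (hc.add hv) hadd,
    lintegral_enorm_sq_eq_ofReal_integral hsub, lintegral_enorm_sq_eq_ofReal_integral hadd,
    ENNReal.mul_le_mul_iff_right (by simp [Real.pi_pos]) ENNReal.ofReal_ne_top,
    ENNReal.ofReal_le_ofReal_iff (integral_nonneg fun t => sq_nonneg _)] at hle
  linarith

theorem conv_congr {b g v : ℝ → ℝ} {t : ℝ} (ht : 0 ≤ t) (h : ∀ s ∈ Ioc 0 t, g s = v s) :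
    conv b g t = conv b v t := by
  rw [conv, conv, intervalIntegral.integral_of_le ht, intervalIntegral.integral_of_le ht]
  exact setIntegral_congr_fun measurableSet_Ioc fun s hs => by simp only [h s hs]

/-- Positivity of the quadratic form of the kernel on a bounded interval. The truncation of `s` to
`(0, T]` has bounded support, so that the weight `exp(-2 x t)` can be removed by letting `x → 0`. -/
theorem energy_nonneg {b s : ℝ → ℝ} (hb : ∀ x, 0 < x → DampedIntegrable b x)
    (hpos : ∀ z : ℂ, 0 < z.re → 0 ≤ (laplace b z).re) (hs : ContinuousOn s (Ici 0)) {T : ℝ}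
    (hT : 0 ≤ T) :
    IntervalIntegrable (fun t => s t * conv b s t) volume 0 T ∧
      0 ≤ ∫ t in (0 : ℝ)..T, s t * conv b s t := by
  set v : ℝ → ℝ := (Ioc 0 T).indicator s with hv
  obtain ⟨M, hM⟩ := isCompact_Icc.exists_bound_of_continuousOn
    (hs.mono (Icc_subset_Ici_self : Icc 0 T ⊆ Ici 0))
  have hM0 : 0 ≤ M := (norm_nonneg _).trans (hM 0 ⟨le_rfl, hT⟩)
  have hvM : ∀ t, 0 < t → |v t| ≤ M := fun t ht => by
    by_cases h : t ∈ Ioc 0 T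
    · rw [hv, indicator_of_mem h]; exact hM t (Ioc_subset_Icc_self h)
    · rw [hv, indicator_of_notMem h, abs_zero]; exact hM0
  have hvm : AEStronglyMeasurable v (volume.restrict (Ioi 0)) :=
    (((aestronglyMeasurable_indicator_iff measurableSet_Ioc).2
      ((hs.mono (fun t ht => ht.1.le)).aestronglyMeasurable measurableSet_Ioc))).restrict
  have key := fun x (hx : 0 < x) => damped_energy_nonneg (hb x hx)
    (fun z hz => hpos z (hz ▸ hx)) (dampedIntegrable_of_aestronglyMeasurable hx hvm hvM)
    (abs_damped_le hx hvM)
  have hvF : ∀ t, v t * conv b v t = (Ioc 0 T).indicator (fun t => s t * conv b s t) t := by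
    intro t
    by_cases h : t ∈ Ioc 0 T
    · rw [indicator_of_mem h, hv, indicator_of_mem h]
      congr 1
      exact conv_congr h.1.le fun r hr =>
        indicator_of_mem (show r ∈ Ioc 0 T from ⟨hr.1, hr.2.trans h.2⟩) _
    · rw [indicator_of_notMem h, hv, indicator_of_notMem h, zero_mul]
  have hFi : IntegrableOn (fun t => v t * conv b v t) (Ioi 0) := by
    have h1 := (key 1 one_pos).1
    have hm : AEStronglyMeasurable (fun t => v t * conv b v t) (volume.restrict (Ioi 0)) := by
      have h2 : Continuous fun t : ℝ => Real.exp (1 * t) ^ 2 := by fun_prop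
      refine (h2.aestronglyMeasurable.restrict.mul h1.aestronglyMeasurable).congr
        (ae_of_all _ fun t => ?_)
      simp only [Pi.mul_apply]
      rw [← mul_assoc, ← mul_pow, ← Real.exp_add]
      simp
    refine Integrable.mono' (h1.norm.const_mul (Real.exp T ^ 2)) hm (ae_of_all _ fun t => ?_)
    by_cases h : t ∈ Ioc 0 T
    · rw [norm_mul (_ ^ 2), ← mul_assoc, norm_pow, Real.norm_of_nonneg (Real.exp_pos _).le,
        ← mul_pow, ← Real.exp_add]
      refine le_mul_of_one_le_left (norm_nonneg _) (one_le_pow₀ (Real.one_le_exp ?_))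
      linarith [h.2]
    · rw [hvF t, indicator_of_notMem h, norm_zero]; positivity
  have hF : IntegrableOn (fun t => s t * conv b s t) (Ioc 0 T) := by
    have := hFi.mono_set (Ioc_subset_Ioi_self : Ioc 0 T ⊆ _)
    refine this.congr ((ae_restrict_iff' measurableSet_Ioc).2 (ae_of_all _ fun t ht => ?_))
    simp only [hvF, indicator_of_mem ht]
  refine ⟨(intervalIntegrable_iff_integrableOn_Ioc_of_le hT).2 hF, ?_⟩
  have hint : ∫ t in (0 : ℝ)..T, s t * conv b s t = ∫ t in Ioi (0 : ℝ), v t * conv b v t := by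
    simp_rw [hvF]
    rw [intervalIntegral.integral_of_le hT, setIntegral_indicator measurableSet_Ioc,
      inter_eq_self_of_subset_right Ioc_subset_Ioi_self]
  rw [hint]
  have hlim : Tendsto (fun n : ℕ => ∫ t in Ioi (0 : ℝ),
      Real.exp (-(1 / ((n : ℝ) + 1)) * t) ^ 2 * (v t * conv b v t)) atTop
      (𝓝 (∫ t in Ioi (0 : ℝ), v t * conv b v t)) := by
    refine tendsto_integral_of_dominated_convergence (fun t => ‖v t * conv b v t‖)
      (fun n => (key _ (by positivity)).1.aestronglyMeasurable) hFi.norm (fun n => ?_) ?_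
    · refine (ae_restrict_iff' measurableSet_Ioi).2 (ae_of_all _ fun t ht => ?_)
      rw [norm_mul, norm_pow, Real.norm_of_nonneg (Real.exp_pos _).le]
      refine mul_le_of_le_one_left (norm_nonneg _) (pow_le_one₀ (Real.exp_pos _).le ?_)
      have : 0 ≤ 1 / ((n : ℝ) + 1) * t := mul_nonneg (by positivity) (le_of_lt ht)
      exact Real.exp_le_one_iff.2 (by linarith)
    · refine ae_of_all _ fun t => ?_
      have h1 := tendsto_one_div_add_atTop_nhds_zero_nat (𝕜 := ℝ)
      have h2 : Continuous fun x : ℝ => Real.exp (-x * t) ^ 2 * (v t * conv b v t) := by fun_prop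
      simpa [Function.comp_def] using (h2.tendsto 0).comp h1
  exact ge_of_tendsto' hlim fun n => (key _ (by positivity)).2

/-- Solutions of the scalar Volterra equation are bounded by their initial value, as
`d/dt s² = -2 l s (b * s)` has nonpositive integrals. -/
theorem abs_le_abs_zero_of_hasDerivAt {b s : ℝ → ℝ} {l : ℝ} (hl : 0 ≤ l)
    (hb : ∀ x, 0 < x → DampedIntegrable b x)
    (hpos : ∀ z : ℂ, 0 < z.re → 0 ≤ (laplace b z).re) (hs : ContinuousOn s (Ici 0))
    (hd : ∀ t, 0 < t → HasDerivAt s (-(l * conv b s t)) t) {t : ℝ} (ht : 0 ≤ t) :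
    |s t| ≤ |s 0| := by
  obtain ⟨hi, h0⟩ := energy_nonneg hb hpos hs ht
  have h := intervalIntegral.integral_eq_sub_of_hasDerivAt_of_le ht
    (f := fun t => s t ^ 2) (f' := fun t => (-2 * l) * (s t * conv b s t))
    ((hs.mono Icc_subset_Ici_self).pow 2)
    (fun r hr => by
      have := (hd r hr.1).pow 2
      refine this.congr_deriv ?_
      push_cast; ring)
    (hi.const_mul _)
  rw [intervalIntegral.integral_const_mul] at h
  rw [← sq_le_sq]
  have : 0 ≤ l * ∫ t in (0 : ℝ)..t, s t * conv b s t := mul_nonneg hl h0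
  linarith

/-- The Laplace transform of `y' = -(b * g)`. -/
theorem laplace_of_hasDerivAt {b y g : ℝ → ℝ} {z : ℂ} (hz : 0 < z.re) {M : ℝ}
    (hb : DampedIntegrable b z.re) (hg : DampedIntegrable g z.re) (hy : ContinuousOn y (Ici 0))
    (hM : ∀ t, 0 < t → |y t| ≤ M) (hd : ∀ t, 0 < t → HasDerivAt y (-conv b g t) t) :
    z * laplace y z - y 0 = -(laplace b z * laplace g z) := by
  have hyd : DampedIntegrable y z.re := dampedIntegrable_of_continuousOn hz hy hM
  have hi1 := hyd.integrableOn_cexp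
  have hi2 := (hb.conv hg).integrableOn_cexp
  have hlim : Tendsto (fun t : ℝ => (y t : ℂ) * Complex.exp (-z * t)) atTop (𝓝 0) := by
    rw [tendsto_zero_iff_norm_tendsto_zero]
    have h1 : Tendsto (fun t : ℝ => M * Real.exp (-(z.re * t))) atTop (𝓝 (M * 0)) :=
      ((Real.tendsto_exp_neg_atTop_nhds_zero).comp
        (tendsto_id.const_mul_atTop hz)).const_mul M
    rw [mul_zero] at h1
    refine squeeze_zero' (Eventually.of_forall fun t => norm_nonneg _) ?_ h1
    filter_upwards [eventually_gt_atTop 0] with t ht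
    rw [norm_mul, Complex.norm_real, Complex.norm_exp]
    have : (-z * (t : ℂ)).re = -(z.re * t) := by simp
    rw [this]
    exact mul_le_mul_of_nonneg_right (hM t ht) (Real.exp_pos _).le
  have h := integral_Ioi_of_hasDerivAt_of_tendsto (a := (0 : ℝ))
    (f := fun t : ℝ => (y t : ℂ) * Complex.exp (-z * t))
    (f' := fun t : ℝ => -z * ((y t : ℂ) * Complex.exp (-z * t)) -
      (conv b g t : ℂ) * Complex.exp (-z * t)) ?_ ?_ ((hi1.const_mul _).sub hi2) hlim
  · rw [integral_sub (hi1.const_mul _) hi2, integral_const_mul] at h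
    have h3 := laplace_conv hb hg
    rw [laplace] at h3
    rw [h3] at h
    simp only [Complex.ofReal_zero, mul_zero, Complex.exp_zero, mul_one] at h
    rw [laplace.eq_def y z]
    linear_combination -h
  · refine ContinuousWithinAt.mul ?_ (by fun_prop)
    exact Complex.continuous_ofReal.continuousAt.comp_continuousWithinAt (hy 0 self_mem_Ici)
  · intro t ht
    have h1 := (hd t ht).ofReal_comp
    have h2 : HasDerivAt (fun t : ℝ => Complex.exp (-z * t)) (Complex.exp (-z * t) * (-z)) t := by
      have h3 : HasDerivAt (fun t : ℝ => -z * (t : ℂ)) (-z) t := by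
        simpa using (hasDerivAt_id t).ofReal_comp.const_mul (-z)
      exact h3.cexp
    refine (h1.mul h2).congr_deriv ?_
    push_cast; ring

/-! ### Two elementary inequalities -/

theorem exp_neg_le_quadratic {u : ℝ} (hu : 0 ≤ u) : Real.exp (-u) ≤ 1 - u + u ^ 2 / 2 := by
  have h1 := Real.quadratic_le_exp_of_nonneg hu
  have h2 : Real.exp (-u) * Real.exp u = 1 := by rw [← Real.exp_add]; simp
  have h3 : 0 < 1 - u + u ^ 2 / 2 := by nlinarith [sq_nonneg (u - 1)]
  have h4 : 1 ≤ (1 - u + u ^ 2 / 2) * (1 + u + u ^ 2 / 2) := by nlinarith [sq_nonneg (u ^ 2)]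
  have h5 : Real.exp (-u) * Real.exp u ≤ (1 - u + u ^ 2 / 2) * Real.exp u := by
    rw [h2]; exact h4.trans (mul_le_mul_of_nonneg_left h1 h3.le)
  exact le_of_mul_le_mul_right h5 (Real.exp_pos u)

/-- The second antiderivative of `cos u + sin u - exp(-u) / 4` is nonnegative. Below `π` the
quadratic bounds of `cos` and `exp` suffice; above `π` the linear terms dominate. -/
theorem quarter_exp_le_trig {u : ℝ} (hu : 0 ≤ u) :
    (u - 1 + Real.exp (-u)) / 4 ≤ 1 - Real.cos u + u - Real.sin u := by
  have hs := Real.sin_le hu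
  rcases le_total u Real.pi with h | h
  · have h2 : Real.cos u ≤ 1 - 2 / Real.pi ^ 2 * u ^ 2 :=
      Real.cos_le_one_sub_mul_cos_sq (by rwa [abs_of_nonneg hu])
    have h3 := exp_neg_le_quadratic hu
    have h4 : (1 : ℝ) / 8 ≤ 2 / Real.pi ^ 2 := by
      rw [div_le_div_iff₀ (by norm_num) (by positivity)]
      nlinarith [Real.pi_le_four, Real.pi_pos]
    nlinarith [sq_nonneg u, mul_le_mul_of_nonneg_right h4 (sq_nonneg u)]
  · have h1 : Real.exp (-u) ≤ 1 := Real.exp_le_one_iff.2 (by linarith)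
    have := Real.pi_gt_three
    linarith [Real.sin_le_one u, Real.cos_le_one u]

/-! ### Integrals against a nonincreasing function -/

/-- The superlevel sets of a nonincreasing function on `(0, ∞)` are initial segments, on which the
integral of `g` is nonnegative by assumption, be they bounded or not. -/
theorem lintegral_neg_le_of_intervalIntegral_nonneg {g : ℝ → ℝ} (hg : Continuous g)
    (hpos : ∀ τ, 0 < τ → 0 ≤ ∫ t in (0 : ℝ)..τ, g t) {A : Set ℝ} (hA : A ⊆ Ioi 0)
    (hlow : ∀ t ∈ A, ∀ s, 0 < s → s ≤ t → s ∈ A) :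
    ∫⁻ t in A, ENNReal.ofReal (-g t) ≤ ∫⁻ t in A, ENNReal.ofReal (g t) := by
  have hfin : ∀ τ, 0 < τ →
      ∫⁻ t in Ioc 0 τ, ENNReal.ofReal (-g t) ≤ ∫⁻ t in Ioc 0 τ, ENNReal.ofReal (g t) := by
    intro τ hτ
    have hi : IntegrableOn g (Ioc 0 τ) := (hg.integrableOn_Icc).mono_set Ioc_subset_Icc_self
    have h := hpos τ hτ
    rw [intervalIntegral.integral_of_le hτ.le,
      integral_eq_lintegral_pos_part_sub_lintegral_neg_part hi, sub_nonneg] at h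
    exact (ENNReal.toReal_le_toReal hi.neg.lintegral_lt_top.ne hi.lintegral_lt_top.ne).1 h
  rcases A.eq_empty_or_nonempty with rfl | hne
  · simp
  by_cases hbd : BddAbove A
  · have hτ : 0 < sSup A := by
      obtain ⟨t, ht⟩ := hne
      exact (hA ht).trans_le (le_csSup hbd ht)
    have hae : A =ᵐ[volume] Ioc 0 (sSup A) := by
      have hsub : A ⊆ Ioc 0 (sSup A) := fun t ht => ⟨hA ht, le_csSup hbd ht⟩
      refine (LE.le.eventuallyLE hsub).antisymm ?_
      refine Ioo_ae_eq_Ioc.symm.le.trans (LE.le.eventuallyLE (fun t ht => ?_ : Ioo 0 (sSup A) ⊆ A))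
      obtain ⟨r, hr, htr⟩ := exists_lt_of_lt_csSup hne ht.2
      exact hlow r hr t ht.1 htr.le
    rw [setLIntegral_congr hae, setLIntegral_congr hae]
    exact hfin _ hτ
  · have hAeq : A = Ioi 0 := by
      refine hA.antisymm fun t ht => ?_
      rw [not_bddAbove_iff] at hbd
      obtain ⟨r, hr, htr⟩ := hbd t
      exact hlow r hr t ht htr.le
    rw [hAeq]
    have hc : AECover (volume.restrict (Ioi (0 : ℝ))) atTop fun n : ℕ => Iic (n : ℝ) :=
      aecover_Iic tendsto_natCast_atTop_atTop
    have hm : Measurable g := hg.measurable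
    refine le_of_tendsto_of_tendsto
      (hc.lintegral_tendsto_of_countably_generated (by fun_prop : AEMeasurable
        (fun t => ENNReal.ofReal (-g t)) _))
      (hc.lintegral_tendsto_of_countably_generated (by fun_prop : AEMeasurable
        (fun t => ENNReal.ofReal (g t)) _)) ?_
    filter_upwards [eventually_gt_atTop 0] with n hn
    rw [Measure.restrict_restrict measurableSet_Iic, inter_comm, Ioi_inter_Iic]
    exact hfin _ (by exact_mod_cast hn)

/-- If all the integrals `∫₀^τ g` are nonnegative, then so is `∫₀^∞ m g` for nonincreasing
`m ≥ 0`: by the layer cake formula `m` is a superposition of indicators of intervals `(0, τ)`. -/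
theorem integral_antitone_mul_nonneg {m g : ℝ → ℝ} (hm : AntitoneOn m (Ioi 0))
    (hm0 : ∀ t, 0 < t → 0 ≤ m t) (hg : Continuous g)
    (hpos : ∀ τ, 0 < τ → 0 ≤ ∫ t in (0 : ℝ)..τ, g t)
    (hi : IntegrableOn (fun t => m t * g t) (Ioi 0)) :
    0 ≤ ∫ t in Ioi (0 : ℝ), m t * g t := by
  have hmm : AEMeasurable m (volume.restrict (Ioi 0)) :=
    aemeasurable_restrict_of_antitoneOn measurableSet_Ioi hm
  have hcake : ∀ f : ℝ → ℝ, Continuous f →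
      ∫⁻ t in Ioi (0 : ℝ), ENNReal.ofReal (m t * f t) =
        ∫⁻ a in Ioi (0 : ℝ), ∫⁻ t in {t | a < m t} ∩ Ioi 0, ENNReal.ofReal (f t) := by
    intro f hf
    have hfm : Measurable fun t => ENNReal.ofReal (f t) := hf.measurable.ennreal_ofReal
    set ν := (volume.restrict (Ioi (0 : ℝ))).withDensity fun t => ENNReal.ofReal (f t)
    have hac : ν ≪ volume.restrict (Ioi (0 : ℝ)) := withDensity_absolutelyContinuous _ _
    have h1 := lintegral_eq_lintegral_meas_lt ν (f := m)
      (hac.ae_le ((ae_restrict_iff' measurableSet_Ioi).2 (ae_of_all _ fun t ht => hm0 t ht)))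
      (hmm.mono_ac hac)
    rw [lintegral_withDensity_eq_lintegral_mul₀ hfm.aemeasurable hmm.ennreal_ofReal] at h1
    have h2 : ∫⁻ t in Ioi (0 : ℝ), ENNReal.ofReal (m t * f t) =
        ∫⁻ t in Ioi (0 : ℝ),
          ((fun t => ENNReal.ofReal (f t)) * fun t => ENNReal.ofReal (m t)) t := by
      refine setLIntegral_congr_fun measurableSet_Ioi fun t ht => ?_
      simp only [Pi.mul_apply]
      rw [ENNReal.ofReal_mul (hm0 t ht), mul_comm]
    rw [h2, h1]
    congr 1; ext a
    have hn : NullMeasurableSet {t | a < m t} (volume.restrict (Ioi 0)) :=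
      nullMeasurableSet_lt aemeasurable_const hmm
    rw [withDensity_apply₀ _ hn, Measure.restrict_restrict₀ hn]
  rw [integral_eq_lintegral_pos_part_sub_lintegral_neg_part hi, sub_nonneg]
  refine ENNReal.toReal_mono hi.lintegral_lt_top.ne ?_
  simp_rw [← mul_neg]
  rw [hcake g hg, hcake (fun t => -g t) hg.neg]
  refine lintegral_mono fun a => ?_
  refine lintegral_neg_le_of_intervalIntegral_nonneg hg hpos inter_subset_right ?_
  rintro t ⟨ht, ht0⟩ s hs hst
  exact ⟨lt_of_lt_of_le ht (hm hs ht0 hst), hs⟩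

/-! ### Sine and cosine integrals of convex functions -/

theorem abs_sin_add_one_sub_cos_sub_le {u : ℝ} (hu : 0 ≤ u) :
    |Real.sin u + 1 - Real.cos u - (1 - Real.exp (-u)) / 4| ≤ 3 * u := by
  have h1 : |Real.sin u| ≤ u := by simpa [abs_of_nonneg hu] using Real.abs_sin_le_abs (x := u)
  have h2 : 1 - Real.cos u ≤ u := by
    rcases le_total u 2 with h | h
    · have := Real.one_sub_sq_div_two_le_cos (x := u)
      nlinarith
    · linarith [Real.neg_one_le_cos u]
  have h3 : 1 - Real.exp (-u) ≤ u := by linarith [Real.add_one_le_exp (-u)]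
  have h4 : Real.exp (-u) ≤ 1 := Real.exp_le_one_iff.2 (by linarith)
  have h5 := Real.cos_le_one u
  have := abs_le.1 h1
  rw [abs_le]; constructor <;> linarith

/-- For convex nonincreasing `β` vanishing at infinity, the cosine and sine integrals of `β`
jointly dominate its Laplace transform. Two integrations by parts move the kernel
`cos kt + sin kt - exp(-kt)/4` to its second antiderivative, which is nonnegative; the second
one is the layer cake argument, since `m = -β'` need not be differentiable. -/
theorem quarter_laplace_le_trig_integral {β m : ℝ → ℝ} {k : ℝ} (hk : 0 < k)
    (hd : ∀ t, 0 < t → HasDerivAt β (-m t) t) (hm : AntitoneOn m (Ioi 0))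
    (hm0 : ∀ t, 0 < t → 0 ≤ m t) (hβ : AntitoneOn β (Ioi 0)) (hβ0 : ∀ t, 0 < t → 0 ≤ β t)
    (hi : IntegrableOn β (Ioi 0)) (hlim : Tendsto (fun t => t * β t) atTop (𝓝 0)) :
    0 ≤ ∫ t in Ioi (0 : ℝ),
      β t * (Real.cos (k * t) + Real.sin (k * t) - Real.exp (-(k * t)) / 4) := by
  -- `t β(t)` tends to zero at `0`, and `t m(t)`, the derivative of `∫₀ᵗ β - t β(t)`, is integrable
  have hI : ∀ t, 0 ≤ t → IntervalIntegrable β volume 0 t := fun t ht =>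
    (intervalIntegrable_iff_integrableOn_Ioc_of_le ht).2 (hi.mono_set Ioc_subset_Ioi_self)
  have hprim : Tendsto (fun t => ∫ s in (0 : ℝ)..t, β s) (𝓝[>] 0) (𝓝 0) := by
    have h1 := intervalIntegral.continuousWithinAt_primitive (f := β) (μ := volume) (a := 0)
      (b₀ := 0) (b₁ := 0) (b₂ := 1) (by simp) (by simpa using hI 1 zero_le_one)
    have h2 := h1.tendsto
    simp only [intervalIntegral.integral_same] at h2
    exact h2.mono_left (nhdsWithin_le_iff.2 (mem_of_superset (Ioo_mem_nhdsGT one_pos)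
      Ioo_subset_Icc_self))
  have hle : ∀ t, 0 < t → t * β t ≤ ∫ s in (0 : ℝ)..t, β s := by
    intro t ht
    have h1 : ∫ s in (0 : ℝ)..t, β t ≤ ∫ s in (0 : ℝ)..t, β s := by
      rw [intervalIntegral.integral_of_le ht.le, intervalIntegral.integral_of_le ht.le]
      exact setIntegral_mono_on (by simp) (hi.mono_set Ioc_subset_Ioi_self) measurableSet_Ioc
        fun s hs => hβ hs.1 ht hs.2
    simpa using h1
  have hzero : Tendsto (fun t => t * β t) (𝓝[>] 0) (𝓝 0) := by
    refine squeeze_zero' ?_ ?_ hprim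
    · filter_upwards [self_mem_nhdsWithin] with t ht using mul_nonneg (le_of_lt ht) (hβ0 t ht)
    · filter_upwards [self_mem_nhdsWithin] with t ht using hle t ht
  have htm : IntegrableOn (fun t => t * m t) (Ioi 0) := by
    refine integrableOn_Ioi_deriv_of_nonneg
      (g := fun t => (∫ s in (0 : ℝ)..t, β s) - t * β t) (l := (∫ s in Ioi (0 : ℝ), β s) - 0)
      ?_ ?_ ?_ ?_
    · rw [← Ioi_insert, continuousWithinAt_insert_self, ContinuousWithinAt]
      simpa using hprim.sub hzero
    · intro t ht
      have hc : ContinuousAt β t := (hd t ht).continuousAt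
      have h1 : HasDerivAt (fun t => ∫ s in (0 : ℝ)..t, β s) (β t) t :=
        intervalIntegral.integral_hasDerivAt_right (hI t (le_of_lt ht))
          (ContinuousOn.stronglyMeasurableAtFilter isOpen_Ioi
            (fun s hs => (hd s hs).continuousAt.continuousWithinAt) t ht) hc
      refine (h1.sub ((hasDerivAt_id t).mul (hd t ht))).congr_deriv ?_
      simp
    · exact fun t ht => mul_nonneg (le_of_lt ht) (hm0 t ht)
    · exact (intervalIntegral_tendsto_integral_Ioi 0 hi tendsto_id).sub hlim
  set Q : ℝ → ℝ := fun t => (Real.sin (k * t) + 1 - Real.cos (k * t) -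
    (1 - Real.exp (-(k * t))) / 4) / k with hQ
  have hQc : Continuous Q := by fun_prop
  have hkt : ∀ t : ℝ, HasDerivAt (fun t => k * t) k t := fun t => by
    simpa using (hasDerivAt_id t).const_mul k
  have hkn : ∀ t : ℝ, HasDerivAt (fun t => -(k * t)) (-k) t := fun t => (hkt t).neg
  have hQd : ∀ t,
      HasDerivAt Q (Real.cos (k * t) + Real.sin (k * t) - Real.exp (-(k * t)) / 4) t := by
    intro t
    have := ((((hkt t).sin.add_const 1).sub (hkt t).cos).sub
      (((hkn t).exp.const_sub 1).div_const 4)).div_const k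
    refine this.congr_deriv ?_
    field_simp; ring
  have hQle : ∀ t, 0 < t → |Q t| ≤ 3 * t := fun t ht => by
    rw [hQ]; simp only
    rw [abs_div, abs_of_pos hk, div_le_iff₀ hk]
    have := abs_sin_add_one_sub_cos_sub_le (u := k * t) (by positivity)
    linarith
  have hmQ : IntegrableOn (fun t => m t * Q t) (Ioi 0) := by
    have hmm : AEStronglyMeasurable m (volume.restrict (Ioi 0)) :=
      (aemeasurable_restrict_of_antitoneOn measurableSet_Ioi hm).aestronglyMeasurable
    refine Integrable.mono' (htm.const_mul 3) (hmm.mul hQc.aestronglyMeasurable.restrict) ?_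
    refine (ae_restrict_iff' measurableSet_Ioi).2 (ae_of_all _ fun t ht => ?_)
    rw [Real.norm_eq_abs, abs_mul, abs_of_nonneg (hm0 t ht)]
    nlinarith [hQle t ht, hm0 t ht]
  have hβq : IntegrableOn (fun t => β t *
      (Real.cos (k * t) + Real.sin (k * t) - Real.exp (-(k * t)) / 4)) (Ioi 0) := by
    refine Integrable.mul_bdd (c := 3) hi
      (by fun_prop : Continuous _).aestronglyMeasurable.restrict ?_
    refine (ae_restrict_iff' measurableSet_Ioi).2 (ae_of_all _ fun t ht => ?_)
    have h1 : Real.exp (-(k * t)) ≤ 1 := Real.exp_le_one_iff.2 (by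
      have : 0 < k * t := mul_pos hk ht
      linarith)
    have h2 := Real.exp_pos (-(k * t))
    rw [Real.norm_eq_abs, abs_le]
    constructor <;> linarith [Real.neg_one_le_cos (k * t), Real.cos_le_one (k * t),
      Real.neg_one_le_sin (k * t), Real.sin_le_one (k * t)]
  have hbound : ∀ t, 0 < t → ‖β t * Q t‖ ≤ 3 * (t * β t) := fun t ht => by
    rw [Real.norm_eq_abs, abs_mul, abs_of_nonneg (hβ0 t ht)]
    nlinarith [hQle t ht, hβ0 t ht]
  have hibp := integral_Ioi_mul_deriv_eq_deriv_mul (a := (0 : ℝ)) (a' := 0) (b' := 0)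
    (u := β) (u' := fun t => -m t) (v := Q)
    (v' := fun t => Real.cos (k * t) + Real.sin (k * t) - Real.exp (-(k * t)) / 4)
    (fun t ht => hd t ht) (fun t _ => hQd t) hβq
    (by refine hmQ.neg.congr (ae_of_all _ fun t => ?_); simp [Pi.mul_apply])
    (squeeze_zero_norm' (by
      filter_upwards [self_mem_nhdsWithin] with t ht using hbound t ht)
      (by simpa using hzero.const_mul 3))
    (squeeze_zero_norm' (by
      filter_upwards [eventually_gt_atTop 0] with t ht using hbound t ht)
      (by simpa using hlim.const_mul 3))
  rw [hibp]
  have hneg : ∫ t in Ioi (0 : ℝ), -m t * Q t = -∫ t in Ioi (0 : ℝ), m t * Q t := by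
    rw [← integral_neg]; congr 1; ext t; ring
  rw [hneg]
  have := integral_antitone_mul_nonneg hm hm0 hQc (fun τ hτ => ?_) hmQ
  · linarith
  have h1 := intervalIntegral.integral_eq_sub_of_hasDerivAt (a := 0) (b := τ)
    (f := fun t => (1 - Real.cos (k * t) + k * t - Real.sin (k * t) -
      (k * t - 1 + Real.exp (-(k * t))) / 4) / k ^ 2) (f' := Q) (fun t _ => by
      have := (((((hkt t).cos.const_sub 1).add (hkt t)).sub (hkt t).sin).sub
        (((hkt t).sub_const 1 |>.add (hkn t).exp).div_const 4)).div_const (k ^ 2)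
      refine this.congr_deriv ?_
      rw [hQ]; field_simp; ring) (hQc.intervalIntegrable _ _)
  rw [h1]
  have h2 := quarter_exp_le_trig (u := k * τ) (by positivity)
  simp only [mul_zero, Real.cos_zero, Real.sin_zero, neg_zero, Real.exp_zero]
  have h3 : 0 ≤ (1 - Real.cos (k * τ) + k * τ - Real.sin (k * τ) -
      (k * τ - 1 + Real.exp (-(k * τ))) / 4) / k ^ 2 := div_nonneg (by linarith) (by positivity)
  simpa using h3

/-! ### Bounds for the Laplace transform of an admissible kernel -/

/-- The Laplace transform on the positive real axis, as a real number. -/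
def laplaceReal (b : ℝ → ℝ) (x : ℝ) : ℝ := ∫ t in Ioi (0 : ℝ), Real.exp (-x * t) * b t

theorem laplace_ofReal (b : ℝ → ℝ) (x : ℝ) : laplace b x = laplaceReal b x := by
  rw [laplace, laplaceReal, ← integral_complex_ofReal]
  congr 1; ext t
  push_cast; ring

theorem laplace_conj (b : ℝ → ℝ) (z : ℂ) : laplace b (conj z) = conj (laplace b z) := by
  rw [laplace, laplace, ← integral_conj]
  congr 1; ext t
  simp [← Complex.exp_conj]

theorem laplace_re_sub_im {b : ℝ → ℝ} {z : ℂ} (hb : DampedIntegrable b z.re) :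
    (laplace b z).re - (laplace b z).im = ∫ t in Ioi (0 : ℝ),
      Real.exp (-z.re * t) * b t * (Real.cos (z.im * t) + Real.sin (z.im * t)) := by
  have hi := hb.integrableOn_cexp
  have h1 : (laplace b z).re = ∫ t in Ioi (0 : ℝ), ((b t : ℂ) * Complex.exp (-z * t)).re :=
    (integral_re hi).symm
  have h2 : (laplace b z).im = ∫ t in Ioi (0 : ℝ), ((b t : ℂ) * Complex.exp (-z * t)).im :=
    (integral_im hi).symm
  have h3 := integral_sub hi.re hi.im
  simp only [RCLike.re_to_complex, RCLike.im_to_complex] at h3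
  rw [h1, h2, ← h3]
  congr 1; ext t
  rw [Complex.re_ofReal_mul, Complex.im_ofReal_mul, Complex.exp_re, Complex.exp_im]
  have e1 : (-z * (t : ℂ)).re = -z.re * t := by simp
  have e2 : (-z * (t : ℂ)).im = -(z.im * t) := by simp
  rw [e1, e2, Real.cos_neg, Real.sin_neg]
  ring

theorem abs_arg_laplace_le (b : ℝ → ℝ) {z : ℂ} (hz : 0 < z.re) :
    |Complex.arg (laplace b z)| ≤ (rho b - 1) * (Real.pi / 2) := by
  have hbdd : BddAbove {a : ℝ | ∃ z : ℂ, 0 < z.re ∧ a = |Complex.arg (laplace b z)|} := by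
    refine ⟨Real.pi, ?_⟩
    rintro a ⟨w, -, rfl⟩
    exact Complex.abs_arg_le_pi _
  have h1 := le_csSup hbdd ⟨z, hz, rfl⟩
  refine h1.trans_eq ?_
  have := Real.pi_ne_zero
  rw [rho]; field_simp; ring

theorem mul_exp_le {c t : ℝ} (hc : 0 < c) :
    t * Real.exp (-(2 * c) * t) ≤ c⁻¹ * Real.exp (-c * t) := by
  have h1 : Real.exp (-(2 * c) * t) = Real.exp (-(c * t)) * Real.exp (-c * t) := by
    rw [← Real.exp_add]; congr 1; ring
  rw [h1, ← mul_assoc]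
  refine mul_le_mul_of_nonneg_right ?_ (Real.exp_pos _).le
  have h2 := Real.add_one_le_exp (c * t)
  have h3 : Real.exp (-(c * t)) * Real.exp (c * t) = 1 := by rw [← Real.exp_add]; simp
  rw [inv_eq_one_div, le_div_iff₀ hc]
  nlinarith [Real.exp_pos (-(c * t))]

namespace IsAdmissibleKernel

variable {b : ℝ → ℝ}

theorem dampedIntegrable (hb : IsAdmissibleKernel b) {x : ℝ} (hx : 0 < x) :
    DampedIntegrable b x := by
  have hE : Continuous fun t : ℝ => Real.exp (-x * t) := by fun_prop
  have hbm : AEStronglyMeasurable b (volume.restrict (Ioi 1)) :=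
    (hb.differentiableOn.continuousOn.mono (Ioi_subset_Ioi zero_le_one)).aestronglyMeasurable
      measurableSet_Ioi
  rw [DampedIntegrable, ← Ioc_union_Ioi_eq_Ioi zero_le_one]
  refine IntegrableOn.union ?_ ?_
  · refine Integrable.bdd_mul (c := 1) (hb.locallyIntegrable 1 one_pos)
      hE.aestronglyMeasurable.restrict ?_
    refine (ae_restrict_iff' measurableSet_Ioc).2 (ae_of_all _ fun t ht => ?_)
    rw [Real.norm_of_nonneg (Real.exp_pos _).le]
    exact Real.exp_le_one_iff.2 (by nlinarith [ht.1])
  · refine Integrable.mul_bdd (c := b 1) (exp_neg_integrableOn_Ioi 1 hx) hbm ?_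
    refine (ae_restrict_iff' measurableSet_Ioi).2 (ae_of_all _ fun t ht => ?_)
    have ht0 : 0 < t := one_pos.trans ht
    rw [Real.norm_of_nonneg (hb.nonneg t ht0)]
    exact hb.antitoneOn (mem_Ioi.2 one_pos) ht0 (le_of_lt ht)

theorem laplaceReal_pos (hb : IsAdmissibleKernel b) {x : ℝ} (hx : 0 < x) : 0 < laplaceReal b x := by
  obtain ⟨t₀, ht₀, hbt⟩ := hb.ne_zero
  rw [laplaceReal, setIntegral_pos_iff_support_of_nonneg_ae _ (hb.dampedIntegrable hx)]
  · have hsub : Ioc 0 t₀ ⊆ Function.support (fun t => Real.exp (-x * t) * b t) ∩ Ioi 0 := by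
      intro t ht
      refine ⟨?_, ht.1⟩
      have : 0 < b t := ((hb.nonneg _ ht₀).lt_of_ne' hbt).trans_le (hb.antitoneOn ht.1 ht₀ ht.2)
      exact (mul_pos (Real.exp_pos _) this).ne'
    refine lt_of_lt_of_le ?_ (measure_mono hsub)
    simpa using ht₀
  · refine (ae_restrict_iff' measurableSet_Ioi).2 (ae_of_all _ fun t ht => ?_)
    exact mul_nonneg (Real.exp_pos _).le (hb.nonneg t ht)

theorem laplaceReal_antitone (hb : IsAdmissibleKernel b) {x y : ℝ} (hx : 0 < x) (hxy : x ≤ y) :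
    laplaceReal b y ≤ laplaceReal b x := by
  refine setIntegral_mono_on (hb.dampedIntegrable (hx.trans_le hxy)) (hb.dampedIntegrable hx)
    measurableSet_Ioi fun t ht => mul_le_mul_of_nonneg_right ?_ (hb.nonneg t ht)
  exact Real.exp_le_exp.2 (by nlinarith [mem_Ioi.1 ht])

/-- The lower bound for `|b̂|` in the first quadrant, from the cosine and sine integrals of
`exp(-x t) b(t)`, a convex nonincreasing function. -/
theorem laplaceReal_le_of_im_pos (hb : IsAdmissibleKernel b) {z : ℂ} (hx : 0 < z.re)
    (hk : 0 < z.im) :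
    laplaceReal b (z.re + z.im) / 4 ≤ (laplace b z).re - (laplace b z).im := by
  set x := z.re
  set k := z.im
  have hE : ∀ t : ℝ, HasDerivAt (fun t => Real.exp (-x * t)) (Real.exp (-x * t) * (-x)) t :=
    fun t => by
      have : HasDerivAt (fun t => -x * t) (-x) t := by
        simpa using (hasDerivAt_id t).const_mul (-x)
      exact this.exp
  have hEanti : ∀ s t : ℝ, s ≤ t → Real.exp (-x * t) ≤ Real.exp (-x * s) := fun s t hst =>
    Real.exp_le_exp.2 (by nlinarith)
  have hbdd := hb.dampedIntegrable hx
  have h := quarter_laplace_le_trig_integral (β := fun t => Real.exp (-x * t) * b t)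
    (m := fun t => Real.exp (-x * t) * (x * b t + -deriv b t)) hk ?_ ?_ ?_ ?_ ?_ hbdd ?_
  · have hi1 : IntegrableOn (fun t => Real.exp (-x * t) * b t *
        (Real.cos (k * t) + Real.sin (k * t))) (Ioi 0) := by
      refine Integrable.mul_bdd (c := 2) hbdd
        (by fun_prop : Continuous _).aestronglyMeasurable.restrict (ae_of_all _ fun t => ?_)
      rw [Real.norm_eq_abs, abs_le]
      constructor <;> linarith [Real.neg_one_le_cos (k * t), Real.cos_le_one (k * t),
        Real.neg_one_le_sin (k * t), Real.sin_le_one (k * t)]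
    have hi2 := (hb.dampedIntegrable (add_pos hx hk)).div_const 4
    rw [laplace_re_sub_im hbdd, laplaceReal, ← integral_div, ← sub_nonneg, ← integral_sub hi1 hi2]
    refine h.trans_eq ?_
    congr 1; ext t
    have : Real.exp (-(x + k) * t) = Real.exp (-x * t) * Real.exp (-(k * t)) := by
      rw [← Real.exp_add]; congr 1; ring
    rw [this]; ring
  · intro t ht
    have hbd : HasDerivAt b (deriv b t) t :=
      (hb.differentiableOn.differentiableAt (Ioi_mem_nhds ht)).hasDerivAt
    refine ((hE t).mul hbd).congr_deriv ?_
    ring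
  · intro s hs t ht hst
    have h1 := hb.antitoneOn hs ht hst
    have h2 := hb.neg_deriv_antitoneOn hs ht hst
    simp only at h2
    have h3 : x * b t ≤ x * b s := mul_le_mul_of_nonneg_left h1 hx.le
    refine mul_le_mul (hEanti s t hst) (by linarith) ?_ (Real.exp_pos _).le
    exact add_nonneg (mul_nonneg hx.le (hb.nonneg t ht)) (hb.neg_deriv_nonneg t ht)
  · intro t ht
    exact mul_nonneg (Real.exp_pos _).le
      (add_nonneg (mul_nonneg hx.le (hb.nonneg t ht)) (hb.neg_deriv_nonneg t ht))
  · intro s hs t ht hst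
    exact mul_le_mul (hEanti s t hst) (hb.antitoneOn hs ht hst) (hb.nonneg t ht) (Real.exp_pos _).le
  · intro t ht
    exact mul_nonneg (Real.exp_pos _).le (hb.nonneg t ht)
  · have h1 := (((Real.tendsto_pow_mul_exp_neg_atTop_nhds_zero 1).comp
      (tendsto_id.const_mul_atTop hx)).mul_const (b 1 / x))
    rw [zero_mul] at h1
    refine squeeze_zero' ?_ ?_ h1
    · filter_upwards [eventually_gt_atTop 0] with t ht
      exact mul_nonneg ht.le (mul_nonneg (Real.exp_pos _).le (hb.nonneg t ht))
    · filter_upwards [eventually_ge_atTop 1] with t ht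
      have ht0 : 0 < t := one_pos.trans_le ht
      have h2 : b t ≤ b 1 := hb.antitoneOn (mem_Ioi.2 one_pos) ht0 ht
      have h3 : ((fun u : ℝ => u ^ 1 * Real.exp (-u)) ∘ fun t => x * id t) t * (b 1 / x) =
          t * (Real.exp (-x * t) * b 1) := by
        simp only [Function.comp, id, pow_one, neg_mul]
        field_simp
      rw [h3]
      gcongr

/-- The modulus of `b̂` on the right half plane is bounded below by its values on the real axis. -/
theorem laplaceReal_le_norm (hb : IsAdmissibleKernel b) {z : ℂ} (hz : 0 < z.re) :
    laplaceReal b (z.re + |z.im|) / 8 ≤ ‖laplace b z‖ := by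
  have hpos : ∀ z : ℂ, 0 < z.re → 0 < z.im →
      laplaceReal b (z.re + |z.im|) / 8 ≤ ‖laplace b z‖ := by
    intro z hz hk
    have h1 := hb.laplaceReal_le_of_im_pos hz hk
    rw [abs_of_pos hk]
    have h2 := Complex.abs_re_le_norm (laplace b z)
    have h3 := Complex.abs_im_le_norm (laplace b z)
    linarith [le_abs_self (laplace b z).re, neg_abs_le (laplace b z).im]
  rcases lt_trichotomy z.im 0 with h | h | h
  · have := hpos (conj z) (by simpa using hz) (by simpa using h)
    rwa [laplace_conj, RCLike.norm_conj, Complex.conj_re, Complex.conj_im, abs_neg] at this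
  · have hzr : z = (z.re : ℂ) := Complex.ext (by simp) (by simpa using h)
    have h1 : ‖laplace b z‖ = laplaceReal b z.re := by
      conv_lhs => rw [hzr]
      rw [laplace_ofReal, Complex.norm_real, Real.norm_of_nonneg (hb.laplaceReal_pos hz).le]
    rw [h1, h, abs_zero, add_zero]
    linarith [hb.laplaceReal_pos hz]
  · exact hpos z hz h

theorem laplace_ne_zero (hb : IsAdmissibleKernel b) {z : ℂ} (hz : 0 < z.re) : laplace b z ≠ 0 := by
  have h1 := hb.laplaceReal_le_norm hz
  have h2 := hb.laplaceReal_pos (x := z.re + |z.im|) (by positivity)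
  rw [← norm_pos_iff]
  linarith

/-! #### The sector condition -/

/-- `cos θ`, for the opening `θ = (ρ - 1) π/2` of the sector that contains the values of `b̂`. -/
theorem cos_sector_pos (hb : IsAdmissibleKernel b) :
    0 < Real.cos ((rho b - 1) * (Real.pi / 2)) := by
  have h1 := hb.one_lt_rho
  have h2 := hb.rho_lt_two
  have := Real.pi_pos
  exact Real.cos_pos_of_mem_Ioo ⟨by nlinarith, by nlinarith⟩

theorem cos_sector_mul_norm_le_re (hb : IsAdmissibleKernel b) {z : ℂ} (hz : 0 < z.re) :
    Real.cos ((rho b - 1) * (Real.pi / 2)) * ‖laplace b z‖ ≤ (laplace b z).re := by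
  have h1 := abs_arg_laplace_le b hz
  have h2 := hb.rho_lt_two
  have hp := Real.pi_pos
  have h3 : Real.cos ((rho b - 1) * (Real.pi / 2)) ≤ Real.cos (Complex.arg (laplace b z)) := by
    rw [← Real.cos_abs (Complex.arg _)]
    exact Real.cos_le_cos_of_nonneg_of_le_pi (abs_nonneg _) (by nlinarith) h1
  rw [Complex.cos_arg (hb.laplace_ne_zero hz), le_div_iff₀
    (norm_pos_iff.2 (hb.laplace_ne_zero hz))] at h3
  exact h3

theorem laplace_re_nonneg (hb : IsAdmissibleKernel b) {z : ℂ} (hz : 0 < z.re) :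
    0 ≤ (laplace b z).re :=
  (mul_nonneg hb.cos_sector_pos.le (norm_nonneg _)).trans (hb.cos_sector_mul_norm_le_re hz)

theorem cos_sector_mul_norm_le (hb : IsAdmissibleKernel b) {z : ℂ} (hz : 0 < z.re)
    {l : ℝ} (hl : 0 ≤ l) :
    Real.cos ((rho b - 1) * (Real.pi / 2)) * (l * ‖laplace b z‖) ≤ ‖z + l * laplace b z‖ := by
  have h1 := hb.cos_sector_mul_norm_le_re hz
  have h2 : (z + l * laplace b z).re = z.re + l * (laplace b z).re := by simp
  have h3 := (le_abs_self _).trans (Complex.abs_re_le_norm (z + l * laplace b z))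
  nlinarith

theorem cos_sector_mul_norm_self_le (hb : IsAdmissibleKernel b) {z : ℂ} (hz : 0 < z.re)
    {l : ℝ} (hl : 0 ≤ l) :
    Real.cos ((rho b - 1) * (Real.pi / 2)) / 2 * ‖z‖ ≤ ‖z + l * laplace b z‖ := by
  have h1 := hb.cos_sector_mul_norm_le hz hl
  have hc := hb.cos_sector_pos
  have hc1 := Real.cos_le_one ((rho b - 1) * (Real.pi / 2))
  have h2 : ‖z‖ ≤ ‖z + l * laplace b z‖ + l * ‖laplace b z‖ := by
    have := norm_sub_le (z + l * laplace b z) (l * laplace b z)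
    rw [add_sub_cancel_right, norm_mul, Complex.norm_real, Real.norm_of_nonneg hl] at this
    exact this
  nlinarith [norm_nonneg (z + l * laplace b z)]

/-! #### Growth on the real axis -/

theorem differentiableOn_laplace (hb : IsAdmissibleKernel b) :
    DifferentiableOn ℂ (laplace b) {z | 0 < z.re} := by
  intro z hz
  refine DifferentiableAt.differentiableWithinAt ?_
  set c := z.re / 4
  have hc : 0 < c := div_pos hz (by norm_num)
  have hs : {w : ℂ | 2 * c < w.re} ∈ 𝓝 z :=
    (isOpen_lt continuous_const Complex.continuous_re).mem_nhds
      (by have : z.re = 4 * c := by simp only [c]; ring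
          simp only [mem_ofPred_eq]; linarith)
  have hmeas : ∀ w : ℂ, 0 < w.re → AEStronglyMeasurable
      (fun t : ℝ => (b t : ℂ) * Complex.exp (-w * t)) (volume.restrict (Ioi 0)) := fun w hw =>
    (hb.dampedIntegrable hw).integrableOn_cexp.aestronglyMeasurable
  have hid : AEStronglyMeasurable (fun t : ℝ => (-t : ℂ)) (volume.restrict (Ioi (0 : ℝ))) :=
    (by fun_prop : Continuous fun t : ℝ => (-t : ℂ)).aestronglyMeasurable
  have h := hasDerivAt_integral_of_dominated_loc_of_deriv_le
    (F := fun (w : ℂ) (t : ℝ) => (b t : ℂ) * Complex.exp (-w * t))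
    (F' := fun (w : ℂ) (t : ℝ) => (-t : ℂ) * ((b t : ℂ) * Complex.exp (-w * t)))
    (x₀ := z) (μ := volume.restrict (Ioi (0 : ℝ))) (s := {w : ℂ | 2 * c < w.re})
    (bound := fun t => c⁻¹ * (Real.exp (-c * t) * b t)) hs
    (mem_of_superset hs fun w hw => hmeas w (by simp only [mem_ofPred_eq] at hw; linarith))
    (hb.dampedIntegrable hz).integrableOn_cexp (hid.mul (hmeas z hz))
    ?_ ((hb.dampedIntegrable hc).const_mul _) ?_
  · exact h.2.differentiableAt
  · refine (ae_restrict_iff' measurableSet_Ioi).2 (ae_of_all _ fun t ht w hw => ?_)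
    have ht0 : 0 < t := ht
    have hb0 := hb.nonneg t ht
    rw [norm_mul, norm_mul, norm_neg, Complex.norm_real, Complex.norm_real, Complex.norm_exp,
      Real.norm_of_nonneg ht0.le, Real.norm_of_nonneg hb0]
    have e1 : (-w * (t : ℂ)).re = -w.re * t := by simp
    have h1 : Real.exp (-w.re * t) ≤ Real.exp (-(2 * c) * t) :=
      Real.exp_le_exp.2 (by have : 2 * c < w.re := hw
                            nlinarith)
    rw [e1]
    calc t * (b t * Real.exp (-w.re * t)) ≤ t * (b t * Real.exp (-(2 * c) * t)) := by gcongr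
      _ = b t * (t * Real.exp (-(2 * c) * t)) := by ring
      _ ≤ b t * (c⁻¹ * Real.exp (-c * t)) := mul_le_mul_of_nonneg_left (mul_exp_le hc) hb0
      _ = _ := by ring
  · refine ae_of_all _ fun t w _ => ?_
    have h1 : HasDerivAt (fun w : ℂ => -w * (t : ℂ)) (-(t : ℂ)) w := by
      simpa using (hasDerivAt_id w).neg.mul_const (t : ℂ)
    refine (h1.cexp.const_mul (b t : ℂ)).congr_deriv ?_
    ring

/-- `x^(ρ-1) b̂(x)` does not drop below its value at `1`. The power `b̂^(1/(ρ-1))` maps the right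
half plane into itself, so that the Schwarz lemma applies to it after Cayley transforms. -/
theorem laplaceReal_one_mul_rpow_le (hb : IsAdmissibleKernel b) {x : ℝ} (hx : 1 ≤ x) :
    laplaceReal b 1 * x ^ (1 - rho b) ≤ laplaceReal b x := by
  have hr : 0 < rho b - 1 := sub_pos.2 hb.one_lt_rho
  have hx0 : 0 < x := one_pos.trans_le hx
  -- `N = (b̂ / b̂(1))^(1/(ρ-1))`
  set N : ℂ → ℂ := fun z =>
    Complex.exp ((Complex.log (laplace b z) - Complex.log (laplace b 1)) / (rho b - 1 : ℝ)) with hN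
  have hB1 := hb.laplaceReal_pos one_pos
  have hBx := hb.laplaceReal_pos hx0
  have h1eq : laplace b 1 = laplaceReal b 1 := by exact_mod_cast laplace_ofReal b 1
  have hlog1 : Complex.log (laplace b 1) = (Real.log (laplaceReal b 1) : ℝ) := by
    rw [h1eq, Complex.ofReal_log hB1.le]
  have hNre : ∀ z : ℂ, 0 < z.re → 0 ≤ (N z).re := by
    intro z hz
    have h1 := abs_le.1 (abs_arg_laplace_le b hz)
    rw [hN]; simp only
    rw [Complex.exp_re]
    refine mul_nonneg (Real.exp_pos _).le (Real.cos_nonneg_of_mem_Icc ?_)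
    rw [Complex.div_ofReal_im, Complex.sub_im, hlog1, Complex.ofReal_im, sub_zero, Complex.log_im]
    constructor
    · rw [le_div_iff₀ hr]; linarith [h1.1]
    · rw [div_le_iff₀ hr]; linarith [h1.2]
  have hNd : DifferentiableOn ℂ N {z | 0 < z.re} := by
    refine (((hb.differentiableOn_laplace.clog fun z hz => ?_).sub_const _).div_const _).cexp
    have h1 := hb.cos_sector_mul_norm_le_re hz
    have h2 := mul_pos hb.cos_sector_pos (norm_pos_iff.2 (hb.laplace_ne_zero hz))
    exact Or.inl (h2.trans_le h1)
  have hN1 : ∀ z : ℂ, 0 < z.re → N z + 1 ≠ 0 := by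
    intro z hz h
    have h1 := congrArg Complex.re h
    rw [Complex.add_re, Complex.one_re, Complex.zero_re] at h1
    linarith [hNre z hz]
  -- the conformal map of the unit disc onto the half plane with `φ 0 = 1`
  set φ : ℂ → ℂ := fun w => (1 + w) / (1 - w) with hφ
  have hne : ∀ w ∈ Metric.ball (0 : ℂ) 1, 1 - w ≠ 0 := by
    intro w hw h
    rw [mem_ball_zero_iff, ← sub_eq_zero.1 h] at hw
    simp at hw
  have hφm : MapsTo φ (Metric.ball 0 1) {z | 0 < z.re} := by
    intro w hw
    have h1 : w.re ^ 2 + w.im ^ 2 < 1 := by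
      have h2 : ‖w‖ ^ 2 < 1 := pow_lt_one₀ (norm_nonneg _) (mem_ball_zero_iff.1 hw) (by norm_num)
      rw [← Complex.normSq_eq_norm_sq, Complex.normSq_apply] at h2
      nlinarith
    have h3 : 0 < Complex.normSq (1 - w) := Complex.normSq_pos.2 (hne w hw)
    simp only [hφ, mem_ofPred_eq, Complex.div_re, Complex.add_re, Complex.one_re, Complex.sub_re,
      Complex.add_im, Complex.one_im, Complex.sub_im]
    rw [← add_div]
    refine div_pos ?_ h3
    nlinarith
  have hφd : DifferentiableOn ℂ φ (Metric.ball 0 1) :=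
    (differentiableOn_id.const_add 1).div (differentiableOn_id.const_sub 1) hne
  have hNφ := hNd.comp hφd hφm
  -- the preimage of `x`
  set w : ℝ := (x - 1) / (x + 1) with hw
  have hw0 : 0 ≤ w := div_nonneg (by linarith) (by linarith)
  have hw1 : w < 1 := by rw [hw, div_lt_one (by linarith)]; linarith
  have hφw : φ (w : ℂ) = x := by
    have h1 : (x + 1 : ℂ) ≠ 0 := by exact_mod_cast (by linarith : x + 1 ≠ 0)
    rw [hφ, hw]; push_cast
    field_simp
    ring
  have hφ0 : φ 0 = 1 := by simp [hφ]
  have hS := Complex.norm_le_norm_of_mapsTo_ball (R := 1) (z := (w : ℂ))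
    (f := fun v => (N (φ v) - 1) / (N (φ v) + 1))
    ((hNφ.sub_const 1).div (hNφ.add_const 1) fun v hv => hN1 _ (hφm hv))
    (fun v hv => by
      rw [mem_closedBall_zero_iff, norm_div,
        div_le_one (norm_pos_iff.2 (hN1 _ (hφm hv)))]
      exact norm_sub_one_le_norm_add_one (hNre _ (hφm hv)))
    (by simp [hφ0, hN])
    (by rw [Complex.norm_real, Real.norm_of_nonneg hw0]; exact hw1)
  set n : ℝ := (laplaceReal b x / laplaceReal b 1) ^ (1 / (rho b - 1)) with hn
  have hn0 : 0 < n := Real.rpow_pos_of_pos (div_pos hBx hB1) _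
  have hNx : N x = n := by
    rw [hN]; simp only
    rw [hlog1, laplace_ofReal, ← Complex.ofReal_log hBx.le, hn,
      Real.rpow_def_of_pos (div_pos hBx hB1), Real.log_div hBx.ne' hB1.ne']
    push_cast
    congr 1
    ring
  rw [hφw, hNx] at hS
  have hS' : |(n - 1) / (n + 1)| ≤ w := by
    have h1 : ((n : ℂ) - 1) / (n + 1) = (((n - 1) / (n + 1) : ℝ) : ℂ) := by push_cast; rfl
    rw [h1, Complex.norm_real, Complex.norm_real, Real.norm_eq_abs, Real.norm_of_nonneg hw0] at hS
    exact hS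
  have h2 := (abs_le.1 hS').1
  rw [hw, ← neg_div, div_le_div_iff₀ (by linarith) (by linarith)] at h2
  have h3 : x⁻¹ ≤ n := by
    rw [inv_eq_one_div, div_le_iff₀ hx0]; linarith
  have h4 := Real.rpow_le_rpow (by positivity) h3 hr.le
  rw [hn, ← Real.rpow_mul (div_pos hBx hB1).le, one_div_mul_cancel hr.ne', Real.rpow_one,
    Real.inv_rpow hx0.le, ← Real.rpow_neg hx0.le, neg_sub, le_div_iff₀ hB1] at h4
  linarith

end IsAdmissibleKernel

/-! ### The scalar Volterra equation -/

/-- `s` solves the scalar equation `s' + l (b * s) = 0` on `(0, ∞)` and is continuous on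
`[0, ∞)`. -/
structure IsScalarSolution (b : ℝ → ℝ) (l : ℝ) (s : ℝ → ℝ) : Prop where
  continuousOn : ContinuousOn s (Ici 0)
  hasDerivAt : ∀ t, 0 < t → HasDerivAt s (-(l * conv b s t)) t

theorem conv_const_mul (b g : ℝ → ℝ) (c t : ℝ) : conv b (fun r => c * g r) t = c * conv b g t := by
  rw [conv, conv, ← intervalIntegral.integral_const_mul]
  congr 1; ext s; ring

theorem intervalIntegrable_sub_left {b : ℝ → ℝ}
    (hb : ∀ T : ℝ, 0 < T → IntegrableOn b (Ioc 0 T)) {t : ℝ} (ht : 0 < t) :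
    IntervalIntegrable (fun s => b (t - s)) volume 0 t := by
  have h1 := (((intervalIntegrable_iff_integrableOn_Ioc_of_le ht.le).2 (hb t ht)).comp_sub_left
    t).symm
  simpa using h1

theorem conv_sub {b g v : ℝ → ℝ} (hb : ∀ T : ℝ, 0 < T → IntegrableOn b (Ioc 0 T))
    (hg : ContinuousOn g (Ici 0)) (hv : ContinuousOn v (Ici 0)) {t : ℝ} (ht : 0 < t) :
    conv b (fun r => g r - v r) t = conv b g t - conv b v t := by
  have h : ∀ f : ℝ → ℝ, ContinuousOn f (Ici 0) →
      IntervalIntegrable (fun s => b (t - s) * f s) volume 0 t := fun f hf =>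
    (intervalIntegrable_sub_left hb ht).mul_continuousOn
      (hf.mono (by rw [uIcc_of_le ht.le]; exact Icc_subset_Ici_self))
  rw [conv, conv, conv, ← intervalIntegral.integral_sub (h g hg) (h v hv)]
  congr 1; ext s; ring

theorem IsScalarSolution.abs_le {b s : ℝ → ℝ} {l : ℝ} (hb : IsAdmissibleKernel b) (hl : 0 ≤ l)
    (hs : IsScalarSolution b l s) {t : ℝ} (ht : 0 ≤ t) : |s t| ≤ |s 0| :=
  abs_le_abs_zero_of_hasDerivAt hl (fun _ => hb.dampedIntegrable) (fun _ => hb.laplace_re_nonneg)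
    hs.continuousOn hs.hasDerivAt ht

theorem IsScalarSolution.sub {b s v : ℝ → ℝ} {l : ℝ} (hb : IsAdmissibleKernel b)
    (hs : IsScalarSolution b l s) (hv : IsScalarSolution b l v) :
    IsScalarSolution b l fun t => s t - v t where
  continuousOn := hs.continuousOn.sub hv.continuousOn
  hasDerivAt t ht := by
    refine ((hs.hasDerivAt t ht).sub (hv.hasDerivAt t ht)).congr_deriv ?_
    rw [conv_sub hb.locallyIntegrable hs.continuousOn hv.continuousOn ht]
    ring

theorem IsScalarSolution.const_mul {b s : ℝ → ℝ} {l : ℝ} (hs : IsScalarSolution b l s) (c : ℝ) :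
    IsScalarSolution b l fun t => c * s t where
  continuousOn := hs.continuousOn.const_smul c
  hasDerivAt t ht := by
    refine ((hs.hasDerivAt t ht).const_mul c).congr_deriv ?_
    rw [conv_const_mul]; ring

theorem IsScalarSolution.eq_of_eq_zero {b s v : ℝ → ℝ} {l : ℝ} (hb : IsAdmissibleKernel b)
    (hl : 0 ≤ l) (hs : IsScalarSolution b l s) (hv : IsScalarSolution b l v) (h0 : s 0 = v 0)
    {t : ℝ} (ht : 0 ≤ t) : s t = v t := by
  have := (hs.sub hb hv).abs_le hb hl ht
  rw [h0, sub_self, abs_zero] at this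
  exact sub_eq_zero.1 (abs_nonpos_iff.1 this)

theorem IsScalarSolution.laplace_eq {b s : ℝ → ℝ} {l : ℝ} (hb : IsAdmissibleKernel b)
    (hl : 0 ≤ l) (hs : IsScalarSolution b l s) {z : ℂ} (hz : 0 < z.re) :
    (z + l * laplace b z) * laplace s z = s 0 := by
  have hM : ∀ t, 0 < t → |s t| ≤ |s 0| := fun t ht => hs.abs_le hb hl ht.le
  have hM' : ∀ t, 0 < t → |l * s t| ≤ l * |s 0| := fun t ht => by
    rw [abs_mul, abs_of_nonneg hl]; exact mul_le_mul_of_nonneg_left (hM t ht) hl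
  have h := laplace_of_hasDerivAt (g := fun t => l * s t) hz (hb.dampedIntegrable hz)
    (dampedIntegrable_of_continuousOn hz (hs.continuousOn.const_smul l) hM') hs.continuousOn hM
    (fun t ht => by rw [conv_const_mul]; exact hs.hasDerivAt t ht)
  rw [laplace_const_mul] at h
  linear_combination h

/-- The symbol `z + l b̂(z)` on the strip `0 < Re z ≤ 1`, uniformly in `l ≥ l₀`. For
`|Im z| ≥ l^(1/ρ)` the second bound follows from the first one, which is the sector condition; for
smaller `|Im z|` it follows from `|b̂(z)| ≥ c (1 + l^(1/ρ))^(1-ρ)`. -/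
theorem IsAdmissibleKernel.exists_le_norm_symbol {b : ℝ → ℝ} (hb : IsAdmissibleKernel b) {l₀ : ℝ}
    (hl₀ : 0 < l₀) : ∃ c > 0, ∀ l, l₀ ≤ l → ∀ z : ℂ, 0 < z.re → z.re ≤ 1 →
      c * |z.im| ≤ ‖z + l * laplace b z‖ ∧ c * l ^ (1 / rho b) ≤ ‖z + l * laplace b z‖ := by
  have hr := hb.one_lt_rho
  have hr0 : 0 < rho b := one_pos.trans hr
  have hB1 := hb.laplaceReal_pos one_pos
  set c₁ := Real.cos ((rho b - 1) * (Real.pi / 2)) with hc₁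
  have hc₁0 : 0 < c₁ := hb.cos_sector_pos
  set K₀ := l₀ ^ (1 / rho b) with hK₀
  have hK₀0 : 0 < K₀ := Real.rpow_pos_of_pos hl₀ _
  set c₂ := c₁ * (laplaceReal b 1 / 8 * (K₀ / (1 + K₀)) ^ (rho b - 1)) with hc₂
  have hc₂0 : 0 < c₂ := by positivity
  refine ⟨min (c₁ / 2) c₂, by positivity, fun l hl z hz hz1 => ?_⟩
  have hl0 : 0 < l := hl₀.trans_le hl
  set K := l ^ (1 / rho b) with hK
  have hK0 : 0 < K := Real.rpow_pos_of_pos hl0 _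
  have hKl : K ^ rho b = l := by
    rw [hK, ← Real.rpow_mul hl0.le, one_div_mul_cancel hr0.ne', Real.rpow_one]
  have hKK : K₀ ≤ K := Real.rpow_le_rpow hl₀.le hl (by positivity)
  have him : min (c₁ / 2) c₂ * |z.im| ≤ ‖z + l * laplace b z‖ := by
    refine le_trans ?_ (hb.cos_sector_mul_norm_self_le hz hl0.le)
    exact mul_le_mul (min_le_left _ _) (Complex.abs_im_le_norm z) (abs_nonneg _) (by positivity)
  refine ⟨him, ?_⟩
  rcases le_total K |z.im| with h | h
  · exact (mul_le_mul_of_nonneg_left h (by positivity)).trans him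
  refine le_trans ?_ (hb.cos_sector_mul_norm_le hz hl0.le)
  refine (mul_le_mul_of_nonneg_right (min_le_right _ _) hK0.le).trans ?_
  rw [hc₂, mul_assoc]
  refine mul_le_mul_of_nonneg_left ?_ hc₁0.le
  have h1 : laplaceReal b 1 * (1 + K) ^ (1 - rho b) / 8 ≤ ‖laplace b z‖ := by
    refine le_trans ?_ (hb.laplaceReal_le_norm hz)
    refine div_le_div_of_nonneg_right ?_ (by norm_num)
    refine (hb.laplaceReal_one_mul_rpow_le (by linarith)).trans ?_
    exact hb.laplaceReal_antitone (by positivity) (by linarith)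
  refine le_trans ?_ (mul_le_mul_of_nonneg_left h1 hl0.le)
  have h2 : (K₀ / (1 + K₀)) ^ (rho b - 1) ≤ (K / (1 + K)) ^ (rho b - 1) := by
    refine Real.rpow_le_rpow (by positivity) ?_ (by linarith)
    rw [div_le_div_iff₀ (by positivity) (by positivity)]
    linarith
  have h3 : (K / (1 + K)) ^ (rho b - 1) * K = l * (1 + K) ^ (1 - rho b) := by
    rw [Real.div_rpow hK0.le (by positivity), div_mul_eq_mul_div, Real.rpow_sub_one hK0.ne',
      div_mul_cancel₀ _ hK0.ne', hKl, div_eq_mul_inv, ← Real.rpow_neg (by positivity), neg_sub]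
  calc laplaceReal b 1 / 8 * (K₀ / (1 + K₀)) ^ (rho b - 1) * K
      ≤ laplaceReal b 1 / 8 * (K / (1 + K)) ^ (rho b - 1) * K := by gcongr
    _ = laplaceReal b 1 / 8 * (l * (1 + K) ^ (1 - rho b)) := by rw [mul_assoc, h3]
    _ = _ := by ring

theorem lintegral_inv_sq_add_sq {K : ℝ} (hK : 0 < K) :
    ∫⁻ k : ℝ, ENNReal.ofReal (K ^ 2 + k ^ 2)⁻¹ = ENNReal.ofReal (Real.pi * K⁻¹) := by
  have h1 : ∀ k : ℝ, ENNReal.ofReal (K ^ 2 + k ^ 2)⁻¹ =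
      ENNReal.ofReal ((K ^ 2)⁻¹) * ENNReal.ofReal (1 + (k / K) ^ 2)⁻¹ := fun k => by
    rw [← ENNReal.ofReal_mul (by positivity)]
    congr 1
    field_simp
  simp_rw [h1]
  rw [lintegral_const_mul _ (by fun_prop),
    lintegral_comp_div (fun k => ENNReal.ofReal (1 + k ^ 2)⁻¹) hK,
    ← ofReal_integral_eq_lintegral_ofReal integrable_inv_one_add_sq
      (ae_of_all _ fun k => by simp only [Pi.zero_apply]; positivity),
    integral_univ_inv_one_add_sq, ← ENNReal.ofReal_mul hK.le, ← ENNReal.ofReal_mul (by positivity)]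
  congr 1
  field_simp

/-- Removal of the damping factor, by Fatou's lemma. -/
theorem lintegral_enorm_sq_le_of_damped {f : ℝ → ℝ} (hf : ContinuousOn f (Ici 0)) {C : ENNReal}
    (h : ∀ x, 0 < x → x ≤ 1 → ∫⁻ t in Ioi (0 : ℝ), ‖Real.exp (-x * t) * f t‖ₑ ^ 2 ≤ C) :
    ∫⁻ t in Ioi (0 : ℝ), ‖f t‖ₑ ^ 2 ≤ C := by
  have hfm : AEMeasurable f (volume.restrict (Ioi 0)) :=
    (hf.mono Ioi_subset_Ici_self).aemeasurable measurableSet_Ioi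
  have hlim : ∀ t, Tendsto (fun n : ℕ => ‖Real.exp (-(1 / ((n : ℝ) + 1)) * t) * f t‖ₑ ^ 2) atTop
      (𝓝 (‖f t‖ₑ ^ 2)) := fun t => by
    have h1 := tendsto_one_div_add_atTop_nhds_zero_nat (𝕜 := ℝ)
    have h2 : Continuous fun x : ℝ => Real.exp (-x * t) * f t := by fun_prop
    have h3 := (h2.tendsto 0).comp h1
    simp only [neg_zero, zero_mul, Real.exp_zero, one_mul] at h3
    exact (ENNReal.continuous_pow 2).continuousAt.tendsto.comp
      (continuous_enorm.continuousAt.tendsto.comp h3)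
  calc ∫⁻ t in Ioi (0 : ℝ), ‖f t‖ₑ ^ 2
      = ∫⁻ t in Ioi (0 : ℝ),
          liminf (fun n : ℕ => ‖Real.exp (-(1 / ((n : ℝ) + 1)) * t) * f t‖ₑ ^ 2) atTop := by
        congr 1; ext t; exact (hlim t).liminf_eq.symm
    _ ≤ liminf (fun n : ℕ =>
          ∫⁻ t in Ioi (0 : ℝ), ‖Real.exp (-(1 / ((n : ℝ) + 1)) * t) * f t‖ₑ ^ 2) atTop :=
        lintegral_liminf_le' fun n => by fun_prop
    _ ≤ C := by
        refine liminf_le_of_le (by isBoundedDefault) fun a ha => ?_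
        obtain ⟨n, hn⟩ := ha.exists
        refine hn.trans (h _ (by positivity) ?_)
        rw [div_le_one (by positivity)]
        linarith [(Nat.cast_nonneg n : (0 : ℝ) ≤ n)]

/-- The square-integrability of scalar solutions, with the decay `l^(-1/ρ)` that comes from
`|z + l b̂(z)| ≥ c (|z| + l^(1/ρ))`. -/
theorem IsAdmissibleKernel.exists_lintegral_sq_le {b : ℝ → ℝ} (hb : IsAdmissibleKernel b) {l₀ : ℝ}
    (hl₀ : 0 < l₀) : ∃ C, 0 ≤ C ∧ ∀ l, l₀ ≤ l → ∀ s, IsScalarSolution b l s →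
      ∫⁻ t in Ioi (0 : ℝ), ‖s t‖ₑ ^ 2 ≤ ENNReal.ofReal (C * l ^ (-(1 / rho b)) * s 0 ^ 2) := by
  obtain ⟨c, hc, hcz⟩ := hb.exists_le_norm_symbol hl₀
  refine ⟨(c ^ 2)⁻¹, by positivity, fun l hl s hs => ?_⟩
  have hl0 : 0 < l := hl₀.trans_le hl
  have hM : ∀ t, 0 < t → |s t| ≤ |s 0| := fun t ht => hs.abs_le hb hl0.le ht.le
  refine lintegral_enorm_sq_le_of_damped hs.continuousOn fun x hx hx1 => ?_
  have hd := dampedIntegrable_of_continuousOn hx hs.continuousOn hM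
  have hP := lintegral_laplace_sq hd (hd.integrableOn_sq (abs_damped_le hx hM))
  set K := l ^ (1 / rho b) with hK
  have hK0 : 0 < K := Real.rpow_pos_of_pos hl0 _
  have hle : ∫⁻ k : ℝ, ‖laplace s (x + k * Complex.I)‖ₑ ^ 2 ≤
      ENNReal.ofReal (2 * (c ^ 2)⁻¹ * s 0 ^ 2) * ENNReal.ofReal (Real.pi * K⁻¹) := by
    rw [← lintegral_inv_sq_add_sq hK0, ← lintegral_const_mul _ (by fun_prop)]
    refine lintegral_mono fun k => ?_
    have hre : (x + k * Complex.I : ℂ).re = x := by simp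
    have him : (x + k * Complex.I : ℂ).im = k := by simp
    set z : ℂ := x + k * Complex.I
    obtain ⟨h1, h2⟩ := hcz l hl z (by rwa [hre]) (by rwa [hre])
    have h3 := congrArg norm (hs.laplace_eq hb hl0.le (z := z) (by rwa [hre]))
    rw [norm_mul, Complex.norm_real, Real.norm_eq_abs] at h3
    rw [him] at h1
    rw [← ofReal_norm, ← ENNReal.ofReal_pow (norm_nonneg _),
      ← ENNReal.ofReal_mul (by positivity)]
    refine ENNReal.ofReal_le_ofReal ?_
    have h4 : c ^ 2 * (K ^ 2 + k ^ 2) ≤ 2 * ‖z + l * laplace b z‖ ^ 2 := by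
      have h5 := pow_le_pow_left₀ (by positivity) h1 2
      have h6 := pow_le_pow_left₀ (by positivity) h2 2
      rw [mul_pow, sq_abs] at h5
      rw [mul_pow] at h6
      linarith
    have h7 : ‖z + l * laplace b z‖ ^ 2 * ‖laplace s z‖ ^ 2 = s 0 ^ 2 := by
      rw [← mul_pow, h3, sq_abs]
    have h8 : 0 < K ^ 2 + k ^ 2 := by positivity
    have e : 2 * (c ^ 2)⁻¹ * s 0 ^ 2 * (K ^ 2 + k ^ 2)⁻¹ =
        2 * s 0 ^ 2 / (c ^ 2 * (K ^ 2 + k ^ 2)) := by field_simp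
    rw [e, le_div_iff₀ (by positivity), ← h7]
    nlinarith [sq_nonneg ‖laplace s z‖]
  rw [hP, ← ENNReal.ofReal_mul (by positivity)] at hle
  have e : 2 * (c ^ 2)⁻¹ * s 0 ^ 2 * (Real.pi * K⁻¹) =
      2 * Real.pi * ((c ^ 2)⁻¹ * l ^ (-(1 / rho b)) * s 0 ^ 2) := by
    rw [Real.rpow_neg hl0.le]; ring
  rw [e, ENNReal.ofReal_mul (p := 2 * Real.pi) (by positivity)] at hle
  exact (ENNReal.mul_le_mul_iff_right (by simp [Real.pi_pos]) ENNReal.ofReal_ne_top).1 hle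

/-- Comparison of the solution `v` with `r`, where `y' + l (b * r) = 0` and `v(0) = y(0)`: the
Laplace transforms satisfy `(z + l b̂)(v̂ - r̂) = z (ŷ - r̂)`, and `z / (z + l b̂)` is bounded uniformly
in `l`. -/
theorem IsAdmissibleKernel.lintegral_sub_sq_le {b : ℝ → ℝ} (hb : IsAdmissibleKernel b) {l : ℝ}
    (hl : 0 ≤ l) {v y r : ℝ → ℝ} {M N : ℝ} (hv : IsScalarSolution b l v)
    (hy : ContinuousOn y (Ici 0)) (hr : ContinuousOn r (Ici 0)) (hyM : ∀ t, 0 < t → |y t| ≤ M)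
    (hrN : ∀ t, 0 < t → |r t| ≤ N) (hyr : ∀ t, 0 < t → HasDerivAt y (-(l * conv b r t)) t)
    (h0 : v 0 = y 0) :
    ∫⁻ t in Ioi (0 : ℝ), ‖v t - r t‖ₑ ^ 2 ≤
      ENNReal.ofReal ((2 / Real.cos ((rho b - 1) * (Real.pi / 2))) ^ 2) *
        ∫⁻ t in Ioi (0 : ℝ), ‖y t - r t‖ₑ ^ 2 := by
  set c := Real.cos ((rho b - 1) * (Real.pi / 2)) with hc
  have hc0 : 0 < c := hb.cos_sector_pos
  have hvM : ∀ t, 0 < t → |v t| ≤ |v 0| := fun t ht => hv.abs_le hb hl ht.le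
  refine lintegral_enorm_sq_le_of_damped (hv.continuousOn.sub hr) fun x hx _ => ?_
  have hvd := dampedIntegrable_of_continuousOn hx hv.continuousOn hvM
  have hyd := dampedIntegrable_of_continuousOn hx hy hyM
  have hrd := dampedIntegrable_of_continuousOn hx hr hrN
  have h1 := lintegral_laplace_sq (hvd.sub hrd) ((hvd.sub hrd).integrableOn_sq
    (abs_damped_le hx fun t ht => (abs_sub _ _).trans (add_le_add (hvM t ht) (hrN t ht))))
  have h2 := lintegral_laplace_sq (hyd.sub hrd) ((hyd.sub hrd).integrableOn_sq
    (abs_damped_le hx fun t ht => (abs_sub _ _).trans (add_le_add (hyM t ht) (hrN t ht))))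
  have h3 : ∫⁻ k : ℝ, ‖laplace (fun t => v t - r t) (x + k * Complex.I)‖ₑ ^ 2 ≤
      ENNReal.ofReal ((2 / c) ^ 2) *
        ∫⁻ k : ℝ, ‖laplace (fun t => y t - r t) (x + k * Complex.I)‖ₑ ^ 2 := by
    rw [← lintegral_const_mul' _ _ ENNReal.ofReal_ne_top]
    refine lintegral_mono fun k => ?_
    have hre : (x + k * Complex.I : ℂ).re = x := by simp
    set z : ℂ := x + k * Complex.I
    have hz : 0 < z.re := by rwa [hre]
    rw [laplace_sub (by rwa [hre]) (by rwa [hre]), laplace_sub (by rwa [hre]) (by rwa [hre])]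
    have e1 := hv.laplace_eq hb hl hz
    have e2 := laplace_of_hasDerivAt (g := fun t => l * r t) hz (hb.dampedIntegrable hz)
      (dampedIntegrable_of_continuousOn (M := l * N) hz (hr.const_smul l) fun t ht => by
        rw [abs_mul, abs_of_nonneg hl]; exact mul_le_mul_of_nonneg_left (hrN t ht) hl) hy hyM
      (fun t ht => by rw [conv_const_mul]; exact hyr t ht)
    rw [laplace_const_mul] at e2
    have e3 : (z + l * laplace b z) * (laplace v z - laplace r z) =
        z * (laplace y z - laplace r z) := by
      rw [h0] at e1
      linear_combination e1 - e2
    have e4 := congrArg norm e3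
    rw [norm_mul, norm_mul] at e4
    have e5 := hb.cos_sector_mul_norm_self_le hz hl
    have hz0 : 0 < ‖z‖ := norm_pos_iff.2 fun h => by rw [h] at hz; simp at hz
    have e6 : ‖laplace v z - laplace r z‖ ≤ 2 / c * ‖laplace y z - laplace r z‖ := by
      rw [div_mul_eq_mul_div, le_div_iff₀ hc0]
      have e7 : c / 2 * ‖z‖ * ‖laplace v z - laplace r z‖ ≤ ‖z‖ * ‖laplace y z - laplace r z‖ :=
        e4 ▸ mul_le_mul_of_nonneg_right e5 (norm_nonneg _)
      have e8 : ‖z‖ * (‖laplace v z - laplace r z‖ * c) ≤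
          ‖z‖ * (2 * ‖laplace y z - laplace r z‖) := by linarith
      exact le_of_mul_le_mul_left e8 hz0
    rw [← ofReal_norm, ← ofReal_norm, ← ENNReal.ofReal_pow (norm_nonneg _),
      ← ENNReal.ofReal_pow (norm_nonneg _), ← ENNReal.ofReal_mul (by positivity), ← mul_pow]
    exact ENNReal.ofReal_le_ofReal (pow_le_pow_left₀ (norm_nonneg _) e6 2)
  rw [h1, h2, mul_left_comm, ENNReal.mul_le_mul_iff_right (by simp [Real.pi_pos])
    ENNReal.ofReal_ne_top] at h3
  refine h3.trans (mul_le_mul_right ?_ _)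
  refine setLIntegral_mono' measurableSet_Ioi fun t ht => ?_
  gcongr
  rw [enorm_mul]
  refine mul_le_of_le_one_left zero_le ?_
  rw [← ofReal_norm, Real.norm_of_nonneg (Real.exp_pos _).le, ENNReal.ofReal_le_one]
  exact Real.exp_le_one_iff.2 (by nlinarith [mem_Ioi.1 ht])

/-! ### Spectral decomposition -/

theorem mem_eigenspace_iff {H : Type*} [NormedAddCommGroup H] [InnerProductSpace ℝ H]
    {A : H →ₗ.[ℝ] H} {μ : ℝ} {x : H} :
    x ∈ eigenspace A μ ↔ ∃ hx : x ∈ A.domain, A ⟨x, hx⟩ = μ • x := by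
  constructor
  · rintro ⟨y, hy, rfl⟩
    refine ⟨y.2, ?_⟩
    have h : A.toFun y - μ • (y : H) = 0 := hy
    exact sub_eq_zero.1 h
  · rintro ⟨hx, h⟩
    refine ⟨⟨x, hx⟩, ?_, rfl⟩
    change A.toFun ⟨x, hx⟩ - μ • x = 0
    exact sub_eq_zero.2 h

variable {H : Type*} [NormedAddCommGroup H] [InnerProductSpace ℝ H] [CompleteSpace H]

theorem inner_eigenproj_left (A : H →ₗ.[ℝ] H) (μ : ℝ) (x y : H) :
    ⟪eigenproj A μ x, y⟫ = ⟪x, eigenproj A μ y⟫ :=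
  Submodule.inner_starProjection_left_eq_right _ x y

theorem inner_eigenproj_eigenproj (A : H →ₗ.[ℝ] H) (μ : ℝ) (x y : H) :
    ⟪eigenproj A μ x, eigenproj A μ y⟫ = ⟪eigenproj A μ x, y⟫ := by
  rw [← inner_eigenproj_left, eigenproj,
    Submodule.starProjection_eq_self_iff.2 (Submodule.starProjection_apply_mem _ x)]

namespace IsPositiveWithCompactInverse

variable {A : H →ₗ.[ℝ] H}

theorem inner_map_left (hA : IsPositiveWithCompactInverse A) (x y : A.domain) :
    ⟪A x, (y : H)⟫ = ⟪(x : H), A y⟫ := by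
  have h := LinearPMap.adjoint_isFormalAdjoint (T := A) hA.dense_domain
  rw [LinearPMap.isSelfAdjoint_def.1 hA.selfAdjoint] at h
  exact h x y

theorem isClosed_eigenspace (hA : IsPositiveWithCompactInverse A) (μ : ℝ) :
    IsClosed (eigenspace A μ : Set H) := by
  obtain ⟨T, -, hT1, hT2⟩ := hA.compact_inverse
  have h : (eigenspace A μ : Set H) = {x | T (μ • x) = x} := by
    ext x
    rw [SetLike.mem_coe, mem_eigenspace_iff, mem_ofPred_eq]
    constructor
    · rintro ⟨hx, h⟩
      rw [← h]; exact hT2 ⟨x, hx⟩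
    · intro h
      obtain ⟨hy, h1⟩ := hT1 (μ • x)
      have hx : x ∈ A.domain := by rw [← h]; exact hy
      refine ⟨hx, ?_⟩
      rw [← h1]; congr 1; exact Subtype.ext h.symm
  rw [h]
  exact isClosed_eq (by fun_prop) continuous_id

theorem eigenproj_mem (hA : IsPositiveWithCompactInverse A) (μ : ℝ) (x : H) :
    eigenproj A μ x ∈ eigenspace A μ := by
  have h : (eigenspace A μ).topologicalClosure = eigenspace A μ :=
    (hA.isClosed_eigenspace μ).submodule_topologicalClosure_eq
  rw [← h]
  exact Submodule.starProjection_apply_mem _ x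

theorem eigenproj_of_mem {μ : ℝ} {x : H} (hx : x ∈ eigenspace A μ) : eigenproj A μ x = x :=
  Submodule.starProjection_eq_self_iff.2 (Submodule.le_topologicalClosure _ hx)

/-- The spectrum is bounded away from zero. -/
theorem exists_pos_le (hA : IsPositiveWithCompactInverse A) :
    ∃ μ₀ > 0, ∀ μ x, eigenproj A μ x ≠ 0 → μ₀ ≤ μ := by
  obtain ⟨T, -, hT1, hT2⟩ := hA.compact_inverse
  refine ⟨1 / (‖T‖ + 1), by positivity, fun μ x hx => ?_⟩
  obtain ⟨he, h⟩ := mem_eigenspace_iff.1 (hA.eigenproj_mem μ x)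
  set e := eigenproj A μ x
  have hpos : 0 < ‖e‖ := norm_pos_iff.2 hx
  have hμ : 0 ≤ μ := by
    have h1 := hA.nonneg ⟨e, he⟩
    rw [h, real_inner_smul_left, real_inner_self_eq_norm_sq] at h1
    exact nonneg_of_mul_nonneg_left h1 (by positivity)
  have h2 : T (μ • e) = e := by rw [← h]; exact hT2 ⟨e, he⟩
  have h3 : ‖e‖ ≤ ‖T‖ * (μ * ‖e‖) := by
    conv_lhs => rw [← h2]
    refine (T.le_opNorm _).trans_eq ?_
    rw [norm_smul, Real.norm_of_nonneg hμ]
  rw [div_le_iff₀ (by positivity)]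
  have h4 : 1 * ‖e‖ ≤ (‖T‖ * μ) * ‖e‖ := by linarith
  have := le_of_mul_le_mul_right h4 hpos
  nlinarith

theorem inner_eq_zero_of_ne (hA : IsPositiveWithCompactInverse A) {μ ν : ℝ} (hne : μ ≠ ν)
    {x y : H} (hx : x ∈ eigenspace A μ) (hy : y ∈ eigenspace A ν) : ⟪x, y⟫ = 0 := by
  obtain ⟨hx, h1⟩ := mem_eigenspace_iff.1 hx
  obtain ⟨hy, h2⟩ := mem_eigenspace_iff.1 hy
  have h := hA.inner_map_left ⟨x, hx⟩ ⟨y, hy⟩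
  rw [h1, h2, real_inner_smul_left, real_inner_smul_right] at h
  have h3 : (μ - ν) * ⟪x, y⟫ = 0 := by linarith
  exact (mul_eq_zero.1 h3).resolve_left (sub_ne_zero.2 hne)

theorem orthogonalFamily (hA : IsPositiveWithCompactInverse A) :
    OrthogonalFamily ℝ (fun μ : ℝ => eigenspace A μ) fun μ => (eigenspace A μ).subtypeₗᵢ :=
  fun _ _ hne x y => hA.inner_eq_zero_of_ne hne x.2 y.2

theorem eigenproj_eigenproj_of_ne (hA : IsPositiveWithCompactInverse A) {μ ν : ℝ} (hne : μ ≠ ν)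
    (x : H) : eigenproj A ν (eigenproj A μ x) = 0 := by
  rw [← inner_self_eq_zero (𝕜 := ℝ), inner_eigenproj_eigenproj]
  exact hA.inner_eq_zero_of_ne hne.symm (hA.eigenproj_mem _ _) (hA.eigenproj_mem _ _)

theorem eigenproj_of_hasSum (hA : IsPositiveWithCompactInverse A) {c : ℝ → ℝ} {x y : H}
    (h : HasSum (fun μ => c μ • eigenproj A μ x) y) (ν : ℝ) :
    eigenproj A ν y = c ν • eigenproj A ν x := by
  have h1 := h.mapL (eigenproj A ν)
  refine h1.unique ?_
  have h2 := hasSum_single (f := fun μ => eigenproj A ν (c μ • eigenproj A μ x)) ν fun μ hμ => by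
    rw [map_smul, hA.eigenproj_eigenproj_of_ne hμ, smul_zero]
  rwa [map_smul, eigenproj_of_mem (hA.eigenproj_mem ν x)] at h2

theorem summable_smul_eigenproj (hA : IsPositiveWithCompactInverse A) {c : ℝ → ℝ} {x : H}
    (h : Summable fun μ => c μ ^ 2 * ‖eigenproj A μ x‖ ^ 2) :
    Summable fun μ => c μ • eigenproj A μ x := by
  have h1 := hA.orthogonalFamily.summable_iff_norm_sq_summable
    (fun μ => ⟨c μ • eigenproj A μ x, Submodule.smul_mem _ _ (hA.eigenproj_mem μ x)⟩)
  refine h1.2 (h.congr fun μ => ?_)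
  rw [Submodule.coe_norm, norm_smul, mul_pow, Real.norm_eq_abs, sq_abs]

theorem summable_norm_eigenproj_sq (hA : IsPositiveWithCompactInverse A) (x : H) :
    Summable fun μ => ‖eigenproj A μ x‖ ^ 2 := by
  refine summable_of_sum_le (c := ‖x‖ ^ 2) (fun μ => sq_nonneg _) fun F => ?_
  set y := ∑ μ ∈ F, eigenproj A μ x
  have h1 : ‖y‖ ^ 2 = ∑ μ ∈ F, ‖eigenproj A μ x‖ ^ 2 :=
    hA.orthogonalFamily.norm_sum (fun μ => ⟨eigenproj A μ x, hA.eigenproj_mem μ x⟩) F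
  have h2 : ⟪y, x⟫ = ∑ μ ∈ F, ‖eigenproj A μ x‖ ^ 2 := by
    rw [sum_inner]
    refine Finset.sum_congr rfl fun μ _ => ?_
    rw [← inner_eigenproj_eigenproj, real_inner_self_eq_norm_sq]
  have h3 := real_inner_le_norm y x
  rw [← h1] at h2 ⊢
  rw [h2] at h3
  nlinarith [norm_nonneg y, norm_nonneg x]

/-- Completeness of the eigenspaces, from the spectral theorem for the compact inverse. -/
theorem hasSum_eigenproj (hA : IsPositiveWithCompactInverse A) (x : H) :
    HasSum (fun μ => eigenproj A μ x) x := by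
  have hs : Summable fun μ => (1 : ℝ) • eigenproj A μ x :=
    hA.summable_smul_eigenproj (c := fun _ => 1) (by simpa using hA.summable_norm_eigenproj_sq x)
  obtain ⟨y, hy⟩ := hs
  have hP : ∀ ν, eigenproj A ν y = eigenproj A ν x := fun ν => by
    simpa using hA.eigenproj_of_hasSum (c := fun _ => 1) hy ν
  obtain ⟨T, hTc, hT1, hT2⟩ := hA.compact_inverse
  have hsymm : T.IsSymmetric := by
    intro u v
    obtain ⟨hu, h1⟩ := hT1 u
    obtain ⟨hv, h2⟩ := hT1 v
    have h := hA.inner_map_left ⟨T u, hu⟩ ⟨T v, hv⟩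
    rw [h1, h2] at h
    exact h.symm
  have hbot := T.orthogonalComplement_iSup_eigenspaces_eq_bot hTc hsymm
  have hmem : x - y ∈ (⨆ ν, Module.End.eigenspace (T : Module.End ℝ H) ν)ᗮ := by
    rw [← Submodule.iInf_orthogonal, Submodule.mem_iInf]
    intro ν
    rw [Submodule.mem_orthogonal]
    intro e he
    have he' : T e = ν • e := Module.End.mem_eigenspace_iff.1 he
    obtain ⟨hd, h1⟩ := hT1 e
    by_cases hν : ν = 0
    · have h2 : (⟨T e, hd⟩ : A.domain) = 0 := Subtype.ext (by simp [he', hν])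
      rw [h2, LinearPMap.map_zero] at h1
      rw [← h1, inner_zero_left]
    · have he2 : e ∈ eigenspace A ν⁻¹ := by
        have hed : e ∈ A.domain := by
          have h3 := A.domain.smul_mem ν⁻¹ hd
          rwa [he', smul_smul, inv_mul_cancel₀ hν, one_smul] at h3
        refine mem_eigenspace_iff.2 ⟨hed, ?_⟩
        have h4 : (⟨e, hed⟩ : A.domain) = ν⁻¹ • ⟨T e, hd⟩ :=
          Subtype.ext (by simp [he', smul_smul, inv_mul_cancel₀ hν])
        rw [h4, LinearPMap.map_smul, h1]
      rw [← eigenproj_of_mem he2, inner_eigenproj_left, map_sub, hP, sub_self, inner_zero_right]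
  rw [hbot, Submodule.mem_bot, sub_eq_zero] at hmem
  rw [hmem]
  simpa [hP] using hy

theorem hasSum_inner_eigenproj (hA : IsPositiveWithCompactInverse A) (x y : H) :
    HasSum (fun μ => ⟪eigenproj A μ x, eigenproj A μ y⟫) ⟪x, y⟫ := by
  have h := (hA.hasSum_eigenproj x).mapL (innerSL ℝ y)
  simp only [innerSL_apply_apply] at h
  rw [real_inner_comm]
  refine h.congr_fun fun μ => ?_
  rw [inner_eigenproj_eigenproj, real_inner_comm]

theorem hasSum_norm_eigenproj_sq (hA : IsPositiveWithCompactInverse A) (x : H) :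
    HasSum (fun μ => ‖eigenproj A μ x‖ ^ 2) (‖x‖ ^ 2) := by
  simpa using hA.hasSum_inner_eigenproj x x

theorem pos_of_eigenproj_ne_zero (hA : IsPositiveWithCompactInverse A) {μ : ℝ} {x : H}
    (h : eigenproj A μ x ≠ 0) : 0 < μ := by
  obtain ⟨μ₀, h0, h1⟩ := hA.exists_pos_le
  exact h0.trans_le (h1 μ x h)

theorem eigenproj_map (hA : IsPositiveWithCompactInverse A) (x : A.domain) (μ : ℝ) :
    eigenproj A μ (A x) = μ • eigenproj A μ (x : H) := by
  refine ext_inner_right ℝ fun f => ?_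
  obtain ⟨hf, h⟩ := mem_eigenspace_iff.1 (hA.eigenproj_mem μ f)
  rw [inner_eigenproj_left, real_inner_smul_left, inner_eigenproj_left]
  have h1 := hA.inner_map_left x ⟨_, hf⟩
  rw [h, real_inner_smul_right] at h1
  exact h1

/-! ### Fractional powers -/

theorem rpow_sq_mul_norm_eigenproj_sq (hA : IsPositiveWithCompactInverse A) (r μ : ℝ) (x : H) :
    (μ ^ r) ^ 2 * ‖eigenproj A μ x‖ ^ 2 = μ ^ (2 * r) * ‖eigenproj A μ x‖ ^ 2 := by
  by_cases h : eigenproj A μ x = 0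
  · simp [h]
  · rw [mul_comm 2 r, Real.rpow_mul (hA.pos_of_eigenproj_ne_zero h).le]
    norm_cast

theorem hasSum_fracPow (hA : IsPositiveWithCompactInverse A) {r : ℝ} {x : H}
    (hx : x ∈ fracDomain A r) : HasSum (fun μ : ℝ => μ ^ r • eigenproj A μ x) (fracPow A r x) :=
  (hA.summable_smul_eigenproj (Summable.congr hx fun μ =>
    (hA.rpow_sq_mul_norm_eigenproj_sq r μ x).symm)).hasSum

theorem eigenproj_fracPow (hA : IsPositiveWithCompactInverse A) {r : ℝ} {x : H}
    (hx : x ∈ fracDomain A r) (μ : ℝ) :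
    eigenproj A μ (fracPow A r x) = μ ^ r • eigenproj A μ x :=
  hA.eigenproj_of_hasSum (hA.hasSum_fracPow hx) μ

theorem hasSum_fracNorm_sq (hA : IsPositiveWithCompactInverse A) {r : ℝ} {x : H}
    (hx : x ∈ fracDomain A (r / 2)) :
    HasSum (fun μ : ℝ => μ ^ r * ‖eigenproj A μ x‖ ^ 2) (fracNorm A r x ^ 2) := by
  refine (hA.hasSum_norm_eigenproj_sq (fracPow A (r / 2) x)).congr_fun fun μ => ?_
  rw [hA.eigenproj_fracPow hx, norm_smul, mul_pow, Real.norm_eq_abs, sq_abs,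
    hA.rpow_sq_mul_norm_eigenproj_sq, mul_div_cancel₀ r two_ne_zero]

theorem domain_subset_fracDomain_half (hA : IsPositiveWithCompactInverse A) (x : A.domain) :
    (x : H) ∈ fracDomain A (1 / 2) := by
  refine (hA.hasSum_inner_eigenproj (A x) x).summable.congr fun μ => ?_
  rw [hA.eigenproj_map, real_inner_smul_left, real_inner_self_eq_norm_sq]
  norm_num

theorem domain_subset_fracDomain_one (hA : IsPositiveWithCompactInverse A) (x : A.domain) :
    (x : H) ∈ fracDomain A (2 / 2) := by
  refine (hA.hasSum_norm_eigenproj_sq (A x)).summable.congr fun μ => ?_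
  rw [hA.eigenproj_map, norm_smul, mul_pow, Real.norm_eq_abs, sq_abs]
  norm_num

theorem fracNorm_two (hA : IsPositiveWithCompactInverse A) (x : A.domain) :
    fracNorm A 2 (x : H) = ‖A x‖ := by
  have h1 := hA.hasSum_fracNorm_sq (hA.domain_subset_fracDomain_one x)
  have h2 : fracNorm A 2 (x : H) ^ 2 = ‖A x‖ ^ 2 := by
    refine (h1.congr_fun fun μ => ?_).unique (hA.hasSum_norm_eigenproj_sq (A x))
    rw [hA.eigenproj_map, norm_smul, mul_pow, Real.norm_eq_abs, sq_abs]
    norm_num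
  exact (pow_left_inj₀ (norm_nonneg _) (norm_nonneg _) two_ne_zero).1 h2

theorem hasSum_energy (hA : IsPositiveWithCompactInverse A) {u v : H}
    (hu : u ∈ fracDomain A (1 / 2)) (hv : v ∈ fracDomain A (1 / 2)) :
    HasSum (fun μ => μ * ⟪eigenproj A μ u, eigenproj A μ v⟫) (energy A u v) := by
  refine (hA.hasSum_inner_eigenproj (fracPow A (1 / 2) u) (fracPow A (1 / 2) v)).congr_fun
    fun μ => ?_
  rw [hA.eigenproj_fracPow hu, hA.eigenproj_fracPow hv, real_inner_smul_left,
    real_inner_smul_right, ← mul_assoc]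
  by_cases h : eigenproj A μ u = 0
  · simp [h]
  · rw [← Real.rpow_add (hA.pos_of_eigenproj_ne_zero h)]
    norm_num

theorem energy_eq_inner (hA : IsPositiveWithCompactInverse A) (u : A.domain) {v : H}
    (hv : v ∈ fracDomain A (1 / 2)) : energy A (u : H) v = ⟪A u, v⟫ := by
  refine ((hA.hasSum_energy (hA.domain_subset_fracDomain_half u) hv).congr_fun fun μ => ?_).unique
    (hA.hasSum_inner_eigenproj (A u) v)
  rw [hA.eigenproj_map, real_inner_smul_left]

/-- The spectral cut-off at level `K`; it maps into the domain of `A`. -/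
theorem exists_spectral_cutoff (hA : IsPositiveWithCompactInverse A) (x : H) (K : ℝ) :
    ∃ y : A.domain, ∀ μ, eigenproj A μ (y : H) = if μ ≤ K then eigenproj A μ x else 0 := by
  classical
  obtain ⟨T, -, hT1, -⟩ := hA.compact_inverse
  -- `y = A⁻¹ w` for `w = ∑_{μ ≤ K} μ P_μ x`
  set c : ℝ → ℝ := fun μ => if μ ≤ K then μ else 0 with hc
  have hs : Summable fun μ => c μ • eigenproj A μ x := by
    refine hA.summable_smul_eigenproj (Summable.of_nonneg_of_le (fun μ => by positivity)
      (fun μ => ?_) ((hA.summable_norm_eigenproj_sq x).mul_left (K ^ 2)))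
    by_cases h : eigenproj A μ x = 0
    · simp [h]
    · have hμ := hA.pos_of_eigenproj_ne_zero h
      refine mul_le_mul_of_nonneg_right ?_ (sq_nonneg _)
      simp only [hc]
      split_ifs with hK
      · exact pow_le_pow_left₀ hμ.le hK 2
      · simpa using sq_nonneg K
  obtain ⟨w, hw⟩ := hs
  obtain ⟨hd, h1⟩ := hT1 w
  refine ⟨⟨T w, hd⟩, fun μ => ?_⟩
  have h2 := hA.eigenproj_map ⟨T w, hd⟩ μ
  rw [h1, hA.eigenproj_of_hasSum hw] at h2
  by_cases hμ : 0 < μ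
  · have h3 : μ • eigenproj A μ (T w) = μ • (if μ ≤ K then eigenproj A μ x else 0) := by
      rw [← h2]
      simp only [hc]
      split_ifs <;> simp
    exact smul_right_injective H hμ.ne' h3
  · have h0 : ∀ v, eigenproj A μ v = 0 := fun v => by
      by_contra h
      exact hμ (hA.pos_of_eigenproj_ne_zero h)
    simp [h0]

end IsPositiveWithCompactInverse

/-! ### Weighted spectral sums -/

/-- `‖x‖_r² = ∑ μ^r ‖P_μ x‖²` as an extended nonnegative number, defined for all `x ∈ H`. -/
def spectralSum (A : H →ₗ.[ℝ] H) (r : ℝ) (x : H) : ENNReal :=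
  ∑' μ : ℝ, ENNReal.ofReal (μ ^ r * ‖eigenproj A μ x‖ ^ 2)

theorem IsPositiveWithCompactInverse.rpow_mul_norm_eigenproj_sq_nonneg {A : H →ₗ.[ℝ] H}
    (hA : IsPositiveWithCompactInverse A) (r μ : ℝ) (x : H) :
    0 ≤ μ ^ r * ‖eigenproj A μ x‖ ^ 2 := by
  by_cases h : eigenproj A μ x = 0
  · simp [h]
  · have := hA.pos_of_eigenproj_ne_zero h
    positivity

theorem IsPositiveWithCompactInverse.spectralSum_eq {A : H →ₗ.[ℝ] H}
    (hA : IsPositiveWithCompactInverse A) {r : ℝ} {x : H} (hx : x ∈ fracDomain A (r / 2)) :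
    spectralSum A r x = ENNReal.ofReal (fracNorm A r x ^ 2) := by
  have h := hA.hasSum_fracNorm_sq hx
  rw [← h.tsum_eq, ENNReal.ofReal_tsum_of_nonneg
    (fun μ => hA.rpow_mul_norm_eigenproj_sq_nonneg r μ x) h.summable, spectralSum]

theorem enorm_sq_eq_ofReal {E : Type*} [SeminormedAddGroup E] (x : E) :
    ‖x‖ₑ ^ 2 = ENNReal.ofReal (‖x‖ ^ 2) := by
  rw [ENNReal.ofReal_pow (norm_nonneg _), ofReal_norm]

theorem IsPositiveWithCompactInverse.tsum_enorm_eigenproj_sq {A : H →ₗ.[ℝ] H}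
    (hA : IsPositiveWithCompactInverse A) (x : H) :
    ∑' μ, ‖eigenproj A μ x‖ₑ ^ 2 = ‖x‖ₑ ^ 2 := by
  have h := hA.hasSum_norm_eigenproj_sq x
  rw [enorm_sq_eq_ofReal, ← h.tsum_eq, ENNReal.ofReal_tsum_of_nonneg (fun μ => sq_nonneg _)
    h.summable]
  simp_rw [enorm_sq_eq_ofReal]

theorem IsPositiveWithCompactInverse.countable_setOf_eigenproj_ne_zero {A : H →ₗ.[ℝ] H}
    (hA : IsPositiveWithCompactInverse A) (x : H) : {μ | eigenproj A μ x ≠ 0}.Countable := by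
  have h := (hA.summable_norm_eigenproj_sq x).countable_support
  refine h.mono fun μ hμ => ?_
  simpa [Function.mem_support] using hμ

/-- Exchange of an integral with a sum over an uncountable index set, of which only countably many
terms do not vanish; the index `μ` of the spectral sums runs over all of `ℝ`. -/
theorem lintegral_tsum_of_countable {α ι : Type*} [MeasurableSpace α] {ν : Measure α} {c : Set ι}
    (hc : c.Countable) {f : ι → α → ENNReal} (hf : ∀ i ∈ c, AEMeasurable (f i) ν)
    (h0 : ∀ᵐ a ∂ν, ∀ i ∉ c, f i a = 0) :
    ∫⁻ a, ∑' i, f i a ∂ν = ∑' i, ∫⁻ a, f i a ∂ν := by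
  have := hc.to_subtype
  have h1 : ∑' i, ∫⁻ a, f i a ∂ν = ∑' i : c, ∫⁻ a, f i a ∂ν := by
    refine (tsum_subtype_eq_of_support_subset fun i hi => ?_).symm
    by_contra h
    refine hi ?_
    have h2 : ∫⁻ a, f i a ∂ν = ∫⁻ _, 0 ∂ν :=
      lintegral_congr_ae (h0.mono fun a ha => ha i h)
    simpa using h2
  rw [h1, ← lintegral_tsum fun i : c => hf i i.2]
  refine lintegral_congr_ae ?_
  filter_upwards [h0] with a ha
  refine (tsum_subtype_eq_of_support_subset fun i hi => ?_).symm
  by_contra h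
  exact hi (ha i h)

/-! ### Spectral components of a resolvent family -/

theorem IsResolventFamily.continuousOn_inner {E : Type*} [NormedAddCommGroup E]
    [InnerProductSpace ℝ E] {A : E →ₗ.[ℝ] E} {S : ℝ → E →L[ℝ] E} {b : ℝ → ℝ}
    (hS : IsResolventFamily b A S) (x f : E) : ContinuousOn (fun t => ⟪S t x, f⟫) (Ici 0) :=
  (hS.continuousOn x).inner continuousOn_const

section ResolventFamily

variable {E : Type*} [NormedAddCommGroup E] [InnerProductSpace ℝ E] [CompleteSpace E]
  {A : E →ₗ.[ℝ] E} {S : ℝ → E →L[ℝ] E} {b : ℝ → ℝ}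

theorem IsResolventFamily.hasDerivAt_inner (hb : IsAdmissibleKernel b)
    (hS : IsResolventFamily b A S) (x : A.domain) (f : E) {t : ℝ} (ht : 0 < t) :
    HasDerivAt (fun τ => ⟪S τ x, f⟫) (-conv b (fun s => ⟪S s (A x), f⟫) t) t := by
  have h1 := (innerSL ℝ f).hasFDerivAt.comp_hasDerivAt t (hS.hasDerivAt x t ht)
  have hint : IntervalIntegrable (fun s => b (t - s) • S s (A x)) volume 0 t :=
    (intervalIntegrable_sub_left hb.locallyIntegrable ht).smul_continuousOn
      ((hS.continuousOn (A x)).mono (by rw [uIcc_of_le ht.le]; exact Icc_subset_Ici_self))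
  rw [map_neg, ← (innerSL ℝ f).intervalIntegral_comp_comm hint] at h1
  refine (h1.congr_deriv ?_).congr_of_eventuallyEq (Eventually.of_forall fun τ => ?_)
  · rw [conv]
    congr 1
    refine intervalIntegral.integral_congr fun s _ => ?_
    simp [real_inner_comm]
  · simp [real_inner_comm]

/-- A weak eigenvector of `A` turns the resolvent equation into the scalar one. -/
theorem IsResolventFamily.isScalarSolution_inner (hb : IsAdmissibleKernel b)
    (hS : IsResolventFamily b A S) {f : E} {l : ℝ}
    (hf : ∀ x : A.domain, ⟪A x, f⟫ = l * ⟪(x : E), f⟫) (x : A.domain) :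
    IsScalarSolution b l fun t => ⟪S t x, f⟫ where
  continuousOn := hS.continuousOn_inner x f
  hasDerivAt t ht := by
    refine (hS.hasDerivAt_inner hb x f ht).congr_deriv ?_
    rw [← conv_const_mul]
    congr 1
    refine conv_congr ht.le fun s hs => ?_
    obtain ⟨hx, h⟩ := hS.commute s hs.1.le x
    rw [← h, hf]

/-- On the eigenspace for `μ`, the resolvent family acts by the solution `s` of the scalar equation
with `s(0) = 1`. Such a solution is read off from the resolvent family itself, on the eigenvector
`P_μ y`; uniqueness and density of the domain give the identity for all `x`. -/
theorem IsResolventFamily.exists_isScalarSolution (hb : IsAdmissibleKernel b)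
    (hA : IsPositiveWithCompactInverse A) (hS : IsResolventFamily b A S) {μ : ℝ} {y : E}
    (hμ : eigenproj A μ y ≠ 0) : ∃ s, IsScalarSolution b μ s ∧ s 0 = 1 ∧
      ∀ t, 0 ≤ t → ∀ x, eigenproj A μ (S t x) = s t • eigenproj A μ x := by
  set e := eigenproj A μ y
  have hμ0 := hA.pos_of_eigenproj_ne_zero hμ
  have hweak : ∀ f ∈ eigenspace A μ, ∀ x : A.domain, ⟪A x, f⟫ = μ * ⟪(x : E), f⟫ := by
    intro f hf x
    obtain ⟨hfd, h⟩ := mem_eigenspace_iff.1 hf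
    rw [hA.inner_map_left x ⟨f, hfd⟩, h, real_inner_smul_right]
  have he : e ∈ eigenspace A μ := hA.eigenproj_mem μ y
  obtain ⟨hed, -⟩ := mem_eigenspace_iff.1 he
  have hs := (hS.isScalarSolution_inner hb (hweak e he) ⟨e, hed⟩).const_mul (⟪e, e⟫)⁻¹
  set s := fun t => (⟪e, e⟫)⁻¹ * ⟪S t e, e⟫ with hsdef
  have hs0 : s 0 = 1 := by
    simp only [hsdef, hS.zero, ContinuousLinearMap.id_apply]
    exact inv_mul_cancel₀ (inner_self_ne_zero.2 hμ)
  refine ⟨s, hs, hs0, fun t ht x => ?_⟩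
  have key : ∀ f ∈ eigenspace A μ, ∀ x : E, ⟪S t x, f⟫ = s t * ⟪x, f⟫ := by
    intro f hf
    have hdom : ∀ x ∈ (A.domain : Set E), ⟪S t x, f⟫ = s t * ⟪x, f⟫ := by
      intro x hx
      have h1 := hS.isScalarSolution_inner hb (hweak f hf) ⟨x, hx⟩
      have h2 := hs.const_mul ⟪x, f⟫
      have h3 := h1.eq_of_eq_zero hb hμ0.le h2 (by simp [hS.zero, hs0]) ht
      rw [h3, mul_comm]
    have h := Continuous.ext_on (f := fun x => ⟪S t x, f⟫) (g := fun x => s t * ⟪x, f⟫)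
      hA.dense_domain (by fun_prop) (by fun_prop) hdom
    exact fun x => congrFun h x
  refine ext_inner_right ℝ fun f => ?_
  rw [inner_eigenproj_left, real_inner_smul_left, inner_eigenproj_left]
  exact key _ (hA.eigenproj_mem μ f) x

theorem IsResolventFamily.eigenproj_eq_zero (hb : IsAdmissibleKernel b)
    (hA : IsPositiveWithCompactInverse A) (hS : IsResolventFamily b A S) {μ : ℝ} {x : E}
    (h : eigenproj A μ x = 0) {t : ℝ} (ht : 0 ≤ t) : eigenproj A μ (S t x) = 0 := by
  by_contra hne
  obtain ⟨s, -, -, h1⟩ := hS.exists_isScalarSolution hb hA hne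
  rw [h1 t ht, h, smul_zero] at hne
  exact hne rfl

theorem IsResolventFamily.norm_apply_le (hb : IsAdmissibleKernel b)
    (hA : IsPositiveWithCompactInverse A) (hS : IsResolventFamily b A S) (x : E) {t : ℝ}
    (ht : 0 ≤ t) : ‖S t x‖ ≤ ‖x‖ := by
  refine le_of_sq_le_sq ?_ (norm_nonneg _)
  refine hasSum_le (fun μ => ?_) (hA.hasSum_norm_eigenproj_sq (S t x))
    (hA.hasSum_norm_eigenproj_sq x)
  by_cases h : eigenproj A μ x = 0
  · rw [hS.eigenproj_eq_zero hb hA h ht, h]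
  · obtain ⟨s, h1, h2, h3⟩ := hS.exists_isScalarSolution hb hA h
    have h4 := h1.abs_le hb (hA.pos_of_eigenproj_ne_zero h).le ht
    rw [h2, abs_one] at h4
    rw [h3 t ht, norm_smul, Real.norm_eq_abs]
    exact pow_le_pow_left₀ (by positivity) (mul_le_of_le_one_left (norm_nonneg _) h4) 2

/-- The smoothing property of the resolvent family, `∫ ‖S(t) x‖² dt ≤ C ‖x‖²_{-1/ρ}`. -/
theorem IsResolventFamily.exists_lintegral_sq_le (hb : IsAdmissibleKernel b)
    (hA : IsPositiveWithCompactInverse A) (hS : IsResolventFamily b A S) :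
    ∃ C, 0 ≤ C ∧ ∀ x, ∫⁻ t in Ioi (0 : ℝ), ‖S t x‖ₑ ^ 2 ≤
      ENNReal.ofReal C * spectralSum A (-(1 / rho b)) x := by
  obtain ⟨μ₀, hμ₀, hμ⟩ := hA.exists_pos_le
  obtain ⟨C, hC, hCs⟩ := hb.exists_lintegral_sq_le hμ₀
  refine ⟨C, hC, fun x => ?_⟩
  rw [lintegral_congr fun t => (hA.tsum_enorm_eigenproj_sq (S t x)).symm,
    lintegral_tsum_of_countable (hA.countable_setOf_eigenproj_ne_zero x), spectralSum,
    ← ENNReal.tsum_mul_left]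
  · refine ENNReal.tsum_le_tsum fun μ => ?_
    by_cases h : eigenproj A μ x = 0
    · refine le_of_eq_of_le ?_ (zero_le (a := _))
      rw [setLIntegral_congr_fun (g := fun _ => 0) measurableSet_Ioi fun t ht => ?_, lintegral_zero]
      simp [hS.eigenproj_eq_zero hb hA h (le_of_lt ht)]
    · obtain ⟨s, h1, h2, h3⟩ := hS.exists_isScalarSolution hb hA h
      have h4 := hCs μ (hμ μ x h) s h1
      rw [setLIntegral_congr_fun (g := fun t => ‖s t‖ₑ ^ 2 * ‖eigenproj A μ x‖ₑ ^ 2)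
        measurableSet_Ioi fun t ht => ?_]
      · rw [lintegral_mul_const' _ _ (by simp)]
        refine (mul_le_mul_left h4 _).trans_eq ?_
        have h0 := hA.pos_of_eigenproj_ne_zero h
        rw [h2, enorm_sq_eq_ofReal, ← ENNReal.ofReal_mul (by positivity), ← ENNReal.ofReal_mul hC]
        congr 1; ring
      · simp only
        rw [h3 t (le_of_lt ht), enorm_smul, mul_pow]
  · intro μ _
    have h1 : ContinuousOn (fun t => eigenproj A μ (S t x)) (Ioi 0) :=
      (eigenproj A μ).continuous.comp_continuousOn
        ((hS.continuousOn x).mono Ioi_subset_Ici_self)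
    exact ((h1.aestronglyMeasurable measurableSet_Ioi).enorm).pow_const 2
  · refine (ae_restrict_iff' measurableSet_Ioi).2 (ae_of_all _ fun t ht μ h => ?_)
    have h' : eigenproj A μ x = 0 := by simpa using h
    simp [hS.eigenproj_eq_zero hb hA h' (le_of_lt ht)]

end ResolventFamily

/-! ### Comparison of discrete and continuous negative powers -/

/-- `x^(-α) = κ ∫ w^(-α) (w + x)⁻¹ dw` for `0 < α < 1`. -/
theorem rpow_neg_eq_lintegral {α : ℝ} (hα : α ∈ Ioo (0 : ℝ) 1) :
    ∃ κ : ℝ, 0 ≤ κ ∧ ∀ x, 0 < x → ENNReal.ofReal (x ^ (-α)) =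
      ENNReal.ofReal κ * ∫⁻ w in Ioi (0 : ℝ), ENNReal.ofReal (w ^ (-α) * (w + x)⁻¹) := by
  have hp : 1 - α ∈ Ioo (0 : ℝ) 1 := ⟨by linarith [hα.2], by linarith [hα.1]⟩
  have hκ := Real.integral_rpowIntegrand₀₁_one_pos hp
  refine ⟨(∫ t in Ioi (0 : ℝ), Real.rpowIntegrand₀₁ (1 - α) t 1)⁻¹, (inv_pos.2 hκ).le,
    fun x hx => ?_⟩
  have heq : ∀ w ∈ Ioi (0 : ℝ), Real.rpowIntegrand₀₁ (1 - α) w x * x⁻¹ =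
      w ^ (-α) * (w + x)⁻¹ := fun w hw => by
    rw [Real.rpowIntegrand₀₁_eq_pow_div hp (le_of_lt hw) hx.le, show 1 - α - 1 = -α by ring]
    field_simp
  have hi : IntegrableOn (fun w : ℝ => w ^ (-α) * (w + x)⁻¹) (Ioi 0) :=
    IntegrableOn.congr_fun ((Real.integrableOn_rpowIntegrand₀₁_Ioi hp hx.le).mul_const x⁻¹) heq
      measurableSet_Ioi
  have h1 := Real.rpow_eq_const_mul_integral hp hx.le
  rw [← ofReal_integral_eq_lintegral_ofReal hi, ← ENNReal.ofReal_mul (inv_pos.2 hκ).le,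
    ← setIntegral_congr_fun measurableSet_Ioi heq, integral_mul_const, ← mul_assoc, ← h1,
    ← div_eq_mul_inv, ← Real.rpow_sub_one hx.ne']
  · congr 2; ring
  · refine (ae_restrict_iff' measurableSet_Ioi).2 (ae_of_all _ fun w hw => ?_)
    have hw' : 0 < w := hw
    simp only [Pi.zero_apply]
    positivity

theorem energy_comm {H : Type*} [NormedAddCommGroup H] [InnerProductSpace ℝ H] [CompleteSpace H]
    (A : H →ₗ.[ℝ] H) (u v : H) : energy A u v = energy A v u :=
  real_inner_comm _ _

theorem enorm_add_sq_le {E : Type*} [SeminormedAddCommGroup E] (u v : E) :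
    ‖u + v‖ₑ ^ 2 ≤ 2 * ‖u‖ₑ ^ 2 + 2 * ‖v‖ₑ ^ 2 := by
  have h2 : (2 : ENNReal) = ENNReal.ofReal 2 := by simp
  rw [enorm_sq_eq_ofReal, enorm_sq_eq_ofReal, enorm_sq_eq_ofReal, h2,
    ← ENNReal.ofReal_mul zero_le_two, ← ENNReal.ofReal_mul zero_le_two,
    ← ENNReal.ofReal_add (by positivity) (by positivity)]
  refine ENNReal.ofReal_le_ofReal ?_
  have := norm_add_le u v
  nlinarith [sq_nonneg (‖u‖ - ‖v‖), norm_nonneg (u + v)]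

theorem enorm_sq_eq_sum_inner {E ι : Type*} [Fintype ι] [NormedAddCommGroup E]
    [InnerProductSpace ℝ E] (φ : OrthonormalBasis ι ℝ E) (p : E) :
    ‖p‖ₑ ^ 2 = ∑ j, ‖⟪p, φ j⟫‖ₑ ^ 2 := by
  simp_rw [enorm_sq_eq_ofReal]
  rw [← ENNReal.ofReal_sum_of_nonneg fun j _ => sq_nonneg _, φ.sum_sq_norm_inner_left]

theorem lintegral_eq_sum_inner {E ι : Type*} [Fintype ι] [NormedAddCommGroup E]
    [InnerProductSpace ℝ E] {f : ℝ → E} (hf : ContinuousOn f (Ioi 0))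
    (φ : OrthonormalBasis ι ℝ E) :
    ∫⁻ t in Ioi (0 : ℝ), ‖f t‖ₑ ^ 2 = ∑ j, ∫⁻ t in Ioi (0 : ℝ), ‖⟪f t, φ j⟫‖ₑ ^ 2 := by
  rw [lintegral_congr fun t => enorm_sq_eq_sum_inner φ (f t), lintegral_finsetSum']
  intro j _
  exact (((hf.inner continuousOn_const).aestronglyMeasurable measurableSet_Ioi).enorm).pow_const 2

section Galerkin

variable {H : Type*} [NormedAddCommGroup H] [InnerProductSpace ℝ H] [CompleteSpace H]
  {A : H →ₗ.[ℝ] H} {V : Submodule ℝ H} {L : V →ₗ[ℝ] V}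
  {ι : Type*} [Fintype ι] {φ : OrthonormalBasis ι ℝ V} {l : ι → ℝ}

theorem inner_apply_eq (hL : ∀ ψ χ : V, ⟪L ψ, χ⟫ = energy A (ψ : H) (χ : H))
    (hφ : ∀ j, L (φ j) = l j • φ j) (p : V) (j : ι) : ⟪L p, φ j⟫ = l j * ⟪p, φ j⟫ := by
  rw [hL, energy_comm, ← hL, hφ, real_inner_smul_left, real_inner_comm]

/-- Monotonicity of resolvents, `P_h (w + A_h)⁻¹ P_h ≤ (w + A)⁻¹` for `w > 0`. With
`v = (w + A_h)⁻¹ P_h y`, the left-hand side is `⟪v, y⟫ = w ‖v‖² + a(v, v)`, and weighted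
arithmetic and geometric means bound `⟪v, y⟫` by half of it plus half of the right-hand side. -/
theorem sum_inner_sq_div_le (hA : IsPositiveWithCompactInverse A)
    (hV : (V : Set H) ⊆ fracDomain A (1 / 2))
    (hL : ∀ ψ χ : V, ⟪L ψ, χ⟫ = energy A (ψ : H) (χ : H)) (hφ : ∀ j, L (φ j) = l j • φ j)
    (hl : ∀ j, 0 < l j) {w : ℝ} (hw : 0 < w) (y : H) :
    ENNReal.ofReal (∑ j, (w + l j)⁻¹ * ⟪y, (φ j : H)⟫ ^ 2) ≤
      ∑' μ, ENNReal.ofReal ((w + μ)⁻¹ * ‖eigenproj A μ y‖ ^ 2) := by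
  set c : ι → ℝ := fun j => (w + l j)⁻¹ * ⟪y, (φ j : H)⟫ with hc
  set v : V := ∑ j, c j • φ j with hv
  have hvj : ∀ j, ⟪v, φ j⟫ = c j := fun j => by
    rw [real_inner_comm, hv]
    simpa using φ.orthonormal.inner_right_fintype c j
  set Q := ∑ j, (w + l j)⁻¹ * ⟪y, (φ j : H)⟫ ^ 2 with hQ
  have hQ1 : ⟪(v : H), y⟫ = Q := by
    rw [hv, Submodule.coe_sum, sum_inner, hQ]
    refine Finset.sum_congr rfl fun j _ => ?_
    rw [Submodule.coe_smul, real_inner_smul_left, real_inner_comm, hc]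
    ring
  have hQ2 : w * ‖(v : H)‖ ^ 2 + energy A (v : H) v = Q := by
    have e1 : ‖(v : H)‖ ^ 2 = ∑ j, c j ^ 2 := by
      rw [Submodule.norm_coe, ← φ.sum_sq_norm_inner_left]
      simp only [hvj, Real.norm_eq_abs, sq_abs]
    have e2 : energy A (v : H) v = ∑ j, l j * c j ^ 2 := by
      rw [← hL, ← φ.sum_inner_mul_inner]
      refine Finset.sum_congr rfl fun j _ => ?_
      rw [inner_apply_eq hL hφ, hvj, real_inner_comm, hvj]
      ring
    rw [e1, e2, Finset.mul_sum, ← Finset.sum_add_distrib, hQ]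
    refine Finset.sum_congr rfl fun j _ => ?_
    have : w + l j ≠ 0 := (add_pos hw (hl j)).ne'
    rw [hc]; field_simp
  have hvV : (v : H) ∈ fracDomain A (1 / 2) := hV v.2
  have hs1 : HasSum (fun μ => (w + μ) * ‖eigenproj A μ (v : H)‖ ^ 2) Q := by
    rw [← hQ2]
    refine (((hA.hasSum_norm_eigenproj_sq (v : H)).mul_left w).add
      (hA.hasSum_energy hvV hvV)).congr_fun fun μ => ?_
    rw [real_inner_self_eq_norm_sq]; ring
  have hnn : ∀ μ, 0 ≤ (w + μ)⁻¹ * ‖eigenproj A μ y‖ ^ 2 := fun μ => by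
    by_cases h : eigenproj A μ y = 0
    · simp [h]
    · have := hA.pos_of_eigenproj_ne_zero h
      positivity
  have hs2 : Summable fun μ => (w + μ)⁻¹ * ‖eigenproj A μ y‖ ^ 2 := by
    refine Summable.of_nonneg_of_le hnn (fun μ => ?_)
      ((hA.summable_norm_eigenproj_sq y).mul_left w⁻¹)
    by_cases h : eigenproj A μ y = 0
    · simp [h]
    · have := hA.pos_of_eigenproj_ne_zero h
      gcongr
      linarith
  rw [← ENNReal.ofReal_tsum_of_nonneg hnn hs2]
  refine ENNReal.ofReal_le_ofReal ?_
  have h1 := hA.hasSum_inner_eigenproj (v : H) y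
  rw [hQ1] at h1
  have h2 := hasSum_le (fun μ => ?_) h1 ((hs1.mul_left (1 / 2)).add (hs2.hasSum.mul_left (1 / 2)))
  · linarith
  · by_cases h : eigenproj A μ (v : H) = 0
    · rw [h, inner_zero_left, norm_zero]
      have := hnn μ
      simp only [ne_eq, OfNat.ofNat_ne_zero, not_false_eq_true, zero_pow, mul_zero, zero_add]
      positivity
    · have hμ : 0 < w + μ := add_pos hw (hA.pos_of_eigenproj_ne_zero h)
      have h3 := real_inner_le_norm (eigenproj A μ (v : H)) (eigenproj A μ y)
      set p := ‖eigenproj A μ (v : H)‖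
      set q := ‖eigenproj A μ y‖
      have h4 : 0 ≤ (w + μ)⁻¹ * ((w + μ) * p - q) ^ 2 := by positivity
      have h5 : (w + μ)⁻¹ * ((w + μ) * p - q) ^ 2 =
          (w + μ) * p ^ 2 - 2 * (p * q) + (w + μ)⁻¹ * q ^ 2 := by
        field_simp
        ring
      linarith

/-- `‖A_h^(-α/2) P_h y‖ ≤ ‖A^(-α/2) y‖` for `0 < α < 1`, by integrating the resolvent inequality
against `w^(-α)`. -/
theorem sum_rpow_neg_le_spectralSum (hA : IsPositiveWithCompactInverse A)
    (hV : (V : Set H) ⊆ fracDomain A (1 / 2))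
    (hL : ∀ ψ χ : V, ⟪L ψ, χ⟫ = energy A (ψ : H) (χ : H)) (hφ : ∀ j, L (φ j) = l j • φ j)
    (hl : ∀ j, 0 < l j) {α : ℝ} (hα : α ∈ Ioo (0 : ℝ) 1) (y : H) :
    ∑ j, ENNReal.ofReal (l j ^ (-α) * ⟪y, (φ j : H)⟫ ^ 2) ≤ spectralSum A (-α) y := by
  obtain ⟨κ, hκ, h⟩ := rpow_neg_eq_lintegral hα
  have hrep : ∀ x a : ℝ, 0 < x → 0 ≤ a → ENNReal.ofReal (x ^ (-α) * a) = ENNReal.ofReal κ *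
      ∫⁻ w in Ioi (0 : ℝ), ENNReal.ofReal (w ^ (-α)) * ENNReal.ofReal ((w + x)⁻¹ * a) := by
    intro x a hx ha
    rw [ENNReal.ofReal_mul (by positivity), h x hx, mul_assoc,
      ← lintegral_mul_const' _ _ ENNReal.ofReal_ne_top]
    congr 1
    refine setLIntegral_congr_fun measurableSet_Ioi fun w hw => ?_
    have hw' : 0 < w := hw
    rw [← ENNReal.ofReal_mul (by positivity), ← ENNReal.ofReal_mul (by positivity), mul_assoc]
  have hm : ∀ x a : ℝ, Measurable fun w : ℝ =>
      ENNReal.ofReal (w ^ (-α)) * ENNReal.ofReal ((w + x)⁻¹ * a) := fun x a => by fun_prop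
  calc ∑ j, ENNReal.ofReal (l j ^ (-α) * ⟪y, (φ j : H)⟫ ^ 2)
      = ENNReal.ofReal κ * ∫⁻ w in Ioi (0 : ℝ), ENNReal.ofReal (w ^ (-α)) *
          ENNReal.ofReal (∑ j, (w + l j)⁻¹ * ⟪y, (φ j : H)⟫ ^ 2) := by
        rw [Finset.sum_congr rfl fun j _ => hrep (l j) _ (hl j) (sq_nonneg _), ← Finset.mul_sum,
          ← lintegral_finsetSum _ fun j _ => hm _ _]
        congr 1
        refine setLIntegral_congr_fun measurableSet_Ioi fun w hw => ?_
        have hw' : 0 < w := hw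
        rw [ENNReal.ofReal_sum_of_nonneg fun j _ => by have := hl j; positivity, Finset.mul_sum]
    _ ≤ ENNReal.ofReal κ * ∫⁻ w in Ioi (0 : ℝ), ENNReal.ofReal (w ^ (-α)) *
          ∑' μ, ENNReal.ofReal ((w + μ)⁻¹ * ‖eigenproj A μ y‖ ^ 2) := by
        refine mul_le_mul_right (setLIntegral_mono' measurableSet_Ioi fun w hw => ?_) _
        gcongr
        exact sum_inner_sq_div_le hA hV hL hφ hl hw y
    _ = spectralSum A (-α) y := by
        simp_rw [← ENNReal.tsum_mul_left]
        rw [lintegral_tsum_of_countable (hA.countable_setOf_eigenproj_ne_zero y)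
          (fun μ _ => (hm _ _).aemeasurable) (ae_of_all _ fun w μ hμ => ?_),
          ← ENNReal.tsum_mul_left, spectralSum]
        · refine tsum_congr fun μ => ?_
          by_cases hμ : eigenproj A μ y = 0
          · simp [hμ]
          · exact (hrep μ _ (hA.pos_of_eigenproj_ne_zero hμ) (sq_nonneg _)).symm
        · have hμ' : eigenproj A μ y = 0 := by simpa using hμ
          simp [hμ']

/-- The discrete eigenvalues are bounded below by any lower bound of the spectrum of `A`, as they
are values of the Rayleigh quotient of `A`. -/
theorem eigenvalue_ge {μ₀ : ℝ} (hA : IsPositiveWithCompactInverse A)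
    (hμ₀ : ∀ μ x, eigenproj A μ x ≠ 0 → μ₀ ≤ μ) (hV : (V : Set H) ⊆ fracDomain A (1 / 2))
    (hL : ∀ ψ χ : V, ⟪L ψ, χ⟫ = energy A (ψ : H) (χ : H)) (hφ : ∀ j, L (φ j) = l j • φ j)
    (j : ι) : μ₀ ≤ l j := by
  have h1 : ‖(φ j : H)‖ = 1 := φ.orthonormal.1 j
  have h2 : l j = energy A (φ j : H) (φ j) := by
    rw [← hL, hφ, real_inner_smul_left, real_inner_self_eq_norm_sq, φ.orthonormal.1 j]
    ring
  have hs := hA.hasSum_energy (hV (φ j).2) (hV (φ j).2)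
  have h3 := hasSum_le (fun μ => ?_) ((hA.hasSum_norm_eigenproj_sq (φ j : H)).mul_left μ₀) hs
  · rw [h1] at h3
    rw [h2]; linarith
  · rw [real_inner_self_eq_norm_sq]
    by_cases h : eigenproj A μ (φ j : H) = 0
    · simp [h]
    · exact mul_le_mul_of_nonneg_right (hμ₀ μ _ h) (sq_nonneg _)

/-! ### Error estimates -/

variable {b : ℝ → ℝ} {S : ℝ → H →L[ℝ] H} {Sh : ℝ → V →L[ℝ] V} [FiniteDimensional ℝ V]

theorem isScalarSolution_galerkin (hb : IsAdmissibleKernel b)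
    (hL : ∀ ψ χ : V, ⟪L ψ, χ⟫ = energy A (ψ : H) (χ : H)) (hφ : ∀ j, L (φ j) = l j • φ j)
    (hSh : IsResolventFamily b (L.toPMap ⊤) Sh) (p : V) (j : ι) :
    IsScalarSolution b (l j) fun t => ⟪Sh t p, φ j⟫ :=
  hSh.isScalarSolution_inner hb (fun x => inner_apply_eq hL hφ (x : V) j) ⟨p, Submodule.mem_top⟩

/-- The stability of the semidiscrete resolvent family in terms of negative norms of `A`. -/
theorem lintegral_galerkin_sq_le (hb : IsAdmissibleKernel b) {l₀ C : ℝ} (hl₀ : 0 < l₀)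
    (hC0 : 0 ≤ C)
    (hC : ∀ l, l₀ ≤ l → ∀ s, IsScalarSolution b l s →
      ∫⁻ t in Ioi (0 : ℝ), ‖s t‖ₑ ^ 2 ≤ ENNReal.ofReal (C * l ^ (-(1 / rho b)) * s 0 ^ 2))
    (hA : IsPositiveWithCompactInverse A) (hV : (V : Set H) ⊆ fracDomain A (1 / 2))
    (hL : ∀ ψ χ : V, ⟪L ψ, χ⟫ = energy A (ψ : H) (χ : H)) (hφ : ∀ j, L (φ j) = l j • φ j)
    (hl : ∀ j, l₀ ≤ l j) (hSh : IsResolventFamily b (L.toPMap ⊤) Sh) (x : H) :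
    ∫⁻ t in Ioi (0 : ℝ), ‖Sh t (V.orthogonalProjectionOnto x)‖ₑ ^ 2 ≤
      ENNReal.ofReal C * spectralSum A (-(1 / rho b)) x := by
  have hr := hb.one_lt_rho
  have hα : 1 / rho b ∈ Ioo (0 : ℝ) 1 :=
    ⟨by positivity, by rw [div_lt_one (by linarith)]; exact hr⟩
  set p := V.orthogonalProjectionOnto x with hp
  rw [lintegral_eq_sum_inner ((hSh.continuousOn p).mono Ioi_subset_Ici_self) φ]
  refine le_trans ?_ (mul_le_mul_right (sum_rpow_neg_le_spectralSum hA hV hL hφ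
    (fun j => hl₀.trans_le (hl j)) hα x) _)
  rw [Finset.mul_sum]
  refine Finset.sum_le_sum fun j _ => ?_
  refine (hC _ (hl j) _ (isScalarSolution_galerkin hb hL hφ hSh p j)).trans_eq ?_
  rw [hSh.zero, ContinuousLinearMap.id_apply, ← ENNReal.ofReal_mul hC0, real_inner_comm, hp,
    Submodule.inner_orthogonalProjectionOnto_eq_of_mem_left, real_inner_comm, mul_assoc]

/-- The error for `x ∈ D(A)`: `S_h(t) P_h x - R_h S(t) x` is controlled by the Ritz projection
error `S(t) x - R_h S(t) x`, one scalar comparison for each discrete eigenvector. -/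
theorem lintegral_error_sq_le (hb : IsAdmissibleKernel b) (hA : IsPositiveWithCompactInverse A)
    (hS : IsResolventFamily b A S) (hV : (V : Set H) ⊆ fracDomain A (1 / 2))
    (hL : ∀ ψ χ : V, ⟪L ψ, χ⟫ = energy A (ψ : H) (χ : H)) (hφ : ∀ j, L (φ j) = l j • φ j)
    (hl : ∀ j, 0 < l j) (hSh : IsResolventFamily b (L.toPMap ⊤) Sh)
    {R : fracDomain A (1 / 2) → V}
    (hR : ∀ v : fracDomain A (1 / 2), ∀ χ : V,
      energy A (R v : H) (χ : H) = energy A (v : H) (χ : H))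
    {K : ℝ} (hK : ∀ v : fracDomain A (1 / 2), (v : H) ∈ fracDomain A (2 / 2) →
      ‖(R v : H) - (v : H)‖ ≤ K * fracNorm A 2 (v : H)) (x : A.domain) :
    ∫⁻ t in Ioi (0 : ℝ), ‖S t x - (Sh t (V.orthogonalProjectionOnto (x : H)) : H)‖ₑ ^ 2 ≤
      ENNReal.ofReal (2 * (1 + (2 / Real.cos ((rho b - 1) * (Real.pi / 2))) ^ 2) * K ^ 2) *
        ∫⁻ t in Ioi (0 : ℝ), ‖S t (A x)‖ₑ ^ 2 := by
  set p := V.orthogonalProjectionOnto (x : H) with hp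
  set D := (2 / Real.cos ((rho b - 1) * (Real.pi / 2))) ^ 2
  -- the Ritz projection of `S(t) x`, by its coefficients
  set r : ι → ℝ → ℝ := fun j t => (l j)⁻¹ * ⟪S t (A x), (φ j : H)⟫ with hr
  set ρ : ℝ → V := fun t => ∑ j, r j t • φ j with hρ
  have hrc : ∀ j, ContinuousOn (r j) (Ici 0) := fun j =>
    (hS.continuousOn_inner (A x) (φ j : H)).const_smul (l j)⁻¹
  have hρc : ContinuousOn ρ (Ici 0) :=
    continuousOn_finsetSum _ fun j _ => (hrc j).smul continuousOn_const
  have hρj : ∀ t j, ⟪ρ t, φ j⟫ = r j t := fun t j => by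
    rw [real_inner_comm, hρ]
    simpa using φ.orthonormal.inner_right_fintype (fun j => r j t) j
  have hρK : ∀ t, 0 < t → ‖S t x - (ρ t : H)‖ₑ ^ 2 ≤ ENNReal.ofReal (K ^ 2) * ‖S t (A x)‖ₑ ^ 2 := by
    intro t ht
    obtain ⟨hx, h1⟩ := hS.commute t ht.le x
    set v : fracDomain A (1 / 2) := ⟨S t x, hA.domain_subset_fracDomain_half ⟨_, hx⟩⟩ with hv
    have hRv : R v = ρ t := by
      refine φ.repr.injective (PiLp.ext fun j => ?_)
      rw [φ.repr_apply_apply, φ.repr_apply_apply, real_inner_comm, real_inner_comm (ρ t), hρj]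
      have h2 : l j * ⟪R v, φ j⟫ = ⟪S t (A x), (φ j : H)⟫ := by
        rw [← inner_apply_eq hL hφ, hL, hR, ← h1, ← hA.energy_eq_inner ⟨S t x, hx⟩ (hV (φ j).2)]
      rw [hr]; simp only
      rw [← h2, inv_mul_cancel_left₀ (hl j).ne']
    have h3 := hK v (hA.domain_subset_fracDomain_one ⟨_, hx⟩)
    rw [hRv] at h3
    have h4 : fracNorm A 2 (v : H) = ‖S t (A x)‖ := by
      rw [← h1]; exact hA.fracNorm_two ⟨_, hx⟩
    rw [h4, ← norm_neg, neg_sub] at h3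
    rw [enorm_sq_eq_ofReal, enorm_sq_eq_ofReal, ← ENNReal.ofReal_mul (sq_nonneg _), ← mul_pow]
    exact ENNReal.ofReal_le_ofReal (pow_le_pow_left₀ (norm_nonneg _) h3 2)
  have hSc : ContinuousOn (fun t => S t x - (ρ t : H)) (Ici 0) :=
    (hS.continuousOn x).sub (continuous_subtype_val.comp_continuousOn hρc)
  have hηm : AEMeasurable (fun t => ‖S t x - (ρ t : H)‖ₑ ^ 2) (volume.restrict (Ioi 0)) :=
    (((hSc.mono Ioi_subset_Ici_self).aestronglyMeasurable measurableSet_Ioi).enorm).pow_const 2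
  have hη : ∫⁻ t in Ioi (0 : ℝ), ‖S t x - (ρ t : H)‖ₑ ^ 2 ≤
      ENNReal.ofReal (K ^ 2) * ∫⁻ t in Ioi (0 : ℝ), ‖S t (A x)‖ₑ ^ 2 := by
    rw [← lintegral_const_mul' _ _ ENNReal.ofReal_ne_top]
    exact setLIntegral_mono' measurableSet_Ioi hρK
  have hθ : ∫⁻ t in Ioi (0 : ℝ), ‖Sh t p - ρ t‖ₑ ^ 2 ≤
      ENNReal.ofReal D * ∫⁻ t in Ioi (0 : ℝ), ‖S t x - (ρ t : H)‖ₑ ^ 2 := by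
    have hcomp : ∀ j, ∫⁻ t in Ioi (0 : ℝ), ‖⟪Sh t p - ρ t, φ j⟫‖ₑ ^ 2 ≤ ENNReal.ofReal D *
        ∫⁻ t in Ioi (0 : ℝ), ‖⟪V.orthogonalProjectionOnto (S t x - (ρ t : H)), φ j⟫‖ₑ ^ 2 := by
      intro j
      have e1 : ∀ t, ⟪Sh t p - ρ t, φ j⟫ = ⟪Sh t p, φ j⟫ - r j t := fun t => by
        rw [inner_sub_left, hρj]
      have e2 : ∀ t, ⟪V.orthogonalProjectionOnto (S t x - (ρ t : H)), φ j⟫ =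
          ⟪S t x, (φ j : H)⟫ - r j t := fun t => by
        rw [real_inner_comm, Submodule.inner_orthogonalProjectionOnto_eq_of_mem_left,
          real_inner_comm, inner_sub_left, ← Submodule.coe_inner, hρj]
      simp_rw [e1, e2]
      have hφ1 : ‖(φ j : H)‖ = 1 := φ.orthonormal.1 j
      have hbound : ∀ (z : H) (t : ℝ), 0 < t → |⟪S t z, (φ j : H)⟫| ≤ ‖z‖ := fun z t ht => by
        refine (abs_real_inner_le_norm _ _).trans ?_
        rw [hφ1, mul_one]
        exact hS.norm_apply_le hb hA z ht.le
      refine hb.lintegral_sub_sq_le (M := ‖(x : H)‖) (N := (l j)⁻¹ * ‖A x‖) (hl j).le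
        (isScalarSolution_galerkin hb hL hφ hSh p j) (hS.continuousOn_inner _ _) (hrc j)
        (hbound x) (fun t ht => ?_) (fun t ht => ?_) ?_
      · rw [hr]; simp only
        rw [abs_mul, abs_of_pos (inv_pos.2 (hl j))]
        exact mul_le_mul_of_nonneg_left (hbound _ t ht) (inv_pos.2 (hl j)).le
      · rw [hr]; simp only
        rw [conv_const_mul, mul_inv_cancel_left₀ (hl j).ne']
        exact hS.hasDerivAt_inner hb x (φ j : H) ht
      · rw [hSh.zero, hS.zero, ContinuousLinearMap.id_apply, ContinuousLinearMap.id_apply,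
          real_inner_comm, hp, Submodule.inner_orthogonalProjectionOnto_eq_of_mem_left,
          real_inner_comm]
    rw [lintegral_eq_sum_inner (f := fun t => Sh t p - ρ t)
      (((hSh.continuousOn p).sub hρc).mono Ioi_subset_Ici_self) φ]
    refine (Finset.sum_le_sum fun j _ => hcomp j).trans ?_
    rw [← Finset.mul_sum, ← lintegral_eq_sum_inner
      (f := fun t => V.orthogonalProjectionOnto (S t x - (ρ t : H)))
      ((V.orthogonalProjectionOnto.continuous.comp_continuousOn hSc).mono Ioi_subset_Ici_self) φ]
    refine mul_le_mul_right (lintegral_mono fun t => ?_) _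
    rw [enorm_sq_eq_ofReal, enorm_sq_eq_ofReal]
    exact ENNReal.ofReal_le_ofReal (pow_le_pow_left₀ (norm_nonneg _)
      (V.norm_orthogonalProjectionOnto_apply_le _) 2)
  have hsplit : ∀ t, ‖S t x - (Sh t p : H)‖ₑ ^ 2 ≤
      2 * ‖S t x - (ρ t : H)‖ₑ ^ 2 + 2 * ‖Sh t p - ρ t‖ₑ ^ 2 := fun t => by
    have h1 := enorm_add_sq_le (S t x - (ρ t : H)) ((ρ t : H) - (Sh t p : H))
    rw [sub_add_sub_cancel] at h1
    refine h1.trans_eq ?_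
    rw [← enorm_neg ((ρ t : H) - (Sh t p : H)), neg_sub]
    rfl
  calc ∫⁻ t in Ioi (0 : ℝ), ‖S t x - (Sh t p : H)‖ₑ ^ 2
      ≤ ∫⁻ t in Ioi (0 : ℝ), (2 * ‖S t x - (ρ t : H)‖ₑ ^ 2 + 2 * ‖Sh t p - ρ t‖ₑ ^ 2) :=
        lintegral_mono hsplit
    _ = 2 * (∫⁻ t in Ioi (0 : ℝ), ‖S t x - (ρ t : H)‖ₑ ^ 2) +
          2 * ∫⁻ t in Ioi (0 : ℝ), ‖Sh t p - ρ t‖ₑ ^ 2 := by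
        rw [lintegral_add_left' (hηm.const_mul 2), lintegral_const_mul' _ _ (by simp),
          lintegral_const_mul' _ _ (by simp)]
    _ ≤ 2 * (∫⁻ t in Ioi (0 : ℝ), ‖S t x - (ρ t : H)‖ₑ ^ 2) +
          2 * (ENNReal.ofReal D * ∫⁻ t in Ioi (0 : ℝ), ‖S t x - (ρ t : H)‖ₑ ^ 2) := by gcongr
    _ = ENNReal.ofReal (2 * (1 + D)) * ∫⁻ t in Ioi (0 : ℝ), ‖S t x - (ρ t : H)‖ₑ ^ 2 := by
        rw [ENNReal.ofReal_mul zero_le_two, ENNReal.ofReal_add zero_le_one (sq_nonneg _)]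
        simp only [ENNReal.ofReal_ofNat, ENNReal.ofReal_one]
        ring
    _ ≤ ENNReal.ofReal (2 * (1 + D)) *
          (ENNReal.ofReal (K ^ 2) * ∫⁻ t in Ioi (0 : ℝ), ‖S t (A x)‖ₑ ^ 2) := by gcongr
    _ = _ := by
        have : 0 ≤ D := sq_nonneg _
        rw [← mul_assoc, ← ENNReal.ofReal_mul (by positivity)]

end Galerkin

/-! ### Interpolation between smooth and nonsmooth data -/

/-- Interpolation weights: `h^(2s) μ^(s-α)` dominates `μ^(-α)` above the level `h^(-2)` and
`h⁴ μ^(2-α)` below it. -/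
theorem interpolation_weight_le {h μ s α : ℝ} (hh : 0 < h) (hμ : 0 < μ) (hs : s ∈ Icc (0 : ℝ) 2) :
    (h⁻¹ ^ 2 < μ → μ ^ (-α) ≤ h ^ (2 * s) * μ ^ (s - α)) ∧
      (μ ≤ h⁻¹ ^ 2 → h ^ 4 * (μ ^ 2 * μ ^ (-α)) ≤ h ^ (2 * s) * μ ^ (s - α)) := by
  have e1 : h ^ (2 * s) * μ ^ (s - α) = (h ^ 2 * μ) ^ s * μ ^ (-α) := by
    rw [Real.mul_rpow (by positivity) hμ.le, sub_eq_add_neg, Real.rpow_add hμ, Real.rpow_mul hh.le]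
    norm_cast
    ring
  have hpos : 0 < h ^ 2 * μ := by positivity
  rw [e1]
  constructor
  · intro h1
    refine le_mul_of_one_le_left (by positivity) (Real.one_le_rpow ?_ hs.1)
    rw [inv_pow, inv_lt_iff_one_lt_mul₀ (by positivity)] at h1
    linarith
  · intro h1
    have h2 : h ^ 2 * μ ≤ 1 := by
      have := mul_le_mul_of_nonneg_left h1 (sq_nonneg h)
      rwa [inv_pow, mul_inv_cancel₀ (by positivity)] at this
    have h3 : (h ^ 2 * μ) ^ (2 : ℝ) ≤ (h ^ 2 * μ) ^ s :=
      Real.rpow_le_rpow_of_exponent_ge hpos h2 hs.2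
    have h4 : h ^ 4 * (μ ^ 2 * μ ^ (-α)) = (h ^ 2 * μ) ^ (2 : ℝ) * μ ^ (-α) := by
      rw [Real.rpow_two]; ring
    rw [h4]
    gcongr

section Interpolation

variable {H : Type*} [NormedAddCommGroup H] [InnerProductSpace ℝ H] [CompleteSpace H]
  {A : H →ₗ.[ℝ] H}

/-- The part of `x` above the frequency `h⁻²`, in the norm of the stability estimates. -/
theorem spectralSum_sub_cutoff_le (hA : IsPositiveWithCompactInverse A) {h s : ℝ} (hh : 0 < h)
    (hs : s ∈ Icc (0 : ℝ) 2) (α : ℝ) {x y : H}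
    (hy : ∀ μ, eigenproj A μ y = if μ ≤ h⁻¹ ^ 2 then eigenproj A μ x else 0) :
    spectralSum A (-α) (x - y) ≤ ENNReal.ofReal (h ^ (2 * s)) * spectralSum A (s - α) x := by
  rw [spectralSum, spectralSum, ← ENNReal.tsum_mul_left]
  refine ENNReal.tsum_le_tsum fun μ => ?_
  rw [map_sub, hy]
  split_ifs with hμ
  · simp
  · by_cases h0 : eigenproj A μ x = 0
    · simp [h0]
    · rw [← ENNReal.ofReal_mul (by positivity), sub_zero, ← mul_assoc]
      gcongr
      exact (interpolation_weight_le hh (hA.pos_of_eigenproj_ne_zero h0) hs).1 (not_le.1 hμ)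

/-- The part `y` of `x` below the frequency `h⁻²`, in the norm of the error estimate for data in
`D(A)`. -/
theorem spectralSum_map_cutoff_le (hA : IsPositiveWithCompactInverse A) {h s : ℝ} (hh : 0 < h)
    (hs : s ∈ Icc (0 : ℝ) 2) (α : ℝ) {x : H} {y : A.domain}
    (hy : ∀ μ, eigenproj A μ y = if μ ≤ h⁻¹ ^ 2 then eigenproj A μ x else 0) :
    ENNReal.ofReal (h ^ 4) * spectralSum A (-α) (A y) ≤
      ENNReal.ofReal (h ^ (2 * s)) * spectralSum A (s - α) x := by
  rw [spectralSum, spectralSum, ← ENNReal.tsum_mul_left, ← ENNReal.tsum_mul_left]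
  refine ENNReal.tsum_le_tsum fun μ => ?_
  rw [hA.eigenproj_map, hy]
  split_ifs with hμ
  · by_cases h0 : eigenproj A μ x = 0
    · simp [h0]
    · rw [← ENNReal.ofReal_mul (by positivity), ← ENNReal.ofReal_mul (by positivity), norm_smul,
        mul_pow, Real.norm_eq_abs, sq_abs]
      refine ENNReal.ofReal_le_ofReal ?_
      calc h ^ 4 * (μ ^ (-α) * (μ ^ 2 * ‖eigenproj A μ x‖ ^ 2))
          = h ^ 4 * (μ ^ 2 * μ ^ (-α)) * ‖eigenproj A μ x‖ ^ 2 := by ring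
        _ ≤ h ^ (2 * s) * μ ^ (s - α) * ‖eigenproj A μ x‖ ^ 2 := by
          exact mul_le_mul_of_nonneg_right
            ((interpolation_weight_le hh (hA.pos_of_eigenproj_ne_zero h0) hs).2 hμ) (sq_nonneg _)
        _ = _ := by ring
  · simp

/-- The error estimate for one discrete space `V`, with a constant that depends only on the two
stability constants and on that of the Ritz projection: `x` is split at the frequency `h⁻²`. -/
theorem lintegral_error_sq_le_spectralSum {b : ℝ → ℝ} (hb : IsAdmissibleKernel b)
    (hA : IsPositiveWithCompactInverse A) {S : ℝ → H →L[ℝ] H} (hS : IsResolventFamily b A S)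
    {l₀ C₁ C₂ CR : ℝ} (hl₀ : 0 < l₀) (hA₀ : ∀ μ x, eigenproj A μ x ≠ 0 → l₀ ≤ μ)
    (hC₁ : 0 ≤ C₁) (hSC : ∀ x, ∫⁻ t in Ioi (0 : ℝ), ‖S t x‖ₑ ^ 2 ≤
      ENNReal.ofReal C₁ * spectralSum A (-(1 / rho b)) x)
    (hC₂ : 0 ≤ C₂) (hC : ∀ l, l₀ ≤ l → ∀ s, IsScalarSolution b l s →
      ∫⁻ t in Ioi (0 : ℝ), ‖s t‖ₑ ^ 2 ≤ ENNReal.ofReal (C₂ * l ^ (-(1 / rho b)) * s 0 ^ 2))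
    {V : Submodule ℝ H} [FiniteDimensional ℝ V] (hV : (V : Set H) ⊆ fracDomain A (1 / 2))
    {L : V →ₗ[ℝ] V} (hL : ∀ ψ χ : V, ⟪L ψ, χ⟫ = energy A (ψ : H) (χ : H))
    {Sh : ℝ → V →L[ℝ] V} (hSh : IsResolventFamily b (L.toPMap ⊤) Sh)
    {R : fracDomain A (1 / 2) → V}
    (hR : ∀ v : fracDomain A (1 / 2), ∀ χ : V,
      energy A (R v : H) (χ : H) = energy A (v : H) (χ : H))
    {h : ℝ} (hh : 0 < h) (hK : ∀ v : fracDomain A (1 / 2), (v : H) ∈ fracDomain A (2 / 2) →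
      ‖(R v : H) - (v : H)‖ ≤ CR * h ^ 2 * fracNorm A 2 (v : H))
    {s : ℝ} (hs : s ∈ Icc (0 : ℝ) 2) (x : H) :
    ∫⁻ t in Ioi (0 : ℝ), ‖S t x - (Sh t (V.orthogonalProjectionOnto x) : H)‖ₑ ^ 2 ≤
      ENNReal.ofReal (2 * (2 * (C₁ + C₂) +
        2 * (1 + (2 / Real.cos ((rho b - 1) * (Real.pi / 2))) ^ 2) * CR ^ 2 * C₁)) *
        (ENNReal.ofReal (h ^ (2 * s)) * spectralSum A (s - 1 / rho b) x) := by
  have hsym : L.IsSymmetric := fun ψ χ => by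
    rw [hL, energy_comm, ← hL, real_inner_comm]
  set φ := hsym.eigenvectorBasis rfl
  have hφ : ∀ j, L (φ j) = hsym.eigenvalues rfl j • φ j := hsym.apply_eigenvectorBasis rfl
  have hl : ∀ j, l₀ ≤ hsym.eigenvalues rfl j := eigenvalue_ge hA hA₀ hV hL hφ
  obtain ⟨y, hy⟩ := hA.exists_spectral_cutoff x (h⁻¹ ^ 2)
  set D := 2 * (1 + (2 / Real.cos ((rho b - 1) * (Real.pi / 2))) ^ 2)
  have hD : 0 ≤ D := by positivity
  set P := V.orthogonalProjectionOnto
  set B := ENNReal.ofReal (h ^ (2 * s)) * spectralSum A (s - 1 / rho b) x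
  have hSm : ∀ z : H, AEMeasurable (fun t => ‖S t z‖ₑ ^ 2) (volume.restrict (Ioi 0)) := fun z =>
    ((((hS.continuousOn z).mono Ioi_subset_Ici_self).aestronglyMeasurable
      measurableSet_Ioi).enorm).pow_const 2
  have hSc : ∀ z, ContinuousOn (fun t => S t z - (Sh t (P z) : H)) (Ici 0) := fun z =>
    (hS.continuousOn z).sub (continuous_subtype_val.comp_continuousOn (hSh.continuousOn _))
  have hEm : ∀ z : H, AEMeasurable (fun t => ‖S t z - (Sh t (P z) : H)‖ₑ ^ 2)
      (volume.restrict (Ioi 0)) := fun z =>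
    ((((hSc z).mono Ioi_subset_Ici_self).aestronglyMeasurable
      measurableSet_Ioi).enorm).pow_const 2
  have hhigh : ∫⁻ t in Ioi (0 : ℝ), ‖S t (x - y) - (Sh t (P (x - y)) : H)‖ₑ ^ 2 ≤
      ENNReal.ofReal (2 * (C₁ + C₂)) * B := by
    calc ∫⁻ t in Ioi (0 : ℝ), ‖S t (x - y) - (Sh t (P (x - y)) : H)‖ₑ ^ 2
        ≤ ∫⁻ t in Ioi (0 : ℝ), (2 * ‖S t (x - y)‖ₑ ^ 2 + 2 * ‖Sh t (P (x - y))‖ₑ ^ 2) := by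
          refine lintegral_mono fun t => ?_
          have := enorm_add_sq_le (S t (x - y)) (-(Sh t (P (x - y)) : H))
          rwa [← sub_eq_add_neg, enorm_neg] at this
      _ = 2 * (∫⁻ t in Ioi (0 : ℝ), ‖S t (x - y)‖ₑ ^ 2) +
            2 * ∫⁻ t in Ioi (0 : ℝ), ‖Sh t (P (x - y))‖ₑ ^ 2 := by
          rw [lintegral_add_left' ((hSm _).const_mul 2), lintegral_const_mul' _ _ (by simp),
            lintegral_const_mul' _ _ (by simp)]
      _ ≤ 2 * (ENNReal.ofReal C₁ * spectralSum A (-(1 / rho b)) (x - y)) +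
            2 * (ENNReal.ofReal C₂ * spectralSum A (-(1 / rho b)) (x - y)) := by
          gcongr
          · exact hSC _
          · exact lintegral_galerkin_sq_le hb hl₀ hC₂ hC hA hV hL hφ hl hSh _
      _ = ENNReal.ofReal (2 * (C₁ + C₂)) * spectralSum A (-(1 / rho b)) (x - y) := by
          rw [ENNReal.ofReal_mul zero_le_two, ENNReal.ofReal_add hC₁ hC₂, ENNReal.ofReal_ofNat]
          ring
      _ ≤ _ := mul_le_mul_right (spectralSum_sub_cutoff_le hA hh hs _ hy) _
  have hlow : ∫⁻ t in Ioi (0 : ℝ), ‖S t y - (Sh t (P (y : H)) : H)‖ₑ ^ 2 ≤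
      ENNReal.ofReal (D * CR ^ 2 * C₁) * B := by
    calc ∫⁻ t in Ioi (0 : ℝ), ‖S t y - (Sh t (P (y : H)) : H)‖ₑ ^ 2
        ≤ ENNReal.ofReal (D * (CR * h ^ 2) ^ 2) * ∫⁻ t in Ioi (0 : ℝ), ‖S t (A y)‖ₑ ^ 2 :=
          lintegral_error_sq_le hb hA hS hV hL hφ (fun j => hl₀.trans_le (hl j)) hSh hR hK y
      _ ≤ ENNReal.ofReal (D * (CR * h ^ 2) ^ 2) *
            (ENNReal.ofReal C₁ * spectralSum A (-(1 / rho b)) (A y)) :=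
          mul_le_mul_right (hSC _) _
      _ = ENNReal.ofReal (D * CR ^ 2 * C₁) *
            (ENNReal.ofReal (h ^ 4) * spectralSum A (-(1 / rho b)) (A y)) := by
          rw [← mul_assoc, ← mul_assoc, ← ENNReal.ofReal_mul (by positivity),
            ← ENNReal.ofReal_mul (by positivity)]
          congr 2
          ring
      _ ≤ _ := mul_le_mul_right (spectralSum_map_cutoff_le hA hh hs _ hy) _
  have hsplit : ∀ t, S t x - (Sh t (P x) : H) =
      (S t (x - y) - (Sh t (P (x - y)) : H)) + (S t y - (Sh t (P (y : H)) : H)) := fun t => by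
    simp only [map_sub, Submodule.coe_sub]
    abel
  calc ∫⁻ t in Ioi (0 : ℝ), ‖S t x - (Sh t (P x) : H)‖ₑ ^ 2
      ≤ ∫⁻ t in Ioi (0 : ℝ), (2 * ‖S t (x - y) - (Sh t (P (x - y)) : H)‖ₑ ^ 2 +
          2 * ‖S t y - (Sh t (P (y : H)) : H)‖ₑ ^ 2) := by
        refine lintegral_mono fun t => ?_
        simp only [hsplit t]
        exact enorm_add_sq_le _ _
    _ = 2 * (∫⁻ t in Ioi (0 : ℝ), ‖S t (x - y) - (Sh t (P (x - y)) : H)‖ₑ ^ 2) +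
          2 * ∫⁻ t in Ioi (0 : ℝ), ‖S t y - (Sh t (P (y : H)) : H)‖ₑ ^ 2 := by
        rw [lintegral_add_left' ((hEm _).const_mul 2), lintegral_const_mul' _ _ (by simp),
          lintegral_const_mul' _ _ (by simp)]
    _ ≤ 2 * (ENNReal.ofReal (2 * (C₁ + C₂)) * B) +
          2 * (ENNReal.ofReal (D * CR ^ 2 * C₁) * B) := by gcongr
    _ = ENNReal.ofReal (2 * (2 * (C₁ + C₂) + D * CR ^ 2 * C₁)) * B := by
        rw [ENNReal.ofReal_mul (p := 2) (q := 2 * (C₁ + C₂) + D * CR ^ 2 * C₁) zero_le_two,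
          ENNReal.ofReal_add (p := 2 * (C₁ + C₂)) (by positivity) (by positivity),
          ENNReal.ofReal_ofNat]
        ring

end Interpolation

end Volterra

end
theorem proposition3p2
    {H : Type*} [NormedAddCommGroup H] [InnerProductSpace ℝ H] [CompleteSpace H]
    [TopologicalSpace.SeparableSpace H]
    -- the kernel `b`
    (b : ℝ → ℝ) (hb : Volterra.IsAdmissibleKernel b)
    -- the operator `A`, and the resolvent family `S` of the continuous problem
    (A : H →ₗ.[ℝ] H) (hA : Volterra.IsPositiveWithCompactInverse A)
    (S : ℝ → H →L[ℝ] H) (hS : Volterra.IsResolventFamily b A S)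
    -- the finite element spaces `V h ⊆ D(A^(1/2))`, `0 < h < 1`
    (V : Set.Ioo (0 : ℝ) 1 → Submodule ℝ H) [∀ h, FiniteDimensional ℝ (V h)]
    (hV : ∀ h, (V h : Set H) ⊆ Volterra.fracDomain A (1 / 2))
    -- the discrete operator `A_h : V h → V h`
    (Ah : ∀ h, V h →ₗ[ℝ] V h)
    (hAh : ∀ h, ∀ ψ χ : V h, inner ℝ (Ah h ψ) χ = Volterra.energy A (ψ : H) (χ : H))
    -- the resolvent family `S_h` of the semidiscrete problem
    (Sh : ∀ h, ℝ → V h →L[ℝ] V h)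
    (hSh : ∀ h, Volterra.IsResolventFamily b ((Ah h).toPMap ⊤) (Sh h))
    -- the Ritz projection `R_h : D(A^(1/2)) → V h`
    (R : ∀ h, Volterra.fracDomain A (1 / 2) → V h)
    (hR : ∀ h, ∀ v : Volterra.fracDomain A (1 / 2), ∀ χ : V h,
      Volterra.energy A (R h v : H) (χ : H) = Volterra.energy A (v : H) (χ : H))
    -- the error bound for the Ritz projection
    (hRitz : ∃ C : ℝ, ∀ h, ∀ γ ∈ Set.Icc (1 : ℝ) 2, ∀ v : Volterra.fracDomain A (1 / 2),
      (v : H) ∈ Volterra.fracDomain A (γ / 2) →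
        ‖(R h v : H) - (v : H)‖ ≤ C * (h : ℝ) ^ γ * Volterra.fracNorm A γ (v : H)) :
    ∃ C : ℝ, ∀ h, ∀ s ∈ Set.Icc (0 : ℝ) 2,
      ∀ x ∈ Volterra.fracDomain A ((s - 1 / Volterra.rho b) / 2),
        MeasureTheory.IntegrableOn
          (fun t => ‖S t x - (Sh h t ((V h).orthogonalProjectionOnto x) : H)‖ ^ 2) (Set.Ioi 0) ∧
        ∫ t in Set.Ioi (0 : ℝ), ‖S t x - (Sh h t ((V h).orthogonalProjectionOnto x) : H)‖ ^ 2 ≤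
          C * (h : ℝ) ^ (2 * s) *
            Volterra.fracNorm A (s - 1 / Volterra.rho b) x ^ 2 := by
  obtain ⟨l₀, hl₀, hA₀⟩ := hA.exists_pos_le
  obtain ⟨C₁, hC₁, hSC⟩ := hS.exists_lintegral_sq_le hb hA
  obtain ⟨C₂, hC₂, hC⟩ := hb.exists_lintegral_sq_le hl₀
  obtain ⟨CR, hCR⟩ := hRitz
  set M := 2 * (2 * (C₁ + C₂) +
    2 * (1 + (2 / Real.cos ((Volterra.rho b - 1) * (Real.pi / 2))) ^ 2) * CR ^ 2 * C₁)
  refine ⟨M, fun h s hs x hx => ?_⟩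
  have hh : (0 : ℝ) < h := h.2.1
  have hM : 0 ≤ M := by positivity
  have hmain := Volterra.lintegral_error_sq_le_spectralSum hb hA hS hl₀ hA₀ hC₁ hSC hC₂ hC
    (hV h) (hAh h) (hSh h) (hR h) hh (CR := CR) (fun v hv => by
      have := hCR h 2 ⟨one_le_two, le_rfl⟩ v hv
      rwa [Real.rpow_two] at this) hs x
  rw [hA.spectralSum_eq hx, ← ENNReal.ofReal_mul (by positivity), ← ENNReal.ofReal_mul hM,
    ← mul_assoc] at hmain
  simp_rw [Volterra.enorm_sq_eq_ofReal] at hmain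
  have hc : ContinuousOn
      (fun t => ‖S t x - (Sh h t ((V h).orthogonalProjectionOnto x) : H)‖ ^ 2) (Ici 0) :=
    ((hS.continuousOn x).sub
      (continuous_subtype_val.comp_continuousOn ((hSh h).continuousOn _))).norm.pow 2
  have hm := (hc.mono Ioi_subset_Ici_self).aestronglyMeasurable (μ := volume) measurableSet_Ioi
  refine ⟨⟨hm, ?_⟩, ?_⟩
  · rw [hasFiniteIntegral_iff_ofReal (ae_of_all _ fun t => by positivity)]
    exact hmain.trans_lt ENNReal.ofReal_lt_top
  · rw [integral_eq_lintegral_of_nonneg_ae (ae_of_all _ fun t => by positivity) hm]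
    exact ENNReal.toReal_le_of_le_ofReal (by positivity) hmain
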